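/- Let $d\ge 2$ and $r\ge 0$ be integers and $\alpha>0$. Let $g:\mathbb R^d\to\mathbb R$ be homogeneous of order $\alpha$, i.e. $g(x\boldsymbol t)=x^\alpha g(\boldsymbol t)$ for all $x>0$ and $\boldsymbol t\in\mathbb R^d$, and of class $C^{2r+2}$ on $\mathbb R^d\setminus\{0\}$. Let $\hat g$ be the maximum of $g$ on the unit sphere $\mathbb S_{d-1}$, assume $\hat g>0$, and assume that $\mathcal M=\{\boldsymbol v\in\mathbb S_{d-1}:g(\boldsymbol v)=\hat g\}$ consists of finitely many points $\boldsymbol v_1,\dots,\boldsymbol v_k$. For each $j$ let $\boldsymbol u_1,\dots,\boldsymbol u_{d-1}$ be an orthonormal basis of the orthogonal complement of $\boldsymbol v_j$, let $g''_{d-1}(\boldsymbol v_j)$ be the Hessian matrix at $t=0$ of $(t_1,\dots,t_{d-1})\mapsto g(\boldsymbol v_j+t_1\boldsymbol u_1+\dots+t_{d-1}\boldsymbol u_{d-1})$, and assume $$\det\Bigl(\frac{g''_{d-1}(\boldsymbol v_j)}{\alpha\hat g}-I_{d-1}\Bigr)\ne 0,\qquad j=1,\dots,k,$$ that is, each $\boldsymbol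 v_j$ is a non-degenerate point of maximum of $g$ restricted to $\mathbb S_{d-1}$. Let $\boldsymbol\eta$ be a standard Gaussian vector in $\mathbb R^d$. Then, as $x\to\infty$, $$\mathbb P\{g(\boldsymbol\eta)>x\}=(x/\hat g)^{-1/\alpha}e^{-(x/\hat g)^{2/\alpha}/2}\Bigl(h_0+\sum_{i=1}^r h_ix^{-2i/\alpha}+o(x^{-2r/\alpha})\Bigr),$$ where $$h_0=\frac1{\sqrt{2\pi}}\sum_{j=1}^k\Bigl|\det\Bigl(\frac{g''_{d-1}(\boldsymbol v_j)}{\alpha\hat g}-I_{d-1}\Bigr)\Bigr|^{-1/2},$$ and where, for given $d$ and $r$, the coefficients $h_0,\dots,h_r\in\mathbb R$ depend only on $\alpha$, on $\hat g$, and on the derivatives of orders at most $2r+2$ of the restriction of $g$ to the unit sphere (equivalently of $\boldsymbol v\mapsto g(\boldsymbol v/\|\boldsymbol v\|)$) at the points $\boldsymbol v_1,\dots,\boldsymbol v_k$. Moreover, the distribution of $g(\boldsymbol\eta)$ restricted to $\mathbb R\setminus\{0\}$ has a density $p_{g(\boldsymbol\eta)}$, continuous on $\mathbb R\setminus\{0\}$,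 and there are $\tilde h_1,\dots,\tilde h_r\in\mathbb R$ such that, as $x\to\infty$, $$p_{g(\boldsymbol\eta)}(x)=(x/\hat g)^{1/\alpha-1}e^{-(x/\hat g)^{2/\alpha}/2}\Bigl(\frac{h_0}{\alpha\hat g}+\sum_{i=1}^r\tilde h_ix^{-2i/\alpha}+o(x^{-2r/\alpha})\Bigr).$$ -/

import Mathlib

open Filter MeasureTheory ProbabilityTheory
open scoped Topology

noncomputable section

/-- `d`-dimensional Euclidean space. -/
abbrev Euc (d : ℕ) : Type := EuclideanSpace ℝ (Fin d)

/-- `g` is (positively) homogeneous of order `α`. -/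
def IsHomogeneousOfOrder {d : ℕ} (α : ℝ) (g : Euc d → ℝ) : Prop :=
  ∀ x : ℝ, 0 < x → ∀ t : Euc d, g (x • t) = x ^ α * g t

/-- The set of points of the unit sphere at which `g` takes the value `ghat`. -/
def sphereLevelSet {d : ℕ} (g : Euc d → ℝ) (ghat : ℝ) : Set (Euc d) :=
  {v | v ∈ Metric.sphere (0 : Euc d) 1 ∧ g v = ghat}

/-- The Hessian matrix at `t = 0` of
`t ↦ g (v + t₁ u₁ + ⋯ + t_{d-1} u_{d-1})`, where `u₁, …, u_{d-1}` is an orthonormal basis of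
the orthogonal complement of `v`. -/
def tangentHessian {d : ℕ} (g : Euc d → ℝ) (v : Euc d)
    (u : OrthonormalBasis (Fin (d - 1)) ℝ (Submodule.span ℝ {v})ᗮ) :
    Matrix (Fin (d - 1)) (Fin (d - 1)) ℝ :=
  Matrix.of fun i j =>
    iteratedFDeriv ℝ 2 (fun t : Euc (d - 1) => g (v + ∑ l, t l • (u l : Euc d))) 0
      ![EuclideanSpace.single i 1, EuclideanSpace.single j 1]

/-- The determinant `det (g''_{d-1}(v) / (α ghat) - I_{d-1})`. -/
def tangentDet {d : ℕ} (α : ℝ) (g : Euc d → ℝ) (ghat : ℝ) (v : Euc d)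
    (u : OrthonormalBasis (Fin (d - 1)) ℝ (Submodule.span ℝ {v})ᗮ) : ℝ :=
  ((α * ghat)⁻¹ • tangentHessian g v u - 1).det

/-- The restriction of `g` to the unit sphere, seen as the function `v ↦ g (v / ‖v‖)`. -/
def angularPart {d : ℕ} (g : Euc d → ℝ) : Euc d → ℝ :=
  fun v => g (‖v‖⁻¹ • v)

/-- A point together with candidate derivatives of orders `0, …, n` at that point. -/
abbrev PointedJet (d n : ℕ) : Type :=
  Euc d × ((m : Fin (n + 1)) → ContinuousMultilinearMap ℝ (fun _ : Fin (m : ℕ) => Euc d) ℝ)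

/-- The point `v` with the derivatives up to order `n` at `v` of the angular part of `g`. -/
def angularJet {d : ℕ} (n : ℕ) (g : Euc d → ℝ) (v : Euc d) : PointedJet d n :=
  (v, fun m => iteratedFDeriv ℝ (m : ℕ) (angularPart g) v)

/-- The law of `g(η)` for a standard Gaussian vector `η` in `ℝ^d`. -/
def chaosLaw {d : ℕ} (g : Euc d → ℝ) : Measure ℝ :=
  (stdGaussian (Euc d)).map g

/-- The tail `P{g(η) > x}` for a standard Gaussian vector `η` in `ℝ^d`. -/
def chaosTail {d : ℕ} (g : Euc d → ℝ) (x : ℝ) : ℝ :=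
  (stdGaussian (Euc d)).real {v | x < g v}

/-- `p` is the continuous version, on `ℝ \ {0}`, of the density of the restriction of `μ` to
`ℝ \ {0}`. The values of `p` on `ℝ \ {0}` are determined by `μ`. -/
def IsContinuousDensityOffZero (μ : Measure ℝ) (p : ℝ → ℝ) : Prop :=
  ContinuousOn p {0}ᶜ ∧ (∀ x, x ≠ 0 → 0 ≤ p x) ∧
    μ.restrict {0}ᶜ = (volume.restrict {0}ᶜ).withDensity (fun x => ENNReal.ofReal (p x))

end

/-! In polar coordinates η = Rω one has g(η) = R^α g(ω). With a = g(ω)/ghat ≤ 1, the variable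
(g(η)/ghat)^(1/α) has on ρ > 0 the density `radialDensity`: up to (2π)^(-d/2) ρ^(d-1), it is the
integral of a^(-d/α) exp(-ρ² a^(-2/α)/2) over the part of the sphere where a > 0. Multiplied by
exp(ρ²/2), this is a Laplace integral with phase (a^(-2/α) - 1)/2, which is nonnegative and vanishes
only at the points of maximum.

Outside narrow cones around the v_j, compactness bounds a by a constant below 1, so that the
contribution is exponentially small (`exists_angularPart_div_le`, `radialDensity_expansion`). Inside
a cone, the points v_j + w with w ⊥ v_j serve as coordinates. Since g(v_j + w) is (1 + |w|²)^(α/2)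
times the angular part, the Hessian of the phase at w = 0 is I - g''/(α ghat). Maximality makes it
semidefinite, the determinant condition makes it definite, and its Gaussian integral produces
|det|^(-1/2).

The analytic core is `exists_laplace_expansion`. After w = ζ/ρ the integrand is a Gaussian times a
polynomial in ρ⁻¹, up to an error of integral o(ρ^(-2r)). The symmetry (ρ, ζ) ↦ (-ρ, -ζ) kills the
odd powers. The phase is multiplied by ρ², which is why derivatives up to order 2r + 2 are needed.
The coefficients are computed from Taylor polynomials alone, hence are shared by all functions with
the same jet; `exists_local_coefficients` turns this into a function of ghat and of the jet.

The density of g(η) then follows by the substitution ρ = (x/ghat)^(1/α). For the tail,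
`tail_expansion` first integrates the expansion in ρ, matching it with functions whose Gaussian
tails are explicit. -/

open scoped ENNReal

/-! ### Functions of subgaussian growth and polynomials with such coefficients -/

section GaussianGrowth

variable {E : Type*} [NormedAddCommGroup E] [InnerProductSpace ℝ E]

theorem exists_pow_le_mul_exp_sq (l : ℕ) {η : ℝ} (hη : 0 < η) :
    ∃ K, 0 ≤ K ∧ ∀ x : ℝ, 0 ≤ x → x ^ l ≤ K * Real.exp (η * x ^ 2) := by
  refine ⟨1 + l.factorial / η ^ l, by positivity, fun x hx => ?_⟩
  have h1 : x ^ l ≤ 1 + x ^ (2 * l) := by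
    rcases le_total x 1 with h | h
    · exact (pow_le_one₀ hx h).trans (le_add_of_nonneg_right (by positivity))
    · exact (pow_le_pow_right₀ h (by omega)).trans (le_add_of_nonneg_left zero_le_one)
  have h2 := Real.pow_div_factorial_le_exp (η * x ^ 2) (by positivity) l
  have h3 : x ^ (2 * l) ≤ l.factorial / η ^ l * Real.exp (η * x ^ 2) := by
    calc x ^ (2 * l) = l.factorial / η ^ l * ((η * x ^ 2) ^ l / l.factorial) := by
          rw [pow_mul, mul_pow]
          field_simp
      _ ≤ _ := by gcongr
  have h4 : 1 ≤ Real.exp (η * x ^ 2) := Real.one_le_exp (by positivity)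
  linarith

/-- Continuous functions growing slower than `exp (η ‖x‖ ^ 2)` for every `η > 0`. -/
def growthAlgebra (E : Type*) [NormedAddCommGroup E] [InnerProductSpace ℝ E] :
    Subalgebra ℝ (E → ℝ) where
  carrier := {f | Continuous f ∧ ∀ η > 0, ∃ K, 0 ≤ K ∧ ∀ ζ, |f ζ| ≤ K * Real.exp (η * ‖ζ‖ ^ 2)}
  mul_mem' := by
    rintro f g ⟨hf, hf'⟩ ⟨hg, hg'⟩
    refine ⟨hf.mul hg, fun η hη => ?_⟩
    obtain ⟨K, hK, hfK⟩ := hf' (η / 2) (by positivity)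
    obtain ⟨L, hL, hgL⟩ := hg' (η / 2) (by positivity)
    refine ⟨K * L, by positivity, fun ζ => ?_⟩
    calc |f ζ * g ζ| = |f ζ| * |g ζ| := abs_mul _ _
      _ ≤ (K * Real.exp (η / 2 * ‖ζ‖ ^ 2)) * (L * Real.exp (η / 2 * ‖ζ‖ ^ 2)) := by
          gcongr
          · exact hfK ζ
          · exact hgL ζ
      _ = K * L * (Real.exp (η / 2 * ‖ζ‖ ^ 2) * Real.exp (η / 2 * ‖ζ‖ ^ 2)) := by ring
      _ = _ := by rw [← Real.exp_add]; ring_nf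
  add_mem' := by
    rintro f g ⟨hf, hf'⟩ ⟨hg, hg'⟩
    refine ⟨hf.add hg, fun η hη => ?_⟩
    obtain ⟨K, hK, hfK⟩ := hf' η hη
    obtain ⟨L, hL, hgL⟩ := hg' η hη
    refine ⟨K + L, by positivity, fun ζ => ?_⟩
    rw [add_mul]
    exact (abs_add_le _ _).trans (add_le_add (hfK ζ) (hgL ζ))
  algebraMap_mem' := by
    intro a
    refine ⟨continuous_const, fun η hη => ⟨|a|, abs_nonneg a, fun ζ => ?_⟩⟩
    exact le_mul_of_one_le_right (abs_nonneg a) (Real.one_le_exp (by positivity))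

/-- `f` is continuous and homogeneous of degree `l`, including for negative scalars. -/
def IsContHomogeneous (l : ℕ) (f : E → ℝ) : Prop :=
  Continuous f ∧ ∀ (t : ℝ) ζ, f (t • ζ) = t ^ l * f ζ

theorem IsContHomogeneous.exists_bound [FiniteDimensional ℝ E] {l : ℕ} {f : E → ℝ}
    (hf : IsContHomogeneous l f) : ∃ C, 0 ≤ C ∧ ∀ ζ, |f ζ| ≤ C * ‖ζ‖ ^ l := by
  obtain ⟨C, hC⟩ := (isCompact_closedBall (0 : E) 1).exists_bound_of_continuousOn
    hf.1.continuousOn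
  have hC0 : 0 ≤ C := (norm_nonneg _).trans (hC 0 (by simp))
  refine ⟨C, hC0, fun ζ => ?_⟩
  rcases eq_or_ne ζ 0 with rfl | h
  · have h0 := hf.2 0 0
    rw [zero_smul] at h0
    rcases Nat.eq_zero_or_pos l with rfl | hl
    · simpa using hC 0 (by simp)
    · rw [zero_pow hl.ne'] at h0
      rw [h0]; simp [hl.ne']
  · have hn : ‖ζ‖ ≠ 0 := norm_ne_zero_iff.2 h
    have h1 : f ζ = ‖ζ‖ ^ l * f (‖ζ‖⁻¹ • ζ) := by
      rw [← hf.2, smul_smul, mul_inv_cancel₀ hn, one_smul]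
    have h2 := hC (‖ζ‖⁻¹ • ζ) (by simp [norm_smul, hn])
    rw [Real.norm_eq_abs] at h2
    rw [h1, abs_mul, abs_of_nonneg (by positivity : 0 ≤ ‖ζ‖ ^ l), mul_comm]
    gcongr

theorem norm_pow_mem_growthAlgebra (l : ℕ) : (fun ζ : E => ‖ζ‖ ^ l) ∈ growthAlgebra E := by
  refine ⟨by fun_prop, fun η hη => ?_⟩
  obtain ⟨K, hK, h⟩ := exists_pow_le_mul_exp_sq l hη
  refine ⟨K, hK, fun ζ => ?_⟩
  rw [abs_of_nonneg (by positivity)]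
  exact h _ (norm_nonneg _)

theorem IsContHomogeneous.mem_growthAlgebra [FiniteDimensional ℝ E] {l : ℕ} {f : E → ℝ}
    (hf : IsContHomogeneous l f) : f ∈ growthAlgebra E := by
  refine ⟨hf.1, fun η hη => ?_⟩
  obtain ⟨C, hC, h⟩ := hf.exists_bound
  obtain ⟨K, hK, h'⟩ := exists_pow_le_mul_exp_sq l hη
  refine ⟨C * K, by positivity, fun ζ => (h ζ).trans ?_⟩
  rw [mul_assoc]
  gcongr
  exact h' _ (norm_nonneg _)

open Polynomial in
/-- The value at `ε` of a polynomial whose coefficients are functions of slow growth. -/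
noncomputable def evalGrowth (B : (growthAlgebra E)[X]) (ε : ℝ) : growthAlgebra E :=
  B.eval (algebraMap ℝ (growthAlgebra E) ε)

open Polynomial in
-- Uniformity in `ε` provides a majorant independent of `ρ = ε⁻¹ ≥ 1` for dominated convergence.
theorem exists_bound_eval_growthAlgebra (B : (growthAlgebra E)[X]) {η : ℝ} (hη : 0 < η) :
    ∃ K, 0 ≤ K ∧ ∀ ε : ℝ, |ε| ≤ 1 → ∀ ζ,
      |(evalGrowth B ε : E → ℝ) ζ| ≤ K * Real.exp (η * ‖ζ‖ ^ 2) := by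
  induction B using Polynomial.induction_on' with
  | add p q hp hq =>
    obtain ⟨K, hK, h⟩ := hp
    obtain ⟨L, hL, h'⟩ := hq
    refine ⟨K + L, by positivity, fun ε hε ζ => ?_⟩
    rw [evalGrowth, eval_add, add_mul]
    exact (abs_add_le _ _).trans (add_le_add (h ε hε ζ) (h' ε hε ζ))
  | monomial k a =>
    obtain ⟨K, hK, h⟩ := a.2.2 η hη
    refine ⟨K, hK, fun ε hε ζ => ?_⟩
    rw [evalGrowth, eval_monomial]
    have : ((a * (algebraMap ℝ (growthAlgebra E) ε) ^ k : growthAlgebra E) : E → ℝ) ζ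
        = (a : E → ℝ) ζ * ε ^ k := rfl
    rw [this, abs_mul, abs_pow]
    exact (mul_le_of_le_one_right (abs_nonneg _) (pow_le_one₀ (abs_nonneg _) hε)).trans (h ζ)

open Polynomial in
theorem eval_growthAlgebra_apply (B : (growthAlgebra E)[X]) (ε : ℝ) (ζ : E) :
    (evalGrowth B ε : E → ℝ) ζ =
      ∑ k ∈ Finset.range (B.natDegree + 1), (B.coeff k : E → ℝ) ζ * ε ^ k := by
  rw [evalGrowth, eval_eq_sum_range]
  simp only [AddSubmonoidClass.coe_finsetSum, Finset.sum_apply]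
  rfl

variable [FiniteDimensional ℝ E] [MeasurableSpace E] [BorelSpace E]

theorem integrable_exp_neg_mul_norm_sq {c : ℝ} (hc : 0 < c) :
    Integrable (fun ζ : E => Real.exp (-(c * ‖ζ‖ ^ 2))) := by
  have h := (GaussianFourier.integrable_cexp_neg_mul_sq_norm_add (b := (c : ℂ))
    (by simpa using hc) 0 (0 : E)).norm
  refine h.congr (Eventually.of_forall fun ζ => ?_)
  simp only [Complex.norm_exp]
  congr 1
  simp [← Complex.ofReal_pow]

theorem integrable_growthAlgebra_mul_exp {f : E → ℝ} (hf : f ∈ growthAlgebra E) {c : ℝ}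
    (hc : 0 < c) : Integrable (fun ζ => f ζ * Real.exp (-(c * ‖ζ‖ ^ 2))) := by
  obtain ⟨K, hK, h⟩ := hf.2 (c / 2) (by positivity)
  have hf1 := hf.1
  refine ((integrable_exp_neg_mul_norm_sq (E := E) (half_pos hc)).const_mul K).mono'
    (by fun_prop) (Eventually.of_forall fun ζ => ?_)
  rw [Real.norm_eq_abs, abs_mul, Real.abs_exp]
  calc |f ζ| * Real.exp (-(c * ‖ζ‖ ^ 2)) ≤
      (K * Real.exp (c / 2 * ‖ζ‖ ^ 2)) * Real.exp (-(c * ‖ζ‖ ^ 2)) := by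
        gcongr; exact h ζ
    _ = _ := by rw [mul_assoc, ← Real.exp_add]; ring_nf

theorem integrable_growthAlgebra_mul_exp_of_le {f q : E → ℝ} (hf : f ∈ growthAlgebra E)
    (hq : Continuous q) {c : ℝ} (hc : 0 < c) (h : ∀ ζ, c * ‖ζ‖ ^ 2 ≤ q ζ) :
    Integrable (fun ζ => f ζ * Real.exp (-(q ζ))) := by
  have hf1 := hf.1
  refine (integrable_growthAlgebra_mul_exp hf hc).mono (by fun_prop)
    (Eventually.of_forall fun ζ => ?_)
  simp only [norm_mul, Real.norm_eq_abs, Real.abs_exp]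
  gcongr
  exact h ζ

end GaussianGrowth

/-! ### Truncated exponentials and even polynomials -/

theorem abs_exp_sub_exp_le (x y m : ℝ) (hx : x ≤ m) (hy : y ≤ m) :
    |Real.exp x - Real.exp y| ≤ Real.exp m * |x - y| := by
  wlog h : y ≤ x generalizing x y
  · rw [abs_sub_comm, abs_sub_comm x y]
    exact this y x hy hx (le_of_not_ge h)
  rw [abs_of_nonneg (sub_nonneg.2 (Real.exp_le_exp.2 h)), abs_of_nonneg (sub_nonneg.2 h)]
  have h1 : Real.exp x - Real.exp y = Real.exp x * (1 - Real.exp (y - x)) := by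
    rw [mul_sub, ← Real.exp_add]; ring_nf
  rw [h1]
  have h2 := Real.add_one_le_exp (y - x)
  have h3 : Real.exp (y - x) ≤ 1 := Real.exp_le_one_iff.2 (by linarith)
  exact mul_le_mul (Real.exp_le_exp.2 hx) (by linarith) (by linarith) (Real.exp_pos _).le

theorem abs_exp_sub_sum_le (x : ℝ) (n : ℕ) :
    |Real.exp x - ∑ m ∈ Finset.range n, x ^ m / m.factorial| ≤ |x| ^ n * Real.exp |x| := by
  have := Complex.norm_exp_sub_sum_le_norm_mul_exp (x : ℂ) n
  rw [Complex.norm_real, Real.norm_eq_abs] at this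
  rw [← Real.norm_eq_abs, ← Complex.norm_real]
  push_cast
  exact this

/-- The error committed when replacing `ψ exp (-x)` by a truncated exponential series. -/
theorem abs_mul_exp_sub_truncated_le {A x y ψ P c : ℝ} (n : ℕ) (hA : 2 * c ≤ A) (hx : |x| ≤ c)
    (hy : |y| ≤ c) :
    |ψ * Real.exp (-(A + x)) -
        P * (∑ m ∈ Finset.range n, (-y) ^ m / m.factorial) * Real.exp (-A)| ≤
      Real.exp (-c) * (|ψ - P| + |P| * |x - y| + |P| * |y| ^ n) := by
  have hc : Real.exp (-A) * Real.exp c ≤ Real.exp (-c) := by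
    rw [← Real.exp_add]; gcongr; linarith
  have h1 : |Real.exp (-x)| ≤ Real.exp c := by
    rw [Real.abs_exp]; gcongr; linarith [neg_abs_le x]
  have h2 := abs_exp_sub_exp_le (-x) (-y) c (by linarith [neg_abs_le x]) (by linarith [neg_abs_le y])
  have h3 := abs_exp_sub_sum_le (-y) n
  have h4 : |(-y)| ^ n * Real.exp |(-y)| ≤ Real.exp c * |y| ^ n := by
    rw [abs_neg, mul_comm]; gcongr
  have e : ψ * Real.exp (-(A + x)) -
        P * (∑ m ∈ Finset.range n, (-y) ^ m / m.factorial) * Real.exp (-A) =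
      Real.exp (-A) * ((ψ - P) * Real.exp (-x) + P * (Real.exp (-x) - Real.exp (-y)) +
        P * (Real.exp (-y) - ∑ m ∈ Finset.range n, (-y) ^ m / m.factorial)) := by
    rw [neg_add, Real.exp_add]; ring
  rw [e, abs_mul, Real.abs_exp]
  have h5 : |-x - -y| = |x - y| := by rw [← abs_neg]; ring_nf
  rw [h5] at h2
  calc _ ≤ Real.exp (-A) * (|ψ - P| * Real.exp c + |P| * (Real.exp c * |x - y|) +
        |P| * (Real.exp c * |y| ^ n)) := by
        gcongr
        refine (abs_add_three _ _ _).trans ?_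
        rw [abs_mul, abs_mul, abs_mul]
        gcongr
        exact h3.trans h4
    _ = Real.exp (-A) * Real.exp c * (|ψ - P| + |P| * |x - y| + |P| * |y| ^ n) := by ring
    _ ≤ _ := by gcongr

open Polynomial in
-- The point `0` is left out because parity will be read off from values at `x = ρ⁻¹`; at `0` the
-- equality is automatic.
theorem Polynomial.coeff_eq_zero_of_even {q : ℝ[X]} (h : ∀ x, x ≠ 0 → q.eval (-x) = q.eval x)
    {k : ℕ} (hk : Odd k) : q.coeff k = 0 := by
  have h1 : q.comp (-X) = q := by
    refine Polynomial.funext fun x => ?_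
    rcases eq_or_ne x 0 with rfl | hx
    · simp
    · simp [h x hx]
  have h2 : (q.comp (-X)).coeff k = (-1) ^ k * q.coeff k := by
    have : (-X : ℝ[X]) = C (-1) * X := by simp
    rw [this, comp_C_mul_X_coeff, mul_comm]
  rw [h1, hk.neg_one_pow] at h2
  linarith

open Polynomial Asymptotics in
-- Odd coefficients vanish, so after removal of the even monomials of degree at most `2 * r` the
-- difference is divisible by `X ^ (2 * r + 1)`, which leaves one spare factor `ρ⁻¹`.
theorem Polynomial.isLittleO_eval_inv_sub_sum_of_even {q : ℝ[X]}
    (h : ∀ x, x ≠ 0 → q.eval (-x) = q.eval x) (r : ℕ) :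
    (fun ρ : ℝ => q.eval ρ⁻¹ - ∑ i ∈ Finset.range (r + 1), q.coeff (2 * i) * ρ⁻¹ ^ (2 * i))
      =o[atTop] fun ρ => ρ⁻¹ ^ (2 * r) := by
  obtain ⟨q', hq'⟩ : X ^ (2 * r + 1) ∣
      q - ∑ i ∈ Finset.range (r + 1), C (q.coeff (2 * i)) * X ^ (2 * i) := by
    rw [X_pow_dvd_iff]
    intro k hk
    rw [coeff_sub, finsetSum_coeff]
    simp only [coeff_C_mul, coeff_X_pow, mul_ite, mul_one, mul_zero]
    rcases Nat.even_or_odd' k with ⟨j, rfl | rfl⟩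
    · rw [Finset.sum_eq_single j]
      · simp
      · intro b _ hb; rw [if_neg (by omega)]
      · intro hj; exact absurd (Finset.mem_range.2 (by omega)) hj
    · rw [coeff_eq_zero_of_even h ⟨j, rfl⟩, zero_sub, neg_eq_zero]
      exact Finset.sum_eq_zero fun b _ => by rw [if_neg (by omega)]
  have e : (fun ρ : ℝ => q.eval ρ⁻¹ -
      ∑ i ∈ Finset.range (r + 1), q.coeff (2 * i) * ρ⁻¹ ^ (2 * i)) =
      fun ρ => ρ⁻¹ ^ (2 * r) * (ρ⁻¹ * q'.eval ρ⁻¹) := by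
    funext ρ
    have := congrArg (eval ρ⁻¹) hq'
    simp only [eval_sub, eval_finsetSum, eval_mul, eval_C, eval_pow, eval_X] at this
    rw [this]; ring
  rw [e]
  have h0 : Tendsto (fun ρ : ℝ => ρ⁻¹ * q'.eval ρ⁻¹) atTop (𝓝 0) := by
    have h1 : Tendsto (fun x : ℝ => x * q'.eval x) (𝓝 0) (𝓝 (0 * q'.eval 0)) :=
      (continuous_id.mul q'.continuous).tendsto 0
    rw [zero_mul] at h1
    exact h1.comp tendsto_inv_atTop_zero
  simpa using (isBigO_refl (fun ρ : ℝ => ρ⁻¹ ^ (2 * r)) atTop).mul_isLittleO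
    ((isLittleO_one_iff ℝ).2 h0)

/-! ### Polynomial model of the rescaled Laplace integrand -/

section Laplace

variable {E : Type*} [NormedAddCommGroup E] [InnerProductSpace ℝ E]

open Polynomial in
/-- The polynomial in `ε` with value `P (ε ζ) ∑ m ≤ 2 r, (- ε⁻² T (ε ζ)) ^ m / m!`, where
`P = ∑ l, p l` and `T = ∑ l ≥ 3, s l`. -/
noncomputable def laplacePoly (r : ℕ) (s p : ℕ → growthAlgebra E) : (growthAlgebra E)[X] :=
  (∑ l ∈ Finset.range (2 * r + 3), C (p l) * X ^ l) *
    ∑ m ∈ Finset.range (2 * r + 1), C (algebraMap ℝ (growthAlgebra E) ((m.factorial : ℝ)⁻¹)) *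
      (-(∑ l ∈ Finset.Icc 3 (2 * r + 2), C (s l) * X ^ (l - 2))) ^ m

theorem evalGrowth_laplacePoly (r : ℕ) (s p : ℕ → growthAlgebra E) (ε : ℝ) (ζ : E) :
    (evalGrowth (laplacePoly r s p) ε : E → ℝ) ζ =
      (∑ l ∈ Finset.range (2 * r + 3), (p l : E → ℝ) ζ * ε ^ l) *
        ∑ m ∈ Finset.range (2 * r + 1),
          (-(∑ l ∈ Finset.Icc 3 (2 * r + 2), (s l : E → ℝ) ζ * ε ^ (l - 2))) ^ m /
            m.factorial := by
  have hmul : ∀ a b : growthAlgebra E, ((a * b : growthAlgebra E) : E → ℝ) ζ =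
    (a : E → ℝ) ζ * (b : E → ℝ) ζ := fun _ _ => rfl
  have hneg : ∀ a : growthAlgebra E, ((-a : growthAlgebra E) : E → ℝ) ζ =
    -(a : E → ℝ) ζ := fun _ => rfl
  have hpow : ∀ (a : growthAlgebra E) (m : ℕ), ((a ^ m : growthAlgebra E) : E → ℝ) ζ =
    ((a : E → ℝ) ζ) ^ m := fun _ _ => rfl
  have halg : ∀ a : ℝ, ((algebraMap ℝ (growthAlgebra E) a : growthAlgebra E) : E → ℝ) ζ = a :=
    fun _ => rfl
  simp only [evalGrowth, laplacePoly, Polynomial.eval_mul, Polynomial.eval_finsetSum,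
    Polynomial.eval_pow, Polynomial.eval_neg, Polynomial.eval_C, Polynomial.eval_X, hmul,
    AddSubmonoidClass.coe_finsetSum, Finset.sum_apply, hneg, hpow, halg]
  congr 1
  refine Finset.sum_congr rfl fun m _ => ?_
  rw [div_eq_inv_mul]

/-- By homogeneity the value at `ρ⁻¹` is a function of `ρ ^ 2` and `ρ⁻¹ • ζ` only. This form can be
compared with the rescaled integrand, and it is invariant under `(ρ, ζ) ↦ (-ρ, -ζ)`. -/
theorem evalGrowth_laplacePoly_inv (r : ℕ) (s p : ℕ → growthAlgebra E)
    (hs : ∀ l, IsContHomogeneous l (s l : E → ℝ)) (hp : ∀ l, IsContHomogeneous l (p l : E → ℝ))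
    {ρ : ℝ} (hρ : ρ ≠ 0) (ζ : E) :
    (evalGrowth (laplacePoly r s p) ρ⁻¹ : E → ℝ) ζ =
      (∑ l ∈ Finset.range (2 * r + 3), (p l : E → ℝ) (ρ⁻¹ • ζ)) *
        ∑ m ∈ Finset.range (2 * r + 1),
          (-(ρ ^ 2 * ∑ l ∈ Finset.Icc 3 (2 * r + 2), (s l : E → ℝ) (ρ⁻¹ • ζ))) ^ m /
            m.factorial := by
  rw [evalGrowth_laplacePoly]
  congr 1
  · exact Finset.sum_congr rfl fun l _ => by rw [(hp l).2, mul_comm]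
  · refine Finset.sum_congr rfl fun m _ => ?_
    congr 3
    rw [Finset.mul_sum]
    refine Finset.sum_congr rfl fun l hl => ?_
    have hl2 : 2 ≤ l := le_trans (by norm_num) (Finset.mem_Icc.1 hl).1
    obtain ⟨j, rfl⟩ := Nat.exists_eq_add_of_le hl2
    rw [(hs _).2, Nat.add_sub_cancel_left, pow_add]
    field_simp

theorem isBigO_sum_homogeneous [FiniteDimensional ℝ E] {s : ℕ → E → ℝ} (hs : ∀ l, IsContHomogeneous l (s l)) (a b : ℕ) :
    (fun w => ∑ l ∈ Finset.Icc a b, s l w) =O[𝓝 0] fun w => ‖w‖ ^ a := by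
  refine Asymptotics.IsBigO.fun_sum fun l hl => ?_
  obtain ⟨C, hC, h⟩ := (hs l).exists_bound
  refine Asymptotics.IsBigO.of_bound C ?_
  filter_upwards [Metric.ball_mem_nhds (0 : E) one_pos] with w hw
  rw [Real.norm_eq_abs, norm_pow, norm_norm]
  refine (h w).trans ?_
  gcongr ?_ * ?_
  exact pow_le_pow_of_le_one (norm_nonneg _) (by simpa using (mem_ball_zero_iff.1 hw).le)
    (Finset.mem_Icc.1 hl).1

open Asymptotics in
/-- Local bounds used to dominate the rescaled integrand. -/
theorem eventually_laplace_bounds [FiniteDimensional ℝ E] (r : ℕ) {s p : ℕ → E → ℝ}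
    (hs : ∀ l, IsContHomogeneous l (s l)) (hp : ∀ l, IsContHomogeneous l (p l))
    {c : ℝ} (hc : 0 < c) :
    ∃ C, 0 ≤ C ∧ ∀ S ψ : E → ℝ,
      ((fun w => S w - ∑ l ∈ Finset.Icc 2 (2 * r + 2), s l w) =o[𝓝 0]
        fun w => ‖w‖ ^ (2 * r + 2)) →
      ((fun w => ψ w - ∑ l ∈ Finset.range (2 * r + 3), p l w) =o[𝓝 0]
        fun w => ‖w‖ ^ (2 * r + 2)) →
      ∀ᶠ w in 𝓝 (0 : E),
        |ψ w - ∑ l ∈ Finset.range (2 * r + 3), p l w| ≤ ‖w‖ ^ (2 * r + 2) ∧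
        |S w - ∑ l ∈ Finset.Icc 2 (2 * r + 2), s l w| ≤ ‖w‖ ^ (2 * r + 2) ∧
        |∑ l ∈ Finset.range (2 * r + 3), p l w| ≤ C ∧
        |∑ l ∈ Finset.Icc 3 (2 * r + 2), s l w| ≤ C * ‖w‖ ^ 3 ∧
        |S w - s 2 w| ≤ c / 2 * ‖w‖ ^ 2 ∧
        |∑ l ∈ Finset.Icc 3 (2 * r + 2), s l w| ≤ c / 2 * ‖w‖ ^ 2 := by
  obtain ⟨C₁, hC₁⟩ := (isBigO_sum_homogeneous hp 0 (2 * r + 2)).bound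
  obtain ⟨C₂, hC₂⟩ := (isBigO_sum_homogeneous hs 3 (2 * r + 2)).bound
  have hrange : Finset.range (2 * r + 3) = Finset.Icc 0 (2 * r + 2) := by
    ext; simp; omega
  refine ⟨max 0 (max C₁ C₂), le_max_left _ _, fun S ψ hS hψ => ?_⟩
  have hlt : Tendsto (fun w : E => max 0 (max C₁ C₂) * ‖w‖) (𝓝 0) (𝓝 0) := by
    have : Continuous fun w : E => max 0 (max C₁ C₂) * ‖w‖ := by fun_prop
    simpa using this.tendsto 0
  -- A quarter of `c` goes to the Peano remainder and a quarter to the terms of degree at least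
  -- three; half of the coercivity of `s 2` stays available for a Gaussian majorant.
  filter_upwards [hψ.bound one_pos, hS.bound one_pos, hS.bound (by positivity : 0 < c / 4), hC₁, hC₂,
    hlt.eventually (gt_mem_nhds (by positivity : 0 < c / 4)),
    Metric.ball_mem_nhds (0 : E) one_pos] with w h1 h2 h3 h4 h5 h6 h7
  have hw1 : ‖w‖ ≤ 1 := (mem_ball_zero_iff.1 h7).le
  simp only [Real.norm_eq_abs, one_mul, pow_zero, abs_one, mul_one] at h1 h2 h3 h4 h5
  rw [abs_of_nonneg (by positivity : 0 ≤ ‖w‖ ^ (2 * r + 2))] at h1 h2 h3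
  rw [abs_of_nonneg (by positivity : 0 ≤ ‖w‖ ^ 3)] at h5
  have h5' : |∑ l ∈ Finset.Icc 3 (2 * r + 2), s l w| ≤ max 0 (max C₁ C₂) * ‖w‖ ^ 3 :=
    h5.trans (by gcongr; exact (le_max_right _ _).trans (le_max_right _ _))
  have h8 : |∑ l ∈ Finset.Icc 3 (2 * r + 2), s l w| ≤ c / 4 * ‖w‖ ^ 2 := by
    refine h5'.trans ?_
    calc _ = max 0 (max C₁ C₂) * ‖w‖ * ‖w‖ ^ 2 := by ring
      _ ≤ _ := by gcongr
  have h9 : ‖w‖ ^ (2 * r + 2) ≤ ‖w‖ ^ 2 := pow_le_pow_of_le_one (norm_nonneg _) hw1 (by omega)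
  have hsum : ∑ l ∈ Finset.Icc 2 (2 * r + 2), s l w =
      s 2 w + ∑ l ∈ Finset.Icc 3 (2 * r + 2), s l w := by
    rw [← Finset.insert_Icc_add_one_left_eq_Icc (by omega : 2 ≤ 2 * r + 2),
      Finset.sum_insert (by simp)]
    rfl
  refine ⟨h1, h2, ?_, h5', ?_, ?_⟩
  · rw [hrange]
    exact h4.trans ((le_max_left _ _).trans (le_max_right _ _))
  · have e : S w - s 2 w = (S w - ∑ l ∈ Finset.Icc 2 (2 * r + 2), s l w) +
        ∑ l ∈ Finset.Icc 3 (2 * r + 2), s l w := by rw [hsum]; ring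
    rw [e]
    calc _ ≤ c / 4 * ‖w‖ ^ (2 * r + 2) + c / 4 * ‖w‖ ^ 2 := (abs_add_le _ _).trans (add_le_add h3 h8)
      _ ≤ c / 4 * ‖w‖ ^ 2 + c / 4 * ‖w‖ ^ 2 := by gcongr
      _ = _ := by ring
  · refine h8.trans ?_
    gcongr
    norm_num

/-- Pointwise comparison of the rescaled integrand with its polynomial approximation. -/
theorem rescaled_sub_le (r : ℕ) (s p : ℕ → growthAlgebra E)
    (hs : ∀ l, IsContHomogeneous l (s l : E → ℝ)) (hp : ∀ l, IsContHomogeneous l (p l : E → ℝ))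
    {c C : ℝ} (hC : 0 ≤ C) (hc : ∀ ζ, c * ‖ζ‖ ^ 2 ≤ (s 2 : E → ℝ) ζ) {S ψ : E → ℝ}
    {ρ : ℝ} (hρ : 1 ≤ ρ) (ζ : E)
    (h : (fun w => |ψ w - ∑ l ∈ Finset.range (2 * r + 3), (p l : E → ℝ) w| ≤ ‖w‖ ^ (2 * r + 2) ∧
        |S w - ∑ l ∈ Finset.Icc 2 (2 * r + 2), (s l : E → ℝ) w| ≤ ‖w‖ ^ (2 * r + 2) ∧
        |∑ l ∈ Finset.range (2 * r + 3), (p l : E → ℝ) w| ≤ C ∧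
        |∑ l ∈ Finset.Icc 3 (2 * r + 2), (s l : E → ℝ) w| ≤ C * ‖w‖ ^ 3 ∧
        |S w - (s 2 : E → ℝ) w| ≤ c / 2 * ‖w‖ ^ 2 ∧
        |∑ l ∈ Finset.Icc 3 (2 * r + 2), (s l : E → ℝ) w| ≤ c / 2 * ‖w‖ ^ 2) (ρ⁻¹ • ζ)) :
    |ρ ^ (2 * r) * (ψ (ρ⁻¹ • ζ) * Real.exp (-(ρ ^ 2 * S (ρ⁻¹ • ζ))) -
      (evalGrowth (laplacePoly r s p) ρ⁻¹ : E → ℝ) ζ * Real.exp (-(s 2 : E → ℝ) ζ))| ≤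
    Real.exp (-(c / 2 * ‖ζ‖ ^ 2)) * (‖ζ‖ ^ (2 * r + 2) * ρ⁻¹ ^ 2 +
      C * (ρ ^ (2 * r + 2) * |S (ρ⁻¹ • ζ) -
        ∑ l ∈ Finset.Icc 2 (2 * r + 2), (s l : E → ℝ) (ρ⁻¹ • ζ)|) +
      C * (C * ‖ζ‖ ^ 3) ^ (2 * r + 1) * ρ⁻¹) := by
  have hρ0 : 0 < ρ := by linarith
  obtain ⟨h1, h2, h3, h4, h5, h6⟩ := h
  rw [evalGrowth_laplacePoly_inv r s p hs hp hρ0.ne']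
  set w := ρ⁻¹ • ζ with hw
  have hζ : ζ = ρ • w := by rw [hw, smul_smul, mul_inv_cancel₀ hρ0.ne', one_smul]
  have hnw : ‖w‖ = ρ⁻¹ * ‖ζ‖ := by rw [hw, norm_smul, Real.norm_of_nonneg (by positivity)]
  have hnζ : ‖ζ‖ = ρ * ‖w‖ := by rw [hnw]; field_simp
  have hs2 : (s 2 : E → ℝ) ζ = ρ ^ 2 * (s 2 : E → ℝ) w := by rw [hζ, (hs 2).2]
  have hsum : ∑ l ∈ Finset.Icc 2 (2 * r + 2), (s l : E → ℝ) w =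
      (s 2 : E → ℝ) w + ∑ l ∈ Finset.Icc 3 (2 * r + 2), (s l : E → ℝ) w := by
    rw [← Finset.insert_Icc_add_one_left_eq_Icc (by omega : 2 ≤ 2 * r + 2),
      Finset.sum_insert (by simp)]
    rfl
  set P := ∑ l ∈ Finset.range (2 * r + 3), (p l : E → ℝ) w
  set T := ∑ l ∈ Finset.Icc 3 (2 * r + 2), (s l : E → ℝ) w
  set Z := ∑ l ∈ Finset.Icc 2 (2 * r + 2), (s l : E → ℝ) w
  have hx : |ρ ^ 2 * (S w - (s 2 : E → ℝ) w)| ≤ c / 2 * ‖ζ‖ ^ 2 := by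
    rw [abs_mul, abs_of_nonneg (by positivity), hnζ]
    calc _ ≤ ρ ^ 2 * (c / 2 * ‖w‖ ^ 2) := by gcongr
      _ = _ := by ring
  have hy : |ρ ^ 2 * T| ≤ c / 2 * ‖ζ‖ ^ 2 := by
    rw [abs_mul, abs_of_nonneg (by positivity), hnζ]
    calc _ ≤ ρ ^ 2 * (c / 2 * ‖w‖ ^ 2) := by gcongr
      _ = _ := by ring
  -- The phase is `s 2 ζ` plus a perturbation of at most half its lower bound `c * ‖ζ‖ ^ 2`; the
  -- exponential series is cut after `m = 2 * r`.
  have key := abs_mul_exp_sub_truncated_le (ψ := ψ w) (P := P) (2 * r + 1)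
    (A := (s 2 : E → ℝ) ζ) (c := c / 2 * ‖ζ‖ ^ 2) (by linarith [hc ζ]) hx hy
  have e1 : (s 2 : E → ℝ) ζ + ρ ^ 2 * (S w - (s 2 : E → ℝ) w) = ρ ^ 2 * S w := by
    rw [hs2]; ring
  rw [e1] at key
  have hxy : |ρ ^ 2 * (S w - (s 2 : E → ℝ) w) - ρ ^ 2 * T| = ρ ^ 2 * |S w - Z| := by
    rw [← mul_sub, abs_mul, abs_of_nonneg (by positivity : 0 ≤ ρ ^ 2), hsum, sub_sub]
  rw [hxy] at key
  rw [abs_mul, abs_of_nonneg (by positivity : 0 ≤ ρ ^ (2 * r))]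
  -- `T` starts at degree three, so `ρ ^ 2 * T` gains a factor `ρ⁻¹`; its power `2 * r + 1` beats
  -- the prefactor `ρ ^ (2 * r)` by one `ρ⁻¹`.
  have hT : |ρ ^ 2 * T| ≤ C * ‖ζ‖ ^ 3 * ρ⁻¹ := by
    rw [abs_mul, abs_of_nonneg (by positivity : 0 ≤ ρ ^ 2), hnζ]
    calc _ ≤ ρ ^ 2 * (C * ‖w‖ ^ 3) := by gcongr
      _ = _ := by field_simp
  have hρr : ρ ^ (2 * r) * (ρ⁻¹ ^ (2 * r + 1)) = ρ⁻¹ := by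
    rw [pow_succ, ← mul_assoc, ← mul_pow, mul_inv_cancel₀ hρ0.ne', one_pow, one_mul]
  calc _ ≤ ρ ^ (2 * r) * (Real.exp (-(c / 2 * ‖ζ‖ ^ 2)) *
        (|ψ w - P| + |P| * (ρ ^ 2 * |S w - Z|) + |P| * |ρ ^ 2 * T| ^ (2 * r + 1))) := by gcongr
    _ ≤ ρ ^ (2 * r) * (Real.exp (-(c / 2 * ‖ζ‖ ^ 2)) *
        (‖w‖ ^ (2 * r + 2) + C * (ρ ^ 2 * |S w - Z|) +
          C * (C * ‖ζ‖ ^ 3 * ρ⁻¹) ^ (2 * r + 1))) := by gcongr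
    _ = Real.exp (-(c / 2 * ‖ζ‖ ^ 2)) * (ρ ^ (2 * r) * ‖w‖ ^ (2 * r + 2) +
        C * (ρ ^ (2 * r + 2) * |S w - Z|) +
          C * (C * ‖ζ‖ ^ 3) ^ (2 * r + 1) * (ρ ^ (2 * r) * (ρ⁻¹ ^ (2 * r + 1)))) := by
        rw [mul_pow (C * ‖ζ‖ ^ 3)]; ring
    _ = _ := by
        rw [hρr, hnζ]
        congr 3
        rw [pow_add ‖w‖, mul_pow, pow_add ρ, pow_add ‖w‖]
        field_simp

end Laplace

/-! ### Laplace expansion by dominated convergence -/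

section Laplace

variable {E : Type*} [NormedAddCommGroup E] [InnerProductSpace ℝ E] [FiniteDimensional ℝ E]
  [MeasurableSpace E] [BorelSpace E]

open Polynomial in
/-- The integral of a Gaussian-type function against a polynomial family is a polynomial. -/
theorem integral_evalGrowth (B : (growthAlgebra E)[X]) {q : E → ℝ} (hq : Continuous q) {c : ℝ}
    (hc : 0 < c) (h : ∀ ζ, c * ‖ζ‖ ^ 2 ≤ q ζ) (ε : ℝ) :
    ∫ ζ, (evalGrowth B ε : E → ℝ) ζ * Real.exp (-(q ζ)) =
      (∑ k ∈ Finset.range (B.natDegree + 1),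
        C (∫ ζ, (B.coeff k : E → ℝ) ζ * Real.exp (-(q ζ))) * X ^ k : ℝ[X]).eval ε := by
  simp only [eval_growthAlgebra_apply, Finset.sum_mul, eval_finsetSum, eval_mul, eval_C, eval_pow,
    eval_X]
  rw [integral_finsetSum]
  · refine Finset.sum_congr rfl fun k _ => ?_
    rw [← integral_mul_const]
    congr 1
    funext ζ
    ring
  · intro k _
    refine ((integrable_growthAlgebra_mul_exp_of_le (B.coeff k).2 hq hc h).mul_const
      (ε ^ k)).congr (Eventually.of_forall fun ζ => ?_)
    simp only
    ring

open Asymptotics in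
/-- **Laplace's method** with a complete expansion to order `r`: the coefficients only depend on
the Taylor polynomials `∑ l, s l` and `∑ l, p l`. -/
theorem exists_laplace_expansion (r : ℕ) {s p : ℕ → E → ℝ}
    (hs : ∀ l, IsContHomogeneous l (s l)) (hp : ∀ l, IsContHomogeneous l (p l))
    {c : ℝ} (hc : 0 < c) (hcs : ∀ ζ, c * ‖ζ‖ ^ 2 ≤ s 2 ζ) :
    ∃ b : ℕ → ℝ, b 0 = p 0 0 * ∫ ζ, Real.exp (-(s 2 ζ)) ∧
      ∀ S ψ : E → ℝ, Measurable S → Measurable ψ →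
      ((fun w => S w - ∑ l ∈ Finset.Icc 2 (2 * r + 2), s l w) =o[𝓝 0]
        fun w => ‖w‖ ^ (2 * r + 2)) →
      ((fun w => ψ w - ∑ l ∈ Finset.range (2 * r + 3), p l w) =o[𝓝 0]
        fun w => ‖w‖ ^ (2 * r + 2)) →
      ∀ᶠ δ in 𝓝[>] (0 : ℝ),
        (fun ρ : ℝ => ρ ^ Module.finrank ℝ E *
            (∫ w in Metric.ball 0 δ, ψ w * Real.exp (-(ρ ^ 2 * S w))) -
          ∑ i ∈ Finset.range (r + 1), b i * ρ⁻¹ ^ (2 * i)) =o[atTop] fun ρ => ρ⁻¹ ^ (2 * r) := by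
  set s' : ℕ → growthAlgebra E := fun l => ⟨s l, (hs l).mem_growthAlgebra⟩ with hs'
  set p' : ℕ → growthAlgebra E := fun l => ⟨p l, (hp l).mem_growthAlgebra⟩ with hp'
  set B := laplacePoly r s' p' with hB
  set q : Polynomial ℝ := ∑ k ∈ Finset.range (B.natDegree + 1),
    Polynomial.C (∫ ζ, (B.coeff k : E → ℝ) ζ * Real.exp (-(s 2 ζ))) * Polynomial.X ^ k with hq
  have hqe : ∀ ε, ∫ ζ, (evalGrowth B ε : E → ℝ) ζ * Real.exp (-(s 2 ζ)) = q.eval ε :=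
    integral_evalGrowth B (hs 2).1 hc hcs
  have hs2even : ∀ ζ, s 2 (-ζ) = s 2 ζ := fun ζ => by
    have := (hs 2).2 (-1) ζ
    simpa using this
  -- The substitution `ζ ↦ -ζ` turns the value at `-x` into the value at `x`: `s 2` is even, and the
  -- polynomial factor only sees `x⁻¹ ^ 2` and `x • ζ`.
  have hqeven : ∀ x, x ≠ 0 → q.eval (-x) = q.eval x := by
    intro x hx
    rw [← hqe, ← hqe, ← integral_neg_eq_self]
    congr 1
    funext ζ
    rw [hs2even]
    congr 1
    have h1 := evalGrowth_laplacePoly_inv r s' p' hs hp (inv_ne_zero (neg_ne_zero.2 hx)) (-ζ)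
    have h2 := evalGrowth_laplacePoly_inv r s' p' hs hp (inv_ne_zero hx) ζ
    rw [inv_inv] at h1 h2
    have h3 : -x • -ζ = x • ζ := by simp
    have h4 : ((-x)⁻¹) ^ 2 = (x⁻¹) ^ 2 := by rw [inv_neg, neg_sq]
    rw [h3, h4] at h1
    rw [hB, h1, h2]
  refine ⟨fun i => q.coeff (2 * i), ?_, fun S ψ hSm hψm hS hψ => ?_⟩
  · simp only [mul_zero, Polynomial.coeff_zero_eq_eval_zero]
    rw [← hqe, ← integral_const_mul]
    congr 1
    funext ζ
    congr 1
    rw [hB, evalGrowth_laplacePoly]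
    have hp0 : p 0 ζ = p 0 0 := by
      have := (hp 0).2 0 ζ
      simpa using this.symm
    -- At `ε = 0` only `l = 0` and `m = 0` survive, because the exponents `l - 2` in the second
    -- factor are at least one.
    rw [Finset.sum_eq_single 0, Finset.sum_eq_single 0]
    · simp [hp', hp0]
    · intro m _ hm
      rw [Finset.sum_eq_zero]
      · simp [hm]
      · intro l hl
        have := (Finset.mem_Icc.1 hl).1
        rw [zero_pow (by omega), mul_zero]
    · simp
    · intro l _ hl; rw [zero_pow hl, mul_zero]
    · simp
  obtain ⟨C, hC, hbd⟩ := eventually_laplace_bounds r hs hp hc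
  obtain ⟨δ₀, hδ₀, hball⟩ := Metric.eventually_nhds_iff_ball.1 (hbd S ψ hS hψ)
  filter_upwards [Ioo_mem_nhdsGT hδ₀] with δ hδ
  obtain ⟨K, hK, hKB⟩ := exists_bound_eval_growthAlgebra B (half_pos hc)
  set Z : E → ℝ := fun w => S w - ∑ l ∈ Finset.Icc 2 (2 * r + 2), s l w with hZ
  -- `I` is the integrand after `w = ρ⁻¹ • ζ`, extended by zero; `J` is its model on the whole
  -- space, with integral `q.eval ρ⁻¹`.
  set I : ℝ → E → ℝ := fun ρ ζ => (Metric.ball (0 : E) (δ * ρ)).indicator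
    (fun ζ => ψ (ρ⁻¹ • ζ) * Real.exp (-(ρ ^ 2 * S (ρ⁻¹ • ζ)))) ζ with hI
  set J : ℝ → E → ℝ := fun ρ ζ => (evalGrowth B ρ⁻¹ : E → ℝ) ζ * Real.exp (-(s 2 ζ)) with hJ
  have hJint : ∀ ρ, Integrable (J ρ) := fun ρ =>
    integrable_growthAlgebra_mul_exp_of_le (evalGrowth B ρ⁻¹).2 (hs 2).1 hc hcs
  -- The last summand covers `‖ζ‖ ≥ δ * ρ`, where `I` vanishes and `ρ` is at most `‖ζ‖ / δ`.
  set M : E → ℝ := fun ζ => Real.exp (-(c / 2 * ‖ζ‖ ^ 2)) * (‖ζ‖ ^ (2 * r + 2) +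
      C * ‖ζ‖ ^ (2 * r + 2) + C * (C * ‖ζ‖ ^ 3) ^ (2 * r + 1) +
        K * (‖ζ‖ / δ) ^ (2 * r)) with hM
  have hMint : Integrable M := by
    have hmem : (fun ζ : E => ‖ζ‖ ^ (2 * r + 2) + C * ‖ζ‖ ^ (2 * r + 2) +
        C * (C * ‖ζ‖ ^ 3) ^ (2 * r + 1) + K * (‖ζ‖ / δ) ^ (2 * r)) ∈ growthAlgebra E := by
      have e : (fun ζ : E => ‖ζ‖ ^ (2 * r + 2) + C * ‖ζ‖ ^ (2 * r + 2) +
          C * (C * ‖ζ‖ ^ 3) ^ (2 * r + 1) + K * (‖ζ‖ / δ) ^ (2 * r)) =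
          (fun ζ : E => ‖ζ‖ ^ (2 * r + 2)) + C • (fun ζ : E => ‖ζ‖ ^ (2 * r + 2)) +
          (C * C ^ (2 * r + 1)) • (fun ζ : E => ‖ζ‖ ^ (3 * (2 * r + 1))) +
          (K / δ ^ (2 * r)) • (fun ζ : E => ‖ζ‖ ^ (2 * r)) := by
        funext ζ
        simp only [Pi.add_apply, Pi.smul_apply, smul_eq_mul]
        rw [mul_pow, ← pow_mul, div_pow]
        ring
      rw [e]
      exact add_mem (add_mem (add_mem (norm_pow_mem_growthAlgebra _)
        (Subalgebra.smul_mem _ (norm_pow_mem_growthAlgebra _) _))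
        (Subalgebra.smul_mem _ (norm_pow_mem_growthAlgebra _) _))
        (Subalgebra.smul_mem _ (norm_pow_mem_growthAlgebra _) _)
    refine (integrable_growthAlgebra_mul_exp hmem (half_pos hc)).congr
      (Eventually.of_forall fun ζ => ?_)
    simp only [hM]
    ring
  have hest : ∀ ρ : ℝ, 1 ≤ ρ → ∀ ζ : E, ‖ζ‖ < δ * ρ →
      |ρ ^ (2 * r) * (I ρ ζ - J ρ ζ)| ≤ Real.exp (-(c / 2 * ‖ζ‖ ^ 2)) *
        (‖ζ‖ ^ (2 * r + 2) * ρ⁻¹ ^ 2 + C * (ρ ^ (2 * r + 2) * |Z (ρ⁻¹ • ζ)|) +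
          C * (C * ‖ζ‖ ^ 3) ^ (2 * r + 1) * ρ⁻¹) ∧
      ρ ^ (2 * r + 2) * |Z (ρ⁻¹ • ζ)| ≤ ‖ζ‖ ^ (2 * r + 2) := by
    intro ρ hρ ζ hζ
    have hρ0 : 0 < ρ := by linarith
    have hnw : ‖ρ⁻¹ • ζ‖ = ρ⁻¹ * ‖ζ‖ := by rw [norm_smul, Real.norm_of_nonneg (by positivity)]
    have hmem : ρ⁻¹ • ζ ∈ Metric.ball (0 : E) δ₀ := by
      rw [mem_ball_zero_iff, hnw]
      calc ρ⁻¹ * ‖ζ‖ < ρ⁻¹ * (δ * ρ) := by gcongr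
        _ = δ := by field_simp
        _ < δ₀ := hδ.2
    have hb := hball _ hmem
    constructor
    · have hIρ : I ρ ζ = ψ (ρ⁻¹ • ζ) * Real.exp (-(ρ ^ 2 * S (ρ⁻¹ • ζ))) := by
        simp only [hI]
        rw [Set.indicator_of_mem (by simpa using hζ)]
      rw [hIρ]
      exact rescaled_sub_le r s' p' hs hp hC hcs hρ ζ hb
    · calc _ ≤ ρ ^ (2 * r + 2) * ‖ρ⁻¹ • ζ‖ ^ (2 * r + 2) := by gcongr; exact hb.2.1
        _ = _ := by rw [hnw, ← mul_pow, ← mul_assoc, mul_inv_cancel₀ hρ0.ne', one_mul]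
  have hmeas : ∀ ρ, AEStronglyMeasurable (fun ζ => ρ ^ (2 * r) * (I ρ ζ - J ρ ζ)) := by
    intro ρ
    have hIm : Measurable (I ρ) := by
      refine Measurable.indicator ?_ Metric.isOpen_ball.measurableSet
      fun_prop
    have hJm := (hJint ρ).aestronglyMeasurable
    exact (hIm.aestronglyMeasurable.sub hJm).const_mul _
  have hbound : ∀ ρ : ℝ, 1 ≤ ρ → ∀ ζ : E, ‖ρ ^ (2 * r) * (I ρ ζ - J ρ ζ)‖ ≤ M ζ := by
    intro ρ hρ ζ
    have hρ0 : 0 < ρ := by linarith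
    have hδ0 : 0 < δ := hδ.1
    have hinv : ρ⁻¹ ≤ 1 := inv_le_one_of_one_le₀ hρ
    rw [Real.norm_eq_abs]
    rcases lt_or_ge ‖ζ‖ (δ * ρ) with h | h
    · obtain ⟨h1, h2⟩ := hest ρ hρ ζ h
      refine h1.trans ?_
      refine mul_le_mul_of_nonneg_left ?_ (Real.exp_pos _).le
      have h3 : ‖ζ‖ ^ (2 * r + 2) * ρ⁻¹ ^ 2 ≤ ‖ζ‖ ^ (2 * r + 2) :=
        mul_le_of_le_one_right (by positivity) (pow_le_one₀ (by positivity) hinv)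
      have h4 : C * (C * ‖ζ‖ ^ 3) ^ (2 * r + 1) * ρ⁻¹ ≤ C * (C * ‖ζ‖ ^ 3) ^ (2 * r + 1) :=
        mul_le_of_le_one_right (by positivity) hinv
      have h5 : C * (ρ ^ (2 * r + 2) * |Z (ρ⁻¹ • ζ)|) ≤ C * ‖ζ‖ ^ (2 * r + 2) := by gcongr
      have h6 : 0 ≤ K * (‖ζ‖ / δ) ^ (2 * r) := by positivity
      linarith
    · have hIρ : I ρ ζ = 0 := by
        simp only [hI]
        rw [Set.indicator_of_notMem (by simpa using h)]
      rw [hIρ, zero_sub, mul_neg, abs_neg, abs_mul, abs_of_nonneg (by positivity)]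
      simp only [hJ, abs_mul, Real.abs_exp]
      have h1 := hKB ρ⁻¹ (by rwa [abs_of_nonneg (by positivity)]) ζ
      have h2 : ρ ≤ ‖ζ‖ / δ := by rw [le_div_iff₀ hδ0]; linarith
      calc _ ≤ (‖ζ‖ / δ) ^ (2 * r) * ((K * Real.exp (c / 2 * ‖ζ‖ ^ 2)) *
              Real.exp (-(c * ‖ζ‖ ^ 2))) := by
            gcongr
            exact hcs ζ
        _ = Real.exp (-(c / 2 * ‖ζ‖ ^ 2)) * (K * (‖ζ‖ / δ) ^ (2 * r)) := by
            rw [mul_assoc K, ← Real.exp_add]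
            ring_nf
        _ ≤ _ := by
            simp only [hM]
            gcongr
            have : 0 ≤ ‖ζ‖ ^ (2 * r + 2) + C * ‖ζ‖ ^ (2 * r + 2) +
              C * (C * ‖ζ‖ ^ 3) ^ (2 * r + 1) := by positivity
            linarith
  have hlim : ∀ ζ : E, Tendsto (fun ρ : ℝ => ρ ^ (2 * r) * (I ρ ζ - J ρ ζ)) atTop (𝓝 0) := by
    intro ζ
    -- The little-o in the Taylor expansion of the phase is needed here: a big-O of the same order
    -- would only give boundedness.
    have hZlim : Tendsto (fun ρ : ℝ => ρ ^ (2 * r + 2) * |Z (ρ⁻¹ • ζ)|) atTop (𝓝 0) := by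
      have h0 : Tendsto (fun ρ : ℝ => ρ⁻¹ • ζ) atTop (𝓝 0) := by
        simpa using tendsto_inv_atTop_zero.smul_const (α := ℝ) ζ
      have hO : (fun ρ : ℝ => ρ ^ (2 * r + 2) * ((fun w : E => ‖w‖ ^ (2 * r + 2)) ∘
          fun ρ : ℝ => ρ⁻¹ • ζ) ρ) =O[atTop] fun _ => (1 : ℝ) := by
        refine IsBigO.of_bound (‖ζ‖ ^ (2 * r + 2)) ?_
        filter_upwards [eventually_gt_atTop 0] with ρ hρ
        simp only [Function.comp_apply, norm_mul, norm_pow, norm_smul, norm_inv, norm_norm,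
          norm_one, mul_one]
        rw [← mul_pow, ← mul_assoc, mul_inv_cancel₀ (by simpa using hρ.ne'), one_mul]
      have h1 := ((isBigO_refl (fun ρ : ℝ => ρ ^ (2 * r + 2)) atTop).mul_isLittleO
        (hS.comp_tendsto h0)).trans_isBigO hO
      have h2 := ((isLittleO_one_iff ℝ).1 h1).abs
      rw [abs_zero] at h2
      refine h2.congr' ?_
      filter_upwards [eventually_gt_atTop 0] with ρ hρ
      rw [abs_mul, abs_of_nonneg (by positivity : 0 ≤ ρ ^ (2 * r + 2))]
      rfl
    have hinv : Tendsto (fun ρ : ℝ => ρ⁻¹) atTop (𝓝 0) := tendsto_inv_atTop_zero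
    have hup : Tendsto (fun ρ : ℝ => Real.exp (-(c / 2 * ‖ζ‖ ^ 2)) *
        (‖ζ‖ ^ (2 * r + 2) * ρ⁻¹ ^ 2 + C * (ρ ^ (2 * r + 2) * |Z (ρ⁻¹ • ζ)|) +
          C * (C * ‖ζ‖ ^ 3) ^ (2 * r + 1) * ρ⁻¹)) atTop (𝓝 0) := by
      have := ((((hinv.pow 2).const_mul (‖ζ‖ ^ (2 * r + 2))).add (hZlim.const_mul C)).add
        (hinv.const_mul (C * (C * ‖ζ‖ ^ 3) ^ (2 * r + 1)))).const_mul
          (Real.exp (-(c / 2 * ‖ζ‖ ^ 2)))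
      simpa using this
    refine squeeze_zero_norm' ?_ hup
    have hδρ : Tendsto (fun ρ : ℝ => δ * ρ) atTop atTop := tendsto_id.const_mul_atTop hδ.1
    filter_upwards [eventually_ge_atTop 1, hδρ.eventually_gt_atTop ‖ζ‖] with ρ hρ h
    exact (hest ρ hρ ζ h).1
  have hDCT : Tendsto (fun ρ : ℝ => ∫ ζ, ρ ^ (2 * r) * (I ρ ζ - J ρ ζ)) atTop (𝓝 0) := by
    have := tendsto_integral_filter_of_dominated_convergence (μ := volume)
      (F := fun (ρ : ℝ) (ζ : E) => ρ ^ (2 * r) * (I ρ ζ - J ρ ζ)) (f := fun _ => (0 : ℝ))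
      (l := atTop) M (Eventually.of_forall hmeas)
      (by filter_upwards [eventually_ge_atTop 1] with ρ hρ
          exact Eventually.of_forall (hbound ρ hρ)) hMint (Eventually.of_forall hlim)
    simpa using this
  have hId : ∀ᶠ ρ : ℝ in atTop, ρ ^ Module.finrank ℝ E *
      (∫ w in Metric.ball 0 δ, ψ w * Real.exp (-(ρ ^ 2 * S w))) - q.eval ρ⁻¹ =
      ρ⁻¹ ^ (2 * r) * ∫ ζ, ρ ^ (2 * r) * (I ρ ζ - J ρ ζ) := by
    filter_upwards [eventually_ge_atTop 1] with ρ hρ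
    have hρ0 : 0 < ρ := by linarith
    have hD : Integrable (fun ζ => ρ ^ (2 * r) * (I ρ ζ - J ρ ζ)) :=
      hMint.mono' (hmeas ρ) (Eventually.of_forall (hbound ρ hρ))
    have hIint : Integrable (I ρ) := by
      have := (hD.const_mul (ρ⁻¹ ^ (2 * r))).add (hJint ρ)
      refine this.congr (Eventually.of_forall fun ζ => ?_)
      simp only [Pi.add_apply]
      rw [← mul_assoc, ← mul_pow, inv_mul_cancel₀ hρ0.ne', one_pow]
      ring
    rw [integral_const_mul, integral_sub hIint (hJint ρ), hqe, ← mul_assoc, ← mul_pow,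
      inv_mul_cancel₀ hρ0.ne', one_pow, one_mul]
    congr 1
    have h1 := Measure.integral_comp_inv_smul_of_nonneg (volume : Measure E)
      ((Metric.ball (0 : E) δ).indicator fun w => ψ w * Real.exp (-(ρ ^ 2 * S w))) hρ0.le
    rw [integral_indicator Metric.isOpen_ball.measurableSet, smul_eq_mul] at h1
    rw [← h1]
    congr 1
    funext ζ
    have hiff : ρ⁻¹ • ζ ∈ Metric.ball (0 : E) δ ↔ ζ ∈ Metric.ball (0 : E) (δ * ρ) := by
      rw [mem_ball_zero_iff, mem_ball_zero_iff, norm_smul, norm_inv, Real.norm_of_nonneg hρ0.le,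
        inv_mul_lt_iff₀ hρ0, mul_comm]
    by_cases hζ : ζ ∈ Metric.ball (0 : E) (δ * ρ)
    · simp only [hI]
      rw [Set.indicator_of_mem hζ, Set.indicator_of_mem (hiff.2 hζ)]
    · simp only [hI]
      rw [Set.indicator_of_notMem hζ, Set.indicator_of_notMem fun h => hζ (hiff.1 h)]
  have hlittle : (fun ρ : ℝ => ρ ^ Module.finrank ℝ E *
      (∫ w in Metric.ball 0 δ, ψ w * Real.exp (-(ρ ^ 2 * S w))) - q.eval ρ⁻¹) =o[atTop]
      fun ρ => ρ⁻¹ ^ (2 * r) := by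
    have h1 : (fun ρ : ℝ => ρ⁻¹ ^ (2 * r) * ∫ ζ, ρ ^ (2 * r) * (I ρ ζ - J ρ ζ)) =o[atTop]
        fun ρ => ρ⁻¹ ^ (2 * r) := by
      simpa using (isBigO_refl (fun ρ : ℝ => ρ⁻¹ ^ (2 * r)) atTop).mul_isLittleO
        ((isLittleO_one_iff ℝ).2 hDCT)
    exact h1.congr' (hId.mono fun ρ h => h.symm) (Eventually.of_forall fun _ => rfl)
  have := hlittle.add (Polynomial.isLittleO_eval_inv_sub_sum_of_even hqeven r)
  refine this.congr_left fun ρ => ?_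
  ring

end Laplace

/-! ### Taylor expansions with Peano remainder -/

section Taylor

variable {E : Type*} [NormedAddCommGroup E] [NormedSpace ℝ E]

/-- The Taylor monomial of degree `k` of `f` at `x`. -/
noncomputable def taylorTerm (f : E → ℝ) (x : E) (k : ℕ) (y : E) : ℝ :=
  (k.factorial : ℝ)⁻¹ • iteratedFDeriv ℝ k f x (fun _ => y)

theorem isContHomogeneous_taylorTerm {E : Type*} [NormedAddCommGroup E] [InnerProductSpace ℝ E]
    (f : E → ℝ) (x : E) (k : ℕ) : IsContHomogeneous k (taylorTerm f x k) := by
  refine ⟨?_, fun t ζ => ?_⟩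
  · unfold taylorTerm
    have : Continuous fun y : E => iteratedFDeriv ℝ k f x (fun _ => y) :=
      (iteratedFDeriv ℝ k f x).cont.comp (continuous_pi fun _ => continuous_id)
    exact continuous_const.mul this
  · unfold taylorTerm
    have := (iteratedFDeriv ℝ k f x).map_smul_univ (fun _ => t) (fun _ => ζ)
    simp only [Finset.prod_const, Finset.card_univ, Fintype.card_fin] at this
    rw [this]
    simp only [smul_eq_mul]
    ring

open Asymptotics in
/-- **Taylor's theorem** in several variables, with Peano remainder. -/
theorem ContDiffAt.sub_sum_taylorTerm_isLittleO {f : E → ℝ} {x : E} {m : ℕ}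
    (hf : ContDiffAt ℝ ((m + 1 : ℕ) : WithTop ℕ∞) f x) :
    (fun y => f (x + y) - ∑ k ∈ Finset.range (m + 2), taylorTerm f x k y) =o[𝓝 0]
      fun y => ‖y‖ ^ (m + 1) := by
  refine IsLittleO.of_bound fun ε hε => ?_
  have h1 : ∀ᶠ z in 𝓝 x, ContDiffAt ℝ ((m + 1 : ℕ) : WithTop ℕ∞) f z := hf.eventually (by simp)
  have hcont : ContinuousAt (iteratedFDeriv ℝ (m + 1) f) x :=
    (hf.iteratedFDeriv_right (i := m + 1) (m := 0) (by simp)).continuousAt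
  have h2 : ∀ᶠ z in 𝓝 x, ‖iteratedFDeriv ℝ (m + 1) f z - iteratedFDeriv ℝ (m + 1) f x‖ < ε := by
    filter_upwards [hcont (Metric.ball_mem_nhds _ hε)] with z hz
    exact mem_ball_iff_norm.1 hz
  obtain ⟨δ, hδ, hball⟩ := Metric.eventually_nhds_iff_ball.1 (h1.and h2)
  filter_upwards [Metric.ball_mem_nhds (0 : E) hδ] with y hy
  have hmem : ∀ t ∈ Set.Icc (0 : ℝ) 1, x + t • y ∈ Metric.ball x δ := by
    intro t ht
    rw [mem_ball_iff_norm, add_sub_cancel_left, norm_smul, Real.norm_of_nonneg ht.1]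
    exact (mul_le_of_le_one_left (norm_nonneg _) ht.2).trans_lt (mem_ball_zero_iff.1 hy)
  have key := map_add_eq_sum_add_integral_iteratedFDeriv (n := m) (f := f) (x := x) (y := y)
    (fun t ht => by exact_mod_cast (hball _ (hmem t ht)).1)
  have hint1 : IntervalIntegrable (fun t : ℝ => (1 - t) ^ m •
      iteratedFDeriv ℝ (m + 1) f (x + t • y) (fun _ => y)) volume 0 1 := by
    refine ContinuousOn.intervalIntegrable fun t ht => ?_
    rw [Set.uIcc_of_le zero_le_one] at ht
    have hc : ContinuousAt (iteratedFDeriv ℝ (m + 1) f) (x + t • y) :=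
      ((hball _ (hmem t ht)).1.iteratedFDeriv_right (i := m + 1) (m := 0) (by simp)).continuousAt
    have := (hc.comp (x := t) (f := fun t : ℝ => x + t • y) (by fun_prop)).continuousWithinAt
      (s := Set.uIcc (0 : ℝ) 1)
    have h3 := this.eval_const (fun _ => y)
    rw [Set.uIcc_of_le zero_le_one] at h3
    exact (by fun_prop : ContinuousWithinAt (fun t : ℝ => (1 - t) ^ m) (Set.uIcc (0 : ℝ) 1)
      t).smul (by rw [Set.uIcc_of_le zero_le_one]; exact h3)
  have hint2 : IntervalIntegrable (fun t : ℝ => (1 - t) ^ m •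
      iteratedFDeriv ℝ (m + 1) f x (fun _ => y)) volume 0 1 :=
    Continuous.intervalIntegrable (by fun_prop) _ _
  have hpow : ∫ t in (0 : ℝ)..1, (1 - t) ^ m = ((m : ℝ) + 1)⁻¹ := by
    rw [intervalIntegral.integral_comp_sub_left (fun s : ℝ => s ^ m) 1]
    simp [integral_pow]
  -- Freezing the derivative at `x` in the integral remainder reproduces the Taylor term of degree
  -- `m + 1`; only the oscillation of that derivative near `x` is left.
  have hterm : taylorTerm f x (m + 1) y = (m.factorial : ℝ)⁻¹ •
      ∫ t in (0 : ℝ)..1, (1 - t) ^ m • iteratedFDeriv ℝ (m + 1) f x (fun _ => y) := by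
    rw [intervalIntegral.integral_smul_const, hpow, taylorTerm, Nat.factorial_succ]
    simp only [smul_eq_mul]
    push_cast
    field_simp
  have hdiff : f (x + y) - ∑ k ∈ Finset.range (m + 2), taylorTerm f x k y =
      (m.factorial : ℝ)⁻¹ • ∫ t in (0 : ℝ)..1, (1 - t) ^ m •
        (iteratedFDeriv ℝ (m + 1) f (x + t • y) - iteratedFDeriv ℝ (m + 1) f x) (fun _ => y) := by
    rw [Finset.sum_range_succ, hterm, key]
    simp only [sub_apply, smul_sub]
    rw [intervalIntegral.integral_sub hint1 hint2]
    simp only [taylorTerm, smul_eq_mul]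
    ring
  rw [hdiff, norm_smul]
  have hnorm : ‖∫ t in (0 : ℝ)..1, (1 - t) ^ m •
        (iteratedFDeriv ℝ (m + 1) f (x + t • y) - iteratedFDeriv ℝ (m + 1) f x) (fun _ => y)‖ ≤
      (ε * ‖y‖ ^ (m + 1)) * |(1 : ℝ) - 0| := by
    refine intervalIntegral.norm_integral_le_of_norm_le_const fun t ht => ?_
    rw [Set.uIoc_of_le zero_le_one] at ht
    have ht' : t ∈ Set.Icc (0 : ℝ) 1 := ⟨ht.1.le, ht.2⟩
    rw [norm_smul]
    have h3 : ‖(1 - t) ^ m‖ ≤ 1 := by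
      rw [norm_pow, Real.norm_of_nonneg (by linarith [ht.2])]
      exact pow_le_one₀ (by linarith [ht.2]) (by linarith [ht.1])
    have h4 := (iteratedFDeriv ℝ (m + 1) f (x + t • y) -
      iteratedFDeriv ℝ (m + 1) f x).le_opNorm (fun _ => y)
    simp only [Finset.prod_const, Finset.card_univ, Fintype.card_fin] at h4
    have h5 := (hball _ (hmem t ht')).2.le
    calc _ ≤ 1 * (‖iteratedFDeriv ℝ (m + 1) f (x + t • y) -
          iteratedFDeriv ℝ (m + 1) f x‖ * ‖y‖ ^ (m + 1)) := by gcongr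
      _ ≤ _ := by rw [one_mul]; gcongr
  have hfac : ‖(m.factorial : ℝ)⁻¹‖ ≤ 1 := by
    rw [norm_inv, Real.norm_of_nonneg (by positivity)]
    exact inv_le_one_of_one_le₀ (by exact_mod_cast Nat.one_le_iff_ne_zero.2 m.factorial_ne_zero)
  calc _ ≤ 1 * ((ε * ‖y‖ ^ (m + 1)) * |(1 : ℝ) - 0|) := by gcongr
    _ = _ := by simp

open Asymptotics in
theorem ContDiffAt.sub_isLittleO_of_iteratedFDeriv_eq {f g : E → ℝ} {x : E} {m : ℕ}
    (hf : ContDiffAt ℝ ((m + 1 : ℕ) : WithTop ℕ∞) f x)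
    (hg : ContDiffAt ℝ ((m + 1 : ℕ) : WithTop ℕ∞) g x)
    (h : ∀ k < m + 2, iteratedFDeriv ℝ k f x = iteratedFDeriv ℝ k g x) :
    (fun y => f (x + y) - g (x + y)) =o[𝓝 0] fun y => ‖y‖ ^ (m + 1) := by
  refine (hf.sub_sum_taylorTerm_isLittleO.sub hg.sub_sum_taylorTerm_isLittleO).congr_left
    fun y => ?_
  have : ∑ k ∈ Finset.range (m + 2), taylorTerm f x k y =
      ∑ k ∈ Finset.range (m + 2), taylorTerm g x k y :=
    Finset.sum_congr rfl fun k hk => by rw [taylorTerm, taylorTerm, h k (Finset.mem_range.1 hk)]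
  rw [this]
  ring

open Asymptotics in
-- Divide by `t`, then by `t ^ 2`, off the origin. Second-order coefficients of two expansions along
-- a line can then be identified, which avoids the chain rule for second derivatives.
theorem eq_zero_of_quadratic_isLittleO {a b : ℝ}
    (h : (fun t : ℝ => a * t + b * t ^ 2) =o[𝓝 0] fun t => t ^ 2) : a = 0 ∧ b = 0 := by
  have hle : 𝓝[≠] (0 : ℝ) ≤ 𝓝 0 := nhdsWithin_le_nhds
  have h' := h.mono hle
  have ha : a = 0 := by
    have h1 : (fun t : ℝ => (a * t + b * t ^ 2) * t⁻¹) =o[𝓝[≠] 0] fun t => t ^ 2 * t⁻¹ :=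
      h'.mul_isBigO (isBigO_refl _ _)
    have h2 : (fun t : ℝ => t ^ 2 * t⁻¹) =O[𝓝[≠] 0] fun _ => (1 : ℝ) := by
      have : Tendsto (fun t : ℝ => t ^ 2 * t⁻¹) (𝓝[≠] 0) (𝓝 0) := by
        refine ((continuous_id.tendsto (0 : ℝ)).mono_left hle).congr' ?_
        filter_upwards [self_mem_nhdsWithin] with t ht
        have : t ≠ 0 := ht
        simp only [id]; field_simp
      exact this.isBigO_one ℝ
    have h3 := (isLittleO_one_iff ℝ).1 (h1.trans_isBigO h2)
    have h4 : Tendsto (fun t : ℝ => (a * t + b * t ^ 2) * t⁻¹) (𝓝[≠] 0) (𝓝 a) := by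
      have h5 : Tendsto (fun t : ℝ => a + b * t) (𝓝[≠] 0) (𝓝 (a + b * 0)) :=
        ((by fun_prop : Continuous fun t : ℝ => a + b * t).tendsto 0).mono_left hle
      rw [mul_zero, add_zero] at h5
      refine h5.congr' ?_
      filter_upwards [self_mem_nhdsWithin] with t ht
      have : t ≠ 0 := ht
      field_simp
    exact tendsto_nhds_unique h4 h3
  refine ⟨ha, ?_⟩
  have h1 : (fun t : ℝ => (a * t + b * t ^ 2) * (t ^ 2)⁻¹) =o[𝓝[≠] 0] fun _ => (1 : ℝ) := by
    refine (h'.mul_isBigO (isBigO_refl (fun t : ℝ => (t ^ 2)⁻¹) _)).congr' .rfl ?_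
    filter_upwards [self_mem_nhdsWithin] with t ht
    have : t ≠ 0 := ht
    field_simp
  have h2 : Tendsto (fun _ : ℝ => b) (𝓝[≠] 0) (𝓝 0) := by
    refine ((isLittleO_one_iff ℝ).1 h1).congr' ?_
    filter_upwards [self_mem_nhdsWithin] with t ht
    have : t ≠ 0 := ht
    rw [ha]; field_simp; ring
  exact tendsto_nhds_unique tendsto_const_nhds h2

open Asymptotics in
/-- The second order expansion along a line. -/
theorem ContDiffAt.line_isLittleO {f : E → ℝ} {x : E} (hf : ContDiffAt ℝ 2 f x) (ζ : E) :
    (fun t : ℝ => f (x + t • ζ) - (f x + fderiv ℝ f x ζ * t +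
      (2⁻¹ * iteratedFDeriv ℝ 2 f x (fun _ => ζ)) * t ^ 2)) =o[𝓝 0] fun t => t ^ 2 := by
  have h := (ContDiffAt.sub_sum_taylorTerm_isLittleO (m := 1) (by exact_mod_cast hf) :
    (fun y => f (x + y) - ∑ k ∈ Finset.range 3, taylorTerm f x k y) =o[𝓝 0] fun y => ‖y‖ ^ 2)
  have h0 : Tendsto (fun t : ℝ => t • ζ) (𝓝 0) (𝓝 0) := by
    have : Continuous fun t : ℝ => t • ζ := by fun_prop
    simpa using this.tendsto 0
  have h1 := h.comp_tendsto h0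
  have h2 : ((fun y : E => ‖y‖ ^ 2) ∘ fun t : ℝ => t • ζ) =O[𝓝 0] fun t : ℝ => t ^ 2 := by
    refine IsBigO.of_bound (‖ζ‖ ^ 2) (Eventually.of_forall fun t => ?_)
    simp only [Function.comp_apply, norm_smul, mul_pow, norm_mul, norm_pow, norm_norm]
    rw [mul_comm]
  refine (h1.trans_isBigO h2).congr_left fun t => ?_
  simp only [Function.comp_apply, Finset.sum_range_succ, Finset.sum_range_zero, taylorTerm]
  have e2 := (iteratedFDeriv ℝ 2 f x).map_smul_univ (fun _ => t) (fun _ => ζ)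
  simp only [Finset.prod_const, Finset.card_univ, Fintype.card_fin] at e2
  rw [e2, iteratedFDeriv_zero_apply, iteratedFDeriv_one_apply]
  simp [Nat.factorial]
  ring

end Taylor

/-! ### Gaussian integral of a quadratic form -/

section GaussianDeterminant

open Matrix in
-- Factor `M = Bᵀ * B`: the form becomes `‖B ζ‖ ^ 2`, and the linear change of variables costs `|det
-- B|⁻¹ = |det M| ^ (-1/2)`.
theorem integral_exp_neg_quadratic {n : ℕ} {M : Matrix (Fin n) (Fin n) ℝ} (hM : M.PosSemidef)
    (hdet : M.det ≠ 0) :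
    (∫ ζ : Euc n, Real.exp (-(2⁻¹ * (ζ.ofLp ⬝ᵥ (M *ᵥ ζ.ofLp))))) =
      (2 * Real.pi) ^ ((n : ℝ) / 2) * |M.det| ^ (-(1 / 2) : ℝ) := by
  obtain ⟨B, rfl⟩ : ∃ B : Matrix (Fin n) (Fin n) ℝ, M = Bᵀ * B := by
    open scoped MatrixOrder in
    obtain ⟨a, ha⟩ := CStarAlgebra.nonneg_iff_eq_star_mul_self.mp hM.nonneg
    exact ⟨a, by rw [ha, star_eq_conjTranspose, conjTranspose_eq_transpose_of_trivial]⟩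
  have hB : B.det ≠ 0 := fun h => hdet (by simp [h])
  set L : Euc n →ₗ[ℝ] Euc n := Matrix.toEuclideanLin B
  have hLdet : LinearMap.det L = B.det := by
    simp only [L, Matrix.toLpLin_eq_toLin, LinearMap.det_toLin]
  have hmap := Measure.map_linearMap_addHaar_eq_smul_addHaar (volume : Measure (Euc n))
    (f := L) (by rw [hLdet]; exact hB)
  have hquad : ∀ ζ : Euc n, ζ.ofLp ⬝ᵥ ((Bᵀ * B) *ᵥ ζ.ofLp) = ‖L ζ‖ ^ 2 := by
    intro ζ
    rw [EuclideanSpace.real_norm_sq_eq]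
    simp only [L, Matrix.toLpLin_apply]
    rw [← Matrix.mulVec_mulVec, Matrix.dotProduct_mulVec, Matrix.vecMul_transpose, dotProduct]
    exact Finset.sum_congr rfl fun i _ => (sq _).symm
  have hLm : Measurable L := (LinearMap.continuous_of_finiteDimensional L).measurable
  have h1 : ∫ ζ : Euc n, Real.exp (-(2⁻¹ * ‖L ζ‖ ^ 2)) =
      ∫ z, Real.exp (-(2⁻¹ * ‖z‖ ^ 2)) ∂(Measure.map L volume) := by
    rw [integral_map hLm.aemeasurable]
    exact (by fun_prop : Continuous fun z : Euc n => Real.exp (-(2⁻¹ * ‖z‖ ^ 2))).aestronglyMeasurable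
  simp only [hquad]
  rw [h1, hmap, integral_smul_measure, hLdet, ENNReal.toReal_ofReal (abs_nonneg _)]
  have h2 := GaussianFourier.integral_rexp_neg_mul_sq_norm (V := Euc n) (b := 2⁻¹) (by norm_num)
  simp only [neg_mul] at h2
  rw [h2, smul_eq_mul, mul_comm, det_mul, det_transpose, abs_mul, finrank_euclideanSpace_fin]
  congr 1
  · congr 1
    field_simp
  · rw [abs_inv, ← sq, ← Real.rpow_natCast, ← Real.rpow_mul (abs_nonneg _)]
    norm_num
    rw [Real.rpow_neg_one]

end GaussianDeterminant

/-! ### Angular part of a homogeneous function -/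

section AngularPart

variable {d : ℕ} {α : ℝ} {g : Euc d → ℝ}

theorem IsHomogeneousOfOrder.map_zero (hα : 0 < α) (hg : IsHomogeneousOfOrder α g) : g 0 = 0 := by
  have h := hg 2 two_pos 0
  rw [smul_zero] at h
  have h1 : (1 : ℝ) < 2 ^ α := Real.one_lt_rpow one_lt_two hα
  have h2 : (2 ^ α - 1) * g 0 = 0 := by linarith
  exact (mul_eq_zero.1 h2).resolve_left (by linarith)

theorem IsHomogeneousOfOrder.eq_norm_rpow_mul (hg : IsHomogeneousOfOrder α g) {z : Euc d}
    (hz : z ≠ 0) : g z = ‖z‖ ^ α * angularPart g z := by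
  have hn : 0 < ‖z‖ := norm_pos_iff.2 hz
  rw [angularPart, ← hg _ hn, smul_smul, mul_inv_cancel₀ hn.ne', one_smul]

theorem angularPart_of_norm_eq_one {z : Euc d} (hz : ‖z‖ = 1) : angularPart g z = g z := by
  rw [angularPart, hz, inv_one, one_smul]

theorem angularPart_smul {s : ℝ} (hs : 0 < s) (z : Euc d) :
    angularPart g (s • z) = angularPart g z := by
  rcases eq_or_ne z 0 with rfl | hz
  · rw [smul_zero]
  have hn : ‖z‖ ≠ 0 := norm_ne_zero_iff.2 hz
  rw [angularPart, angularPart, norm_smul, Real.norm_of_nonneg hs.le, smul_smul]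
  congr 2
  field_simp

theorem contDiffAt_angularPart {N : ℕ} (hg : ContDiffOn ℝ (N : WithTop ℕ∞) g {0}ᶜ) {z : Euc d}
    (hz : z ≠ 0) : ContDiffAt ℝ (N : WithTop ℕ∞) (angularPart g) z := by
  have h1 : ContDiffAt ℝ (N : WithTop ℕ∞) g (‖z‖⁻¹ • z) :=
    hg.contDiffAt (isOpen_compl_singleton.mem_nhds (by simpa using hz))
  have h2 : ContDiffAt ℝ (N : WithTop ℕ∞) (fun z : Euc d => ‖z‖⁻¹ • z) z :=
    ((contDiffAt_norm ℝ hz).inv (norm_ne_zero_iff.2 hz)).smul contDiffAt_id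
  exact ContDiffAt.comp (f := fun z : Euc d => ‖z‖⁻¹ • z) z h1 h2

theorem measurable_of_contDiffOn_compl {N : ℕ} (hg : ContDiffOn ℝ (N : WithTop ℕ∞) g {0}ᶜ) :
    Measurable g :=
  measurable_of_continuousOn_compl_singleton 0 hg.continuousOn

theorem measurable_angularPart (hg : Measurable g) : Measurable (angularPart g) := by
  unfold angularPart
  fun_prop

end AngularPart

/-! ### Orthonormal coordinates on the tangent hyperplane -/

section Frame

variable {d : ℕ} {v : Euc d}

/-- The inclusion of the tangent space at `v`, in the coordinates given by `u`. -/
noncomputable def frameIncl (u : OrthonormalBasis (Fin (d - 1)) ℝ (Submodule.span ℝ {v})ᗮ) :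
    Euc (d - 1) →ₗᵢ[ℝ] Euc d :=
  (Submodule.span ℝ {v})ᗮ.subtypeₗᵢ.comp u.repr.symm.toLinearIsometry

variable (u : OrthonormalBasis (Fin (d - 1)) ℝ (Submodule.span ℝ {v})ᗮ)

theorem frameIncl_apply (w : Euc (d - 1)) : frameIncl u w = ∑ l, w l • (u l : Euc d) := by
  have : frameIncl u w = ((u.repr.symm w : (Submodule.span ℝ {v})ᗮ) : Euc d) := rfl
  rw [this, ← u.sum_repr_symm]
  simp

theorem inner_frameIncl (w : Euc (d - 1)) : inner ℝ v (frameIncl u w) = 0 := by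
  have : frameIncl u w ∈ (Submodule.span ℝ {v})ᗮ := (u.repr.symm w).2
  exact Submodule.inner_right_of_mem_orthogonal (Submodule.mem_span_singleton_self v) this

theorem norm_add_frameIncl_sq (hv : ‖v‖ = 1) (w : Euc (d - 1)) :
    ‖v + frameIncl u w‖ ^ 2 = 1 + ‖w‖ ^ 2 := by
  rw [norm_add_sq_real, inner_frameIncl, hv, (frameIncl u).norm_map]
  ring

theorem base_add_frameIncl_ne_zero (hv : ‖v‖ = 1) (w : Euc (d - 1)) : v + frameIncl u w ≠ 0 := by
  intro h
  have := norm_add_frameIncl_sq u hv w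
  rw [h, norm_zero] at this
  nlinarith [sq_nonneg ‖w‖]

end Frame

/-- `v` is a maximum point on the unit sphere of a homogeneous function `g`. -/
structure IsSphereMax {d : ℕ} (α : ℝ) (N : ℕ) (g : Euc d → ℝ) (ghat : ℝ) (v : Euc d) : Prop where
  homog : IsHomogeneousOfOrder α g
  contDiff : ContDiffOn ℝ (N : WithTop ℕ∞) g {0}ᶜ
  norm_eq : ‖v‖ = 1
  value : g v = ghat
  le : ∀ ω : Euc d, ‖ω‖ = 1 → g ω ≤ ghat
  pos : 0 < ghat

/-! ### Phase and amplitude at a point of maximum, and the Hessian of the phase -/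

section LocalData

variable {d : ℕ} {α : ℝ} {N : ℕ} {g : Euc d → ℝ} {ghat : ℝ} {v : Euc d}

/-- The angular part of `g` in the gnomonic chart at `v`, normalized by the maximum. -/
noncomputable def chartProfile (g : Euc d → ℝ) (ghat : ℝ)
    (u : OrthonormalBasis (Fin (d - 1)) ℝ (Submodule.span ℝ {v})ᗮ) (w : Euc (d - 1)) : ℝ :=
  angularPart g (v + frameIncl u w) / ghat

/-- The phase of the Laplace integral at `v`. -/
noncomputable def laplacePhase (α : ℝ) (g : Euc d → ℝ) (ghat : ℝ)
    (u : OrthonormalBasis (Fin (d - 1)) ℝ (Submodule.span ℝ {v})ᗮ) (w : Euc (d - 1)) : ℝ :=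
  (chartProfile g ghat u w ^ (-2 / α) - 1) / 2

/-- The amplitude of the Laplace integral at `v`. -/
noncomputable def laplaceAmplitude (α : ℝ) (g : Euc d → ℝ) (ghat : ℝ)
    (u : OrthonormalBasis (Fin (d - 1)) ℝ (Submodule.span ℝ {v})ᗮ) (w : Euc (d - 1)) : ℝ :=
  chartProfile g ghat u w ^ (-(d : ℝ) / α) * (1 + ‖w‖ ^ 2) ^ (-(d : ℝ) / 2)

variable (u : OrthonormalBasis (Fin (d - 1)) ℝ (Submodule.span ℝ {v})ᗮ)

theorem IsSphereMax.angularPart_le (h : IsSphereMax α N g ghat v) {z : Euc d} (hz : z ≠ 0) :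
    angularPart g z ≤ ghat :=
  h.le _ (by rw [norm_smul, norm_inv, norm_norm, inv_mul_cancel₀ (norm_ne_zero_iff.2 hz)])

theorem IsSphereMax.chartProfile_zero (h : IsSphereMax α N g ghat v) :
    chartProfile g ghat u 0 = 1 := by
  rw [chartProfile, _root_.map_zero, add_zero, angularPart_of_norm_eq_one h.norm_eq, h.value,
    div_self h.pos.ne']

theorem IsSphereMax.chartProfile_le_one (h : IsSphereMax α N g ghat v) (w : Euc (d - 1)) :
    chartProfile g ghat u w ≤ 1 :=
  (div_le_one h.pos).2 (h.angularPart_le (base_add_frameIncl_ne_zero u h.norm_eq w))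

theorem IsSphereMax.contDiffAt_chartProfile (h : IsSphereMax α N g ghat v) (w : Euc (d - 1)) :
    ContDiffAt ℝ (N : WithTop ℕ∞) (chartProfile g ghat u) w := by
  have h1 := contDiffAt_angularPart h.contDiff (base_add_frameIncl_ne_zero u h.norm_eq w)
  have h2 : ContDiff ℝ (N : WithTop ℕ∞) fun w => v + frameIncl u w :=
    contDiff_const.add (frameIncl u).contDiff
  exact (h1.comp w h2.contDiffAt).div_const _

theorem IsSphereMax.contDiffAt_rpow (h : IsSphereMax α N g ghat v) (p : ℝ) :
    ContDiffAt ℝ (N : WithTop ℕ∞) (fun w => chartProfile g ghat u w ^ p) 0 :=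
  (h.contDiffAt_chartProfile u 0).rpow_const_of_ne (by rw [h.chartProfile_zero]; exact one_ne_zero)

theorem IsSphereMax.contDiffAt_laplacePhase (h : IsSphereMax α N g ghat v) :
    ContDiffAt ℝ (N : WithTop ℕ∞) (laplacePhase α g ghat u) 0 :=
  ((h.contDiffAt_rpow u _).sub contDiffAt_const).div_const _

theorem contDiff_one_add_norm_sq_rpow (p : ℝ) {n : WithTop ℕ∞} :
    ContDiff ℝ n fun w : Euc (d - 1) => (1 + ‖w‖ ^ 2) ^ p :=
  (contDiff_const.add (contDiff_norm_sq ℝ)).rpow_const_of_ne fun w => by positivity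

theorem IsSphereMax.contDiffAt_laplaceAmplitude (h : IsSphereMax α N g ghat v) :
    ContDiffAt ℝ (N : WithTop ℕ∞) (laplaceAmplitude α g ghat u) 0 :=
  (h.contDiffAt_rpow u _).mul (contDiff_one_add_norm_sq_rpow _).contDiffAt

theorem measurable_chartProfile (hg : Measurable g) : Measurable (chartProfile g ghat u) := by
  have h1 := measurable_angularPart hg
  have h2 : Measurable fun w => v + frameIncl u w :=
    (continuous_const.add (frameIncl u).continuous).measurable
  exact (h1.comp h2).div_const _

theorem measurable_laplacePhase (hg : Measurable g) : Measurable (laplacePhase α g ghat u) :=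
  (((measurable_chartProfile u hg).pow_const _).sub_const _).div_const _

theorem measurable_laplaceAmplitude (hg : Measurable g) :
    Measurable (laplaceAmplitude α g ghat u) :=
  ((measurable_chartProfile u hg).pow_const _).mul
    (contDiff_one_add_norm_sq_rpow (n := 0) _).continuous.measurable

theorem IsSphereMax.laplacePhase_zero (h : IsSphereMax α N g ghat v) :
    laplacePhase α g ghat u 0 = 0 := by
  rw [laplacePhase, h.chartProfile_zero]; simp

theorem IsSphereMax.laplaceAmplitude_zero (h : IsSphereMax α N g ghat v) :
    laplaceAmplitude α g ghat u 0 = 1 := by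
  rw [laplaceAmplitude, h.chartProfile_zero]; simp

theorem IsSphereMax.eventually_chartProfile_pos (h : IsSphereMax α N g ghat v) :
    ∀ᶠ w in 𝓝 0, 0 < chartProfile g ghat u w := by
  have h1 := (h.contDiffAt_chartProfile u 0).continuousAt
  have h2 : (0 : ℝ) < chartProfile g ghat u 0 := by rw [h.chartProfile_zero]; exact one_pos
  exact h1.eventually (lt_mem_nhds h2)

theorem IsSphereMax.eventually_laplacePhase_nonneg (hα : 0 < α) (h : IsSphereMax α N g ghat v) :
    ∀ᶠ w in 𝓝 0, 0 ≤ laplacePhase α g ghat u w := by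
  filter_upwards [h.eventually_chartProfile_pos u] with w hw
  have h1 : 1 ≤ chartProfile g ghat u w ^ (-2 / α) :=
    Real.one_le_rpow_of_pos_of_le_one_of_nonpos hw (h.chartProfile_le_one u w)
      (div_nonpos_of_nonpos_of_nonneg (by norm_num) hα.le)
  rw [laplacePhase]
  linarith

theorem IsSphereMax.fderiv_laplacePhase (hα : 0 < α) (h : IsSphereMax α N g ghat v) :
    fderiv ℝ (laplacePhase α g ghat u) 0 = 0 := by
  refine IsLocalMin.fderiv_eq_zero ?_
  filter_upwards [h.eventually_laplacePhase_nonneg u hα] with w hw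
  rwa [h.laplacePhase_zero]

theorem IsSphereMax.fderiv_chartProfile (h : IsSphereMax α N g ghat v) :
    fderiv ℝ (chartProfile g ghat u) 0 = 0 := by
  refine IsLocalMax.fderiv_eq_zero ?_
  filter_upwards with w
  rw [h.chartProfile_zero]
  exact h.chartProfile_le_one u w

/-- The tangent hyperplane leaves the sphere, so homogeneity contributes `‖v + frameIncl u w‖ ^ α`.
The quadratic part of this factor is the source of the identity matrix in `tangentDet`. -/
theorem IsSphereMax.eq_chartProfile_mul (h : IsSphereMax α N g ghat v) (w : Euc (d - 1)) :
    g (v + ∑ l, w l • (u l : Euc d)) =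
      ghat * (chartProfile g ghat u w * (1 + ‖w‖ ^ 2) ^ (α / 2)) := by
  have hn := norm_add_frameIncl_sq u h.norm_eq w
  rw [← frameIncl_apply, h.homog.eq_norm_rpow_mul (base_add_frameIncl_ne_zero u h.norm_eq w),
    chartProfile, ← hn, ← Real.rpow_natCast, ← Real.rpow_mul (norm_nonneg _)]
  have hp := h.pos.ne'
  have : ((2 : ℕ) : ℝ) * (α / 2) = α := by push_cast; ring
  rw [this]
  field_simp

theorem hasDerivAt_rpow_one (p : ℝ) : HasDerivAt (fun x : ℝ => x ^ p) p 1 := by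
  simpa using Real.hasDerivAt_rpow_const (x := 1) (p := p) (Or.inl one_ne_zero)

open Asymptotics in
theorem rpow_sub_one_sub_isLittleO {f : ℝ → ℝ} (p : ℝ) (hf : Tendsto f (𝓝 0) (𝓝 1))
    (hO : (fun t => f t - 1) =O[𝓝 0] fun t => t ^ 2) :
    (fun t => f t ^ p - 1 - p * (f t - 1)) =o[𝓝 0] fun t => t ^ 2 := by
  have h1 := (hasDerivAt_rpow_one p).isLittleO
  have h2 := (h1.comp_tendsto hf).trans_isBigO hO
  refine h2.congr_left fun t => ?_
  simp [mul_comm]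

open Asymptotics in
/-- The quadratic part of the phase in terms of the Hessian of `g` along the tangent space. -/
theorem IsSphereMax.taylorTerm_two_laplacePhase (hα : 0 < α) (hN : 2 ≤ N)
    (h : IsSphereMax α N g ghat v) (ζ : Euc (d - 1)) :
    taylorTerm (laplacePhase α g ghat u) 0 2 ζ = 2⁻¹ * (‖ζ‖ ^ 2 - (α * ghat)⁻¹ *
      iteratedFDeriv ℝ 2 (fun t : Euc (d - 1) => g (v + ∑ l, t l • (u l : Euc d))) 0
        (fun _ => ζ)) := by
  have hN' : (2 : WithTop ℕ∞) ≤ (N : WithTop ℕ∞) := by exact_mod_cast hN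
  set κ := chartProfile g ghat u with hκ
  set G : Euc (d - 1) → ℝ := fun t => g (v + ∑ l, t l • (u l : Euc d)) with hG
  have hGeq : G = fun w => ghat * (κ w * (1 + ‖w‖ ^ 2) ^ (α / 2)) :=
    funext fun w => h.eq_chartProfile_mul u w
  have hκ2 : ContDiffAt ℝ 2 κ 0 := (h.contDiffAt_chartProfile u 0).of_le hN'
  have hS2 : ContDiffAt ℝ 2 (laplacePhase α g ghat u) 0 := (h.contDiffAt_laplacePhase u).of_le hN'
  have hG2 : ContDiffAt ℝ 2 G 0 := by
    rw [hGeq]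
    exact contDiffAt_const.mul (hκ2.mul (contDiff_one_add_norm_sq_rpow _).contDiffAt)
  have lκ := hκ2.line_isLittleO ζ
  have lS := hS2.line_isLittleO ζ
  have lG := hG2.line_isLittleO ζ
  have hG0 : G 0 = ghat := by
    rw [hGeq]; simp [hκ, h.chartProfile_zero]
  have hκ0 : κ 0 = 1 := h.chartProfile_zero u
  rw [h.fderiv_chartProfile, hκ0] at lκ
  rw [h.laplacePhase_zero] at lS
  rw [hG0] at lG
  simp only [zero_add, zero_apply, zero_mul, add_zero] at lκ lS lG
  set K := 2⁻¹ * iteratedFDeriv ℝ 2 κ 0 fun _ => ζ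
  set S₂ := 2⁻¹ * iteratedFDeriv ℝ 2 (laplacePhase α g ghat u) 0 fun _ => ζ with hS₂
  set H := iteratedFDeriv ℝ 2 G 0 fun _ => ζ
  have ht2 : Tendsto (fun t : ℝ => t ^ 2) (𝓝 0) (𝓝 0) := by
    simpa using ((continuous_pow 2).tendsto (0 : ℝ))
  have O2 : ∀ a : ℝ, (fun t : ℝ => a * t ^ 2) =O[𝓝 0] fun t => t ^ 2 := fun a =>
    (isBigO_refl _ _).const_mul_left a
  have hκO : (fun t : ℝ => κ (t • ζ) - 1) =O[𝓝 0] fun t => t ^ 2 := by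
    refine (lκ.isBigO.add (O2 K)).congr_left fun t => ?_
    ring
  have hκt : Tendsto (fun t : ℝ => κ (t • ζ)) (𝓝 0) (𝓝 1) := by
    have := hκO.trans_tendsto ht2
    simpa using this.add_const 1
  have e1 := rpow_sub_one_sub_isLittleO (-2 / α) hκt hκO
  -- Since `κ - 1` is of order `t ^ 2` along the line, linearizing the power at `1` costs only `o(t
  -- ^ 2)`. The phase is therefore `-α⁻¹ * K * t ^ 2` to second order.
  have e2 : (fun t : ℝ => laplacePhase α g ghat u (t • ζ) + α⁻¹ * K * t ^ 2) =o[𝓝 0]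
      fun t => t ^ 2 := by
    refine ((e1.const_mul_left 2⁻¹).add (lκ.const_mul_left (-α⁻¹))).congr_left fun t => ?_
    simp only [laplacePhase, ← hκ]
    ring
  have e3 := eq_zero_of_quadratic_isLittleO
    (a := fderiv ℝ (laplacePhase α g ghat u) 0 ζ) (b := S₂ + α⁻¹ * K)
    ((e2.sub lS).congr_left fun t => by ring)
  have hRO : (fun t : ℝ => (1 + ‖t • ζ‖ ^ 2) - 1) =O[𝓝 0] fun t => t ^ 2 := by
    refine (O2 (‖ζ‖ ^ 2)).congr_left fun t => ?_
    rw [norm_smul, mul_pow, Real.norm_eq_abs, sq_abs]; ring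
  have hRt : Tendsto (fun t : ℝ => 1 + ‖t • ζ‖ ^ 2) (𝓝 0) (𝓝 1) := by
    have := (by fun_prop : Continuous fun t : ℝ => 1 + ‖t • ζ‖ ^ 2).tendsto 0
    simpa using this
  have e4 := rpow_sub_one_sub_isLittleO (α / 2) hRt hRO
  have hR1 : (fun t : ℝ => (1 + ‖t • ζ‖ ^ 2) ^ (α / 2)) =O[𝓝 0] fun _ => (1 : ℝ) :=
    (hRt.rpow_const (p := α / 2) (Or.inl one_ne_zero)).isBigO_one ℝ
  have hc1 : (fun t : ℝ => 1 + K * t ^ 2) =O[𝓝 0] fun _ => (1 : ℝ) := by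
    have : Tendsto (fun t : ℝ => 1 + K * t ^ 2) (𝓝 0) (𝓝 (1 + K * 0 ^ 2)) :=
      (by fun_prop : Continuous fun t : ℝ => 1 + K * t ^ 2).tendsto 0
    exact this.isBigO_one ℝ
  -- Both factors of `G / ghat` are `1 + O(t ^ 2)`, so their second-order coefficients add and the
  -- cross term is negligible. Eliminating `K` between this and the phase gives the claim.
  have e5 : (fun t : ℝ => G (t • ζ) - (ghat + ghat * (K + α / 2 * ‖ζ‖ ^ 2) * t ^ 2)) =o[𝓝 0]
      fun t => t ^ 2 := by
    have f1 : (fun t : ℝ => (κ (t • ζ) - (1 + K * t ^ 2)) * (1 + ‖t • ζ‖ ^ 2) ^ (α / 2)) =o[𝓝 0]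
        fun t => t ^ 2 := by simpa using lκ.mul_isBigO hR1
    have f2 : (fun t : ℝ => (1 + K * t ^ 2) * ((1 + ‖t • ζ‖ ^ 2) ^ (α / 2) - 1 -
        α / 2 * ((1 + ‖t • ζ‖ ^ 2) - 1))) =o[𝓝 0] fun t => t ^ 2 := by
      simpa using hc1.mul_isLittleO e4
    have f3 : (fun t : ℝ => t ^ 2 * (K * (α / 2) * ‖ζ‖ ^ 2 * t ^ 2)) =o[𝓝 0] fun t => t ^ 2 := by
      have : (fun t : ℝ => K * (α / 2) * ‖ζ‖ ^ 2 * t ^ 2) =o[𝓝 0] fun _ => (1 : ℝ) := by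
        rw [isLittleO_one_iff]
        simpa using ht2.const_mul (K * (α / 2) * ‖ζ‖ ^ 2)
      simpa using (isBigO_refl (fun t : ℝ => t ^ 2) (𝓝 0)).mul_isLittleO this
    refine (((f1.add f2).add f3).const_mul_left ghat).congr_left fun t => ?_
    have hnt : ‖t • ζ‖ ^ 2 = t ^ 2 * ‖ζ‖ ^ 2 := by
      rw [norm_smul, mul_pow, Real.norm_eq_abs, sq_abs]
    rw [hGeq]
    simp only [hnt]
    ring
  have e6 := eq_zero_of_quadratic_isLittleO
    (a := fderiv ℝ G 0 ζ) (b := 2⁻¹ * H - ghat * (K + α / 2 * ‖ζ‖ ^ 2))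
    ((e5.sub lG).congr_left fun t => by ring)
  have hgp := h.pos.ne'
  have hT : taylorTerm (laplacePhase α g ghat u) 0 2 ζ = S₂ := by
    simp [taylorTerm, hS₂, Nat.factorial]
  rw [hT, eq_neg_of_add_eq_zero_left e3.2]
  have hK : K = (2⁻¹ * H) / ghat - α / 2 * ‖ζ‖ ^ 2 := by
    have := e6.2
    field_simp
    linarith
  rw [hK]
  field_simp
  ring

open Matrix in
/-- The quadratic part of the phase is given by the matrix
`1 - (α * ghat)⁻¹ • tangentHessian g v u`. -/
theorem IsSphereMax.taylorTerm_two_eq_quadratic (hα : 0 < α) (hN : 2 ≤ N)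
    (h : IsSphereMax α N g ghat v) (ζ : Euc (d - 1)) :
    taylorTerm (laplacePhase α g ghat u) 0 2 ζ =
      2⁻¹ * (ζ.ofLp ⬝ᵥ ((1 - (α * ghat)⁻¹ • tangentHessian g v u) *ᵥ ζ.ofLp)) := by
  rw [h.taylorTerm_two_laplacePhase u hα hN ζ, sub_mulVec, one_mulVec, dotProduct_sub,
    smul_mulVec, dotProduct_smul, smul_eq_mul]
  congr 2
  · rw [EuclideanSpace.real_norm_sq_eq, dotProduct]
    exact Finset.sum_congr rfl fun i _ => sq _
  · congr 1
    have hζ : ζ = ∑ i, ζ i • (EuclideanSpace.single i (1 : ℝ) : Euc (d - 1)) := by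
      ext j
      simp [Finset.sum_apply, Pi.single_apply]
    simp only [dotProduct, mulVec, tangentHessian, of_apply, iteratedFDeriv_two_apply]
    conv_lhs => rw [hζ]
    simp only [map_sum, map_smul, _root_.sum_apply, _root_.smul_apply, smul_eq_mul]
    simp only [Matrix.cons_val_zero, Matrix.cons_val_one, Finset.mul_sum]
    rw [Finset.sum_comm]
    refine Finset.sum_congr rfl fun i _ => Finset.sum_congr rfl fun j _ => ?_
    ring

end LocalData

/-! ### Lebesgue density of the standard Gaussian vector -/

theorem withDensity_gaussian_charFun {d : ℕ} (t : Euc d) :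
    ∫ z : Euc d, Complex.exp ((inner ℝ z t : ℝ) * Complex.I) *
      (((2 * Real.pi) ^ (-(d : ℝ) / 2) * Real.exp (-‖z‖ ^ 2 / 2) : ℝ) : ℂ) =
      Complex.exp (-‖t‖ ^ 2 / 2) := by
  have h := GaussianFourier.integral_cexp_neg_mul_sq_norm_add (V := Euc d) (b := 2⁻¹) (by norm_num)
    Complex.I t
  have h2 : ((2 * Real.pi : ℝ) ^ (-(d : ℝ) / 2) : ℝ) * ((2 * Real.pi : ℝ) ^ ((d : ℝ) / 2) : ℝ)
      = 1 := by
    rw [← Real.rpow_add (by positivity), neg_div, neg_add_cancel, Real.rpow_zero]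
  have h3 : ((Real.pi : ℂ) / 2⁻¹) ^ ((Module.finrank ℝ (Euc d) : ℂ) / 2) =
      (((2 * Real.pi : ℝ) ^ ((d : ℝ) / 2) : ℝ) : ℂ) := by
    rw [Complex.ofReal_cpow (by positivity), finrank_euclideanSpace_fin]
    congr 1
    · push_cast; field_simp
    · push_cast; rfl
  calc _ = ∫ z : Euc d, (((2 * Real.pi : ℝ) ^ (-(d : ℝ) / 2) : ℝ) : ℂ) *
        Complex.exp (-2⁻¹ * ‖z‖ ^ 2 + Complex.I * (inner ℝ t z : ℝ)) := by
        congr 1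
        funext z
        rw [Complex.exp_add, real_inner_comm]
        push_cast
        ring_nf
    _ = _ := by
        rw [integral_const_mul, h, h3, ← mul_assoc, ← Complex.ofReal_mul, h2, Complex.ofReal_one,
          one_mul]
        congr 1
        rw [Complex.I_sq]
        ring

/-- Both measures are finite and have the same characteristic function. -/
theorem stdGaussian_eq_withDensity (d : ℕ) : stdGaussian (Euc d) =
    (volume : Measure (Euc d)).withDensity (fun z => ENNReal.ofReal
      ((2 * Real.pi) ^ (-(d : ℝ) / 2) * Real.exp (-‖z‖ ^ 2 / 2))) := by
  have hint : Integrable (fun z : Euc d =>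
      (2 * Real.pi) ^ (-(d : ℝ) / 2) * Real.exp (-‖z‖ ^ 2 / 2)) := by
    refine ((integrable_exp_neg_mul_norm_sq (E := Euc d) (c := 2⁻¹) (by norm_num)).const_mul
      ((2 * Real.pi) ^ (-(d : ℝ) / 2))).congr (Eventually.of_forall fun z => ?_)
    simp only
    ring_nf
  have hfin := isFiniteMeasure_withDensity_ofReal hint.2
  apply Measure.ext_of_charFun
  funext t
  rw [charFun_stdGaussian, ← withDensity_gaussian_charFun t, charFun_apply,
    integral_withDensity_eq_integral_toReal_smul (by fun_prop)
      (Eventually.of_forall fun _ => ENNReal.ofReal_lt_top)]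
  congr 1
  funext z
  rw [ENNReal.toReal_ofReal (by positivity), Complex.real_smul, mul_comm]

/-! ### Polar coordinates, with angular averages taken over the unit ball -/

section Polar

variable {d : ℕ}

theorem lintegral_eq_lintegral_toSphere {F : ℝ × Euc d → ℝ≥0∞} (hF : Measurable F) (hd : 0 < d) :
    ∫⁻ z : Euc d, F (‖z‖, ‖z‖⁻¹ • z) =
      ∫⁻ ω, (∫⁻ R in Set.Ioi (0 : ℝ), ENNReal.ofReal (R ^ (d - 1)) * F (R, (ω : Euc d)))
        ∂((volume : Measure (Euc d)).toSphere) := by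
  have : Nonempty (Fin d) := ⟨⟨0, hd⟩⟩
  have hmp := (volume : Measure (Euc d)).measurePreserving_homeomorphUnitSphereProd
  rw [finrank_euclideanSpace_fin] at hmp
  have hF' : Measurable fun p : Metric.sphere (0 : Euc d) 1 × Set.Ioi (0 : ℝ) =>
      F ((p.2 : ℝ), (p.1 : Euc d)) :=
    hF.comp ((measurable_subtype_coe.comp measurable_snd).prodMk
      (measurable_subtype_coe.comp measurable_fst))
  calc _ = ∫⁻ z in ({0}ᶜ : Set (Euc d)), F (‖z‖, ‖z‖⁻¹ • z) := by
        rw [restrict_compl_singleton]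
    _ = ∫⁻ z : ({0}ᶜ : Set (Euc d)), F (‖(z : Euc d)‖, ‖(z : Euc d)‖⁻¹ • (z : Euc d))
        ∂(volume.comap Subtype.val) := by
        rw [lintegral_subtype_comap (measurableSet_singleton _).compl
          (fun z : Euc d => F (‖z‖, ‖z‖⁻¹ • z))]
    _ = ∫⁻ p, F ((p.2 : ℝ), (p.1 : Euc d))
        ∂((volume : Measure (Euc d)).toSphere.prod (Measure.volumeIoiPow (d - 1))) := by
        rw [← hmp.lintegral_comp hF']
        simp only [homeomorphUnitSphereProd_apply_snd_coe, homeomorphUnitSphereProd_apply_fst_coe]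
    _ = ∫⁻ ω, ∫⁻ R, F ((R : ℝ), (ω : Euc d)) ∂(Measure.volumeIoiPow (d - 1))
        ∂((volume : Measure (Euc d)).toSphere) := lintegral_prod _ hF'.aemeasurable
    _ = _ := by
        congr 1
        funext ω
        have hm : Measurable fun R : ℝ => F (R, (ω : Euc d)) :=
          hF.comp (measurable_id.prodMk measurable_const)
        have hm' : Measurable fun R : Set.Ioi (0 : ℝ) => F ((R : ℝ), (ω : Euc d)) :=
          hm.comp measurable_subtype_coe
        rw [Measure.volumeIoiPow, lintegral_withDensity_eq_lintegral_mul _ (by fun_prop) hm']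
        exact lintegral_subtype_comap measurableSet_Ioi
          (fun R : ℝ => ENNReal.ofReal (R ^ (d - 1)) * F (R, (ω : Euc d)))

theorem lintegral_Ioo_pow (hd : 0 < d) {T : ℝ} (hT : 0 ≤ T) :
    ∫⁻ R in Set.Ioo (0 : ℝ) T, ENNReal.ofReal (R ^ (d - 1)) =
      ENNReal.ofReal (T ^ d / d) := by
  rw [Measure.restrict_congr_set Ioo_ae_eq_Ioc, ← ofReal_integral_eq_lintegral_ofReal,
    ← intervalIntegral.integral_of_le hT]
  · rw [integral_pow]
    have h1 : d - 1 + 1 = d := Nat.sub_add_cancel hd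
    have h2 : ((d - 1 : ℕ) : ℝ) + 1 = d := by exact_mod_cast h1
    rw [h1, h2, zero_pow hd.ne', sub_zero]
  · exact (intervalIntegral.intervalIntegrable_pow _).1
  · filter_upwards [ae_restrict_mem measurableSet_Ioc] with y hy
    exact pow_nonneg hy.1.le _

/-- Integrals over the unit sphere, expressed through the unit ball. -/
theorem lintegral_ball_angular {F : Euc d → ℝ≥0∞} (hF : Measurable F) (hd : 0 < d) :
    d * ∫⁻ z in Metric.ball (0 : Euc d) 1, F (‖z‖⁻¹ • z) =
      ∫⁻ ω, F (ω : Euc d) ∂((volume : Measure (Euc d)).toSphere) := by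
  have h := lintegral_eq_lintegral_toSphere (d := d)
    (F := fun p => (Set.Iio (1 : ℝ)).indicator (fun _ => F p.2) p.1) (by
      have : (fun p : ℝ × Euc d => (Set.Iio (1 : ℝ)).indicator (fun _ => F p.2) p.1) =
        (Set.Iio (1 : ℝ) ×ˢ (Set.univ : Set (Euc d))).indicator fun p => F p.2 := by
        funext p
        by_cases hp : p.1 < 1 <;> simp [Set.indicator, hp]
      rw [this]
      exact (hF.comp measurable_snd).indicator (measurableSet_Iio.prod MeasurableSet.univ)) hd
  have h1 : ∫⁻ z : Euc d, (Set.Iio (1 : ℝ)).indicator (fun _ => F (‖z‖⁻¹ • z)) ‖z‖ =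
      ∫⁻ z in Metric.ball (0 : Euc d) 1, F (‖z‖⁻¹ • z) := by
    rw [← lintegral_indicator Metric.isOpen_ball.measurableSet]
    congr 1
    funext z
    by_cases hz : ‖z‖ < 1 <;> simp [Set.indicator, hz]
  have h2 : ∀ c : ℝ≥0∞, ∫⁻ R in Set.Ioi (0 : ℝ), ENNReal.ofReal (R ^ (d - 1)) *
      (Set.Iio (1 : ℝ)).indicator (fun _ => c) R = ENNReal.ofReal (1 / d) * c := by
    intro c
    have : ∀ R : ℝ, ENNReal.ofReal (R ^ (d - 1)) * (Set.Iio (1 : ℝ)).indicator (fun _ => c) R =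
        (Set.Iio (1 : ℝ)).indicator (fun R => ENNReal.ofReal (R ^ (d - 1)) * c) R := by
      intro R
      by_cases hR : R < 1 <;> simp [Set.indicator, hR]
    simp only [this]
    rw [lintegral_indicator measurableSet_Iio, Measure.restrict_restrict measurableSet_Iio,
      Set.inter_comm, Set.Ioi_inter_Iio, lintegral_mul_const _ (by fun_prop),
      lintegral_Ioo_pow hd zero_le_one, one_pow]
  rw [← h1, h]
  simp only [h2]
  have hF' : Measurable fun ω : Metric.sphere (0 : Euc d) 1 => F (ω : Euc d) :=
    hF.comp measurable_subtype_coe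
  rw [lintegral_const_mul _ hF', ← mul_assoc,
    ← ENNReal.ofReal_natCast, ← ENNReal.ofReal_mul (by positivity), mul_one_div_cancel (by positivity)]
  simp

/-- The direction is averaged over the unit ball rather than the sphere: functions of degree zero on
the ball can be cut along cones and handled with linear coordinates and Lebesgue measure alone. -/
theorem lintegral_polar_ball {F : ℝ × Euc d → ℝ≥0∞} (hF : Measurable F) (hd : 0 < d) :
    ∫⁻ z : Euc d, F (‖z‖, ‖z‖⁻¹ • z) =
      d * ∫⁻ z in Metric.ball (0 : Euc d) 1,
        ∫⁻ R in Set.Ioi (0 : ℝ), ENNReal.ofReal (R ^ (d - 1)) * F (R, ‖z‖⁻¹ • z) := by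
  rw [lintegral_eq_lintegral_toSphere hF hd]
  have hm : Measurable fun ω : Euc d =>
      ∫⁻ R in Set.Ioi (0 : ℝ), ENNReal.ofReal (R ^ (d - 1)) * F (R, ω) := by
    refine Measurable.lintegral_prod_right' (f := fun p : Euc d × ℝ =>
      ENNReal.ofReal (p.2 ^ (d - 1)) * F (p.2, p.1)) ?_
    have h1 : Measurable fun p : Euc d × ℝ => ENNReal.ofReal (p.2 ^ (d - 1)) := by fun_prop
    exact h1.mul (hF.comp measurable_swap)
  exact (lintegral_ball_angular hm hd).symm

end Polar

/-- The density at `x` of `R ^ α * c`, where `R` has (unnormalized) density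
`R ^ (d - 1) * exp (- R ^ 2 / 2)` on the positive half-line. -/
noncomputable def densityKernel (d : ℕ) (α x c : ℝ) : ℝ :=
  if 0 < x * c then (x / c) ^ ((d : ℝ) / α) / (α * |x|) * Real.exp (-(x / c) ^ (2 / α) / 2) else 0

/-! ### Density along a fixed direction -/

section DensityKernel

variable {d : ℕ} {α : ℝ}

theorem div_pos_of_mul_pos {x c : ℝ} (h : 0 < x * c) : 0 < x / c := by
  rcases pos_and_pos_or_neg_and_neg_of_mul_pos h with ⟨h1, h2⟩ | ⟨h1, h2⟩
  · positivity
  · exact div_pos_of_neg_of_neg h1 h2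

theorem densityKernel_nonneg (hα : 0 < α) (x c : ℝ) : 0 ≤ densityKernel d α x c := by
  unfold densityKernel
  split_ifs with h
  · have := div_pos_of_mul_pos h
    positivity
  · exact le_rfl

theorem measurable_densityKernel :
    Measurable fun p : ℝ × ℝ => densityKernel d α p.1 p.2 := by
  unfold densityKernel
  refine Measurable.ite (measurableSet_lt measurable_const (by fun_prop)) ?_ measurable_const
  fun_prop

/-- With `s = (x / c) ^ (1 / α)` the Gaussian factor absorbs `s ^ d`. Uniformity in `c` gives a
constant majorant over directions, locally uniform in `x ≠ 0`, hence continuity of the density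
there. -/
theorem exists_densityKernel_le (d : ℕ) (hα : 0 < α) :
    ∃ K, 0 ≤ K ∧ ∀ x c, densityKernel d α x c ≤ K / (α * |x|) := by
  obtain ⟨K, hK, h⟩ := exists_pow_le_mul_exp_sq d (η := 1 / 2) (by norm_num)
  refine ⟨K, hK, fun x c => ?_⟩
  unfold densityKernel
  split_ifs with hx
  · have hxc := div_pos_of_mul_pos hx
    set s := (x / c) ^ (1 / α) with hs
    have hs0 : 0 ≤ s := by positivity
    have e1 : (x / c) ^ ((d : ℝ) / α) = s ^ d := by
      rw [hs, ← Real.rpow_natCast, ← Real.rpow_mul hxc.le]; congr 1; field_simp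
    have e2 : (x / c) ^ (2 / α) = s ^ 2 := by
      rw [hs, ← Real.rpow_natCast, ← Real.rpow_mul hxc.le]; congr 1; push_cast; field_simp
    rw [e1, e2, div_mul_eq_mul_div]
    gcongr
    calc s ^ d * Real.exp (-s ^ 2 / 2) ≤ K * Real.exp (1 / 2 * s ^ 2) * Real.exp (-s ^ 2 / 2) := by
          gcongr; exact h s hs0
      _ = K := by rw [mul_assoc, ← Real.exp_add]; ring_nf; simp
  · positivity

theorem continuousAt_densityKernel (c : ℝ) {x : ℝ} (hα : α ≠ 0) (hx : x ≠ 0) :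
    ContinuousAt (fun x => densityKernel d α x c) x := by
  rcases lt_trichotomy 0 (x * c) with h | h | h
  · have h1 : ∀ᶠ y in 𝓝 x, 0 < y * c :=
      (continuousAt_id.mul continuousAt_const).eventually (lt_mem_nhds h)
    have h2 : (fun y => (y / c) ^ ((d : ℝ) / α) / (α * |y|) *
        Real.exp (-(y / c) ^ (2 / α) / 2)) =ᶠ[𝓝 x] fun y => densityKernel d α y c := by
      filter_upwards [h1] with y hy
      rw [densityKernel, if_pos hy]
    refine ContinuousAt.congr ?_ h2
    have hxc := (div_pos_of_mul_pos h).ne'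
    have c1 : ContinuousAt (fun y => y / c) x := by fun_prop
    have c2 := c1.rpow_const (p := (d : ℝ) / α) (Or.inl hxc)
    have c3 := c1.rpow_const (p := 2 / α) (Or.inl hxc)
    have c4 : ContinuousAt (fun y : ℝ => α * |y|) x := by fun_prop
    exact (c2.div c4 (mul_ne_zero hα (abs_ne_zero.2 hx))).mul (c3.neg.div_const 2).rexp
  · have hc : c = 0 := (mul_eq_zero.1 h.symm).resolve_left hx
    simp only [densityKernel, hc, mul_zero, lt_irrefl, if_false]
    exact continuousAt_const
  · have h1 : ∀ᶠ y in 𝓝 x, y * c < 0 :=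
      (continuousAt_id.mul continuousAt_const).eventually (gt_mem_nhds h)
    refine (continuousAt_const (y := (0 : ℝ))).congr ?_
    filter_upwards [h1] with y hy
    rw [densityKernel, if_neg hy.not_gt]

/-- Change of variables `x = R ^ α * c`, onto the half-line `x * c > 0`. For `c = 0` the map is
constant, and both sides vanish because `χ 0 = 0`. -/
theorem lintegral_rpow_mul_eq_densityKernel (hα : 0 < α) (hd : 0 < d) {χ : ℝ → ℝ≥0∞}
    (h0 : χ 0 = 0) (c : ℝ) :
    ∫⁻ R in Set.Ioi (0 : ℝ), ENNReal.ofReal (R ^ (d - 1)) *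
        (χ (R ^ α * c) * ENNReal.ofReal (Real.exp (-R ^ 2 / 2))) =
      ∫⁻ x, χ x * ENNReal.ofReal (densityKernel d α x c) := by
  rcases eq_or_ne c 0 with rfl | hc
  · simp [h0, densityKernel]
  have hder : ∀ R ∈ Set.Ioi (0 : ℝ), HasDerivWithinAt (fun R : ℝ => R ^ α * c)
      (α * R ^ (α - 1) * c) (Set.Ioi 0) R := fun R hR =>
    ((Real.hasDerivAt_rpow_const (Or.inl (ne_of_gt hR))).mul_const c).hasDerivWithinAt
  have hinj : Set.InjOn (fun R : ℝ => R ^ α * c) (Set.Ioi 0) := by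
    intro R hR R' hR' h
    exact Real.rpow_left_injOn hα.ne' (Set.Ioi_subset_Ici_self hR) (Set.Ioi_subset_Ici_self hR')
      (mul_right_cancel₀ hc h)
  have himage : (fun R : ℝ => R ^ α * c) '' Set.Ioi 0 = {x | 0 < x * c} := by
    ext x
    constructor
    · rintro ⟨R, hR, rfl⟩
      have hR' : (0 : ℝ) < R := hR
      have : 0 < R ^ α * (c * c) := mul_pos (by positivity) (mul_self_pos.2 hc)
      simpa [mul_assoc] using this
    · intro hx
      have hxc := div_pos_of_mul_pos hx
      refine ⟨(x / c) ^ α⁻¹, by simpa using Real.rpow_pos_of_pos hxc _, ?_⟩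
      simp only
      rw [← Real.rpow_mul hxc.le, inv_mul_cancel₀ hα.ne', Real.rpow_one, div_mul_cancel₀ _ hc]
  have key := lintegral_image_eq_lintegral_abs_deriv_mul measurableSet_Ioi hder hinj
    (fun x => χ x * ENNReal.ofReal (densityKernel d α x c))
  rw [himage] at key
  have hset : MeasurableSet {x : ℝ | 0 < x * c} := measurableSet_lt measurable_const (by fun_prop)
  have hsupp : ∫⁻ x, χ x * ENNReal.ofReal (densityKernel d α x c) =
      ∫⁻ x in {x | 0 < x * c}, χ x * ENNReal.ofReal (densityKernel d α x c) := by
    rw [← lintegral_indicator hset]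
    congr 1
    funext x
    by_cases hx : 0 < x * c
    · rw [Set.indicator_of_mem (by exact hx)]
    · rw [Set.indicator_of_notMem (by exact hx), densityKernel, if_neg hx]; simp
  rw [hsupp, key]
  refine setLIntegral_congr_fun measurableSet_Ioi fun R hR => ?_
  have hR' : (0 : ℝ) < R := hR
  have hpos : 0 < R ^ α * c * c := by
    rw [mul_assoc]; exact mul_pos (by positivity) (mul_self_pos.2 hc)
  have hk : |α * R ^ (α - 1) * c| * densityKernel d α (R ^ α * c) c =
      R ^ (d - 1) * Real.exp (-R ^ 2 / 2) := by
    rw [densityKernel, if_pos hpos, mul_div_cancel_right₀ _ hc, ← Real.rpow_mul hR'.le,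
      ← Real.rpow_mul hR'.le, mul_div_cancel₀ _ hα.ne', mul_div_cancel₀ _ hα.ne',
      Real.rpow_natCast, abs_mul, abs_mul, abs_mul, abs_of_pos hα,
      abs_of_pos (Real.rpow_pos_of_pos hR' _), abs_of_pos (Real.rpow_pos_of_pos hR' _),
      Real.rpow_sub_one hR'.ne', Real.rpow_two]
    have h1 : R ^ d = R ^ (d - 1) * R := by rw [← pow_succ, Nat.sub_add_cancel hd]
    rw [h1]
    have h2 : |c| ≠ 0 := abs_ne_zero.2 hc
    have h3 : R ^ α ≠ 0 := (Real.rpow_pos_of_pos hR' _).ne'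
    field_simp
  rw [mul_left_comm (ENNReal.ofReal |_|), ← ENNReal.ofReal_mul (abs_nonneg _), hk,
    ENNReal.ofReal_mul (by positivity)]
  ring

end DensityKernel

/-! ### Law of `g(η)` off the origin: continuous density and tail -/

section Density

variable {d : ℕ} {α : ℝ} {g : Euc d → ℝ}

/-- The continuous density of `g(η)` outside `0`. -/
noncomputable def chaosDensity (α : ℝ) (g : Euc d → ℝ) (x : ℝ) : ℝ :=
  (2 * Real.pi) ^ (-(d : ℝ) / 2) *
    (d * ∫ z in Metric.ball (0 : Euc d) 1, densityKernel d α x (angularPart g z))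

theorem chaosDensity_nonneg (hα : 0 < α) (x : ℝ) : 0 ≤ chaosDensity α g x := by
  have : 0 ≤ ∫ z in Metric.ball (0 : Euc d) 1, densityKernel d α x (angularPart g z) :=
    integral_nonneg fun z => densityKernel_nonneg hα _ _
  unfold chaosDensity
  positivity

theorem integrableOn_densityKernel (hα : 0 < α) (hg : Measurable g) (x : ℝ) :
    IntegrableOn (fun z => densityKernel d α x (angularPart g z)) (Metric.ball (0 : Euc d) 1) := by
  obtain ⟨K, hK, h⟩ := exists_densityKernel_le d hα
  have hm : Measurable fun z => densityKernel d α x (angularPart g z) :=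
    measurable_densityKernel.comp (measurable_const.prodMk (measurable_angularPart hg))
  refine Measure.integrableOn_of_bounded (M := K / (α * |x|)) measure_ball_lt_top.ne
    hm.aestronglyMeasurable (Eventually.of_forall fun z => ?_)
  rw [Real.norm_of_nonneg (densityKernel_nonneg hα _ _)]
  exact h _ _

theorem continuousOn_chaosDensity (hα : 0 < α) (hg : Measurable g) :
    ContinuousOn (chaosDensity α g) {0}ᶜ := by
  intro x hx
  have hx' : x ≠ 0 := hx
  refine ContinuousAt.continuousWithinAt ?_
  obtain ⟨K, hK, h⟩ := exists_densityKernel_le d hα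
  have hm : ∀ x, Measurable fun z => densityKernel d α x (angularPart g z) := fun x =>
    measurable_densityKernel.comp (measurable_const.prodMk (measurable_angularPart hg))
  have key : ContinuousAt (fun x => ∫ z in Metric.ball (0 : Euc d) 1,
      densityKernel d α x (angularPart g z)) x := by
    refine continuousAt_of_dominated (bound := fun _ => K / (α * (|x| / 2)))
      (Eventually.of_forall fun y => (hm y).aestronglyMeasurable) ?_ ?_
      (Eventually.of_forall fun z => continuousAt_densityKernel _ hα.ne' hx')
    · have h1 : ∀ᶠ y in 𝓝 x, |x| / 2 < |y| :=
        continuous_abs.continuousAt.eventually (lt_mem_nhds (by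
          have := abs_pos.2 hx'; linarith))
      filter_upwards [h1] with y hy
      refine Eventually.of_forall fun z => ?_
      rw [Real.norm_of_nonneg (densityKernel_nonneg hα _ _)]
      refine (h _ _).trans ?_
      have := abs_pos.2 hx'
      gcongr
    · exact integrableOn_const measure_ball_lt_top.ne
  exact continuousAt_const.mul (continuousAt_const.mul key)

/-- Polar coordinates, the change of variables along each direction, and Tonelli. The test function
must vanish at `0` because `g` may be zero on a cone of positive measure, which gives the law an
atom there. -/
theorem lintegral_comp_stdGaussian (hα : 0 < α) (hd : 0 < d) (hhom : IsHomogeneousOfOrder α g)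
    (hg : Measurable g) {χ : ℝ → ℝ≥0∞} (hχ : Measurable χ) (h0 : χ 0 = 0) :
    ∫⁻ z, χ (g z) ∂(stdGaussian (Euc d)) =
      ∫⁻ x, χ x * ENNReal.ofReal (chaosDensity α g x) := by
  have hA := measurable_angularPart hg
  have hc : (0 : ℝ) ≤ (2 * Real.pi) ^ (-(d : ℝ) / 2) := by positivity
  have hχg : Measurable fun z => χ (g z) := hχ.comp hg
  rw [stdGaussian_eq_withDensity, lintegral_withDensity_eq_lintegral_mul _ (by fun_prop)
    hχg]
  have hF : Measurable fun p : ℝ × Euc d => χ (p.1 ^ α * angularPart g p.2) *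
      ENNReal.ofReal (Real.exp (-p.1 ^ 2 / 2)) := by
    have h1 : Measurable fun p : ℝ × Euc d => p.1 ^ α * angularPart g p.2 :=
      (measurable_fst.pow_const α).mul (hA.comp measurable_snd)
    exact (hχ.comp h1).mul (by fun_prop)
  have hangle : ∀ z : Euc d, angularPart g (‖z‖⁻¹ • z) = angularPart g z := by
    intro z
    rcases eq_or_ne z 0 with rfl | hz
    · simp
    · exact angularPart_smul (inv_pos.2 (norm_pos_iff.2 hz)) z
  have hgA : ∀ z : Euc d, z ≠ 0 → g z = ‖z‖ ^ α * angularPart g (‖z‖⁻¹ • z) := fun z hz => by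
    rw [hangle, ← hhom.eq_norm_rpow_mul hz]
  have e1 : ∫⁻ z : Euc d, ((fun z => ENNReal.ofReal ((2 * Real.pi) ^ (-(d : ℝ) / 2) *
      Real.exp (-‖z‖ ^ 2 / 2)) : Euc d → ℝ≥0∞) * (fun z => χ (g z) : Euc d → ℝ≥0∞)) z =
      ENNReal.ofReal ((2 * Real.pi) ^ (-(d : ℝ) / 2)) * ∫⁻ z : Euc d,
        χ (‖z‖ ^ α * angularPart g (‖z‖⁻¹ • z)) * ENNReal.ofReal (Real.exp (-‖z‖ ^ 2 / 2)) := by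
    rw [← lintegral_const_mul' _ _ ENNReal.ofReal_ne_top]
    refine lintegral_congr fun z => ?_
    simp only [Pi.mul_apply]
    rw [ENNReal.ofReal_mul hc, mul_assoc]
    congr 1
    rw [mul_comm]
    congr 2
    rcases eq_or_ne z 0 with rfl | hz
    · simp [hhom.map_zero hα, hα.ne']
    · exact hgA z hz
  have e2 := lintegral_polar_ball hF hd
  simp only at e2
  have hk : Measurable fun p : Euc d × ℝ => χ p.2 *
      ENNReal.ofReal (densityKernel d α p.2 (angularPart g p.1)) :=
    (hχ.comp measurable_snd).mul (measurable_densityKernel.comp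
      (measurable_snd.prodMk (hA.comp measurable_fst))).ennreal_ofReal
  have e3 : ∀ x, χ x * ENNReal.ofReal (chaosDensity α g x) =
      ENNReal.ofReal ((2 * Real.pi) ^ (-(d : ℝ) / 2)) * (d * ∫⁻ z in Metric.ball (0 : Euc d) 1,
        χ x * ENNReal.ofReal (densityKernel d α x (angularPart g z))) := by
    intro x
    have hm : Measurable fun z => densityKernel d α x (angularPart g z) :=
      measurable_densityKernel.comp (measurable_const.prodMk hA)
    rw [lintegral_const_mul _ hm.ennreal_ofReal, ← ofReal_integral_eq_lintegral_ofReal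
      (integrableOn_densityKernel hα hg x) (Eventually.of_forall fun z =>
        densityKernel_nonneg hα _ _), chaosDensity, ENNReal.ofReal_mul hc,
      ENNReal.ofReal_mul (by positivity), ENNReal.ofReal_natCast]
    ring
  have hk2 : Measurable fun x => ∫⁻ z in Metric.ball (0 : Euc d) 1,
      χ x * ENNReal.ofReal (densityKernel d α x (angularPart g z)) :=
    Measurable.lintegral_prod_left' (f := fun p : Euc d × ℝ => χ p.2 *
      ENNReal.ofReal (densityKernel d α p.2 (angularPart g p.1))) hk
  simp only [e3]
  rw [e1, e2, lintegral_const_mul' _ _ ENNReal.ofReal_ne_top,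
    lintegral_const_mul' _ _ (ENNReal.natCast_ne_top d)]
  congr 2
  rw [lintegral_lintegral_swap (f := fun x z => χ x *
    ENNReal.ofReal (densityKernel d α x (angularPart g z))) (hk.comp measurable_swap).aemeasurable]
  refine lintegral_congr fun z => ?_
  rw [lintegral_rpow_mul_eq_densityKernel hα hd h0, hangle]

theorem isContinuousDensityOffZero_chaosDensity (hα : 0 < α) (hd : 0 < d)
    (hhom : IsHomogeneousOfOrder α g) (hg : Measurable g) :
    IsContinuousDensityOffZero (chaosLaw g) (chaosDensity α g) := by
  refine ⟨continuousOn_chaosDensity hα hg, fun x _ => chaosDensity_nonneg hα x, ?_⟩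
  ext A hA
  have hA' : MeasurableSet (A ∩ {0}ᶜ) := hA.inter (measurableSet_singleton 0).compl
  rw [Measure.restrict_apply hA, chaosLaw, Measure.map_apply hg hA', withDensity_apply _ hA,
    Measure.restrict_restrict hA]
  have h := lintegral_comp_stdGaussian hα hd hhom hg
    (χ := (A ∩ {0}ᶜ).indicator 1) (measurable_one.indicator hA') (by simp)
  have h1 : ∫⁻ z, (A ∩ {0}ᶜ).indicator (1 : ℝ → ℝ≥0∞) (g z) ∂(stdGaussian (Euc d)) =
      stdGaussian (Euc d) (g ⁻¹' (A ∩ {0}ᶜ)) := by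
    rw [← lintegral_indicator_one (hg hA')]
    rfl
  rw [← h1, h, ← lintegral_indicator hA']
  refine lintegral_congr fun x => ?_
  by_cases hx : x ∈ A ∩ {0}ᶜ <;> simp [Set.indicator, hx]

theorem chaosTail_eq_integral (hα : 0 < α) (hd : 0 < d) (hhom : IsHomogeneousOfOrder α g)
    (hg : Measurable g) {x : ℝ} (hx : 0 < x) :
    chaosTail g x = ∫ t in Set.Ioi x, chaosDensity α g t ∧
      IntegrableOn (chaosDensity α g) (Set.Ioi x) := by
  have h := lintegral_comp_stdGaussian hα hd hhom hg
    (χ := (Set.Ioi x).indicator 1) (measurable_one.indicator measurableSet_Ioi) (by simp [hx.le])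
  have h1 : ∫⁻ z, (Set.Ioi x).indicator (1 : ℝ → ℝ≥0∞) (g z) ∂(stdGaussian (Euc d)) =
      stdGaussian (Euc d) {z | x < g z} := by
    rw [← lintegral_indicator_one (measurableSet_lt measurable_const hg)]
    rfl
  have h2 : ∫⁻ t, (Set.Ioi x).indicator (1 : ℝ → ℝ≥0∞) t * ENNReal.ofReal (chaosDensity α g t) =
      ∫⁻ t in Set.Ioi x, ENNReal.ofReal (chaosDensity α g t) := by
    rw [← lintegral_indicator measurableSet_Ioi]
    refine lintegral_congr fun t => ?_
    by_cases ht : t ∈ Set.Ioi x <;> simp [Set.indicator, ht]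
  rw [h1, h2] at h
  have hcont : ContinuousOn (chaosDensity α g) (Set.Ioi x) :=
    (continuousOn_chaosDensity hα hg).mono fun t ht => (hx.trans ht).ne'
  have hmeas := hcont.aestronglyMeasurable (μ := volume) measurableSet_Ioi
  constructor
  · rw [integral_eq_lintegral_of_nonneg_ae (Eventually.of_forall fun t => chaosDensity_nonneg hα t)
      hmeas, ← h]
    rfl
  · refine ⟨hmeas, ?_⟩
    rw [hasFiniteIntegral_iff_ofReal (Eventually.of_forall fun t => chaosDensity_nonneg hα t), ← h]
    exact measure_lt_top _ _

end Density

/-! ### Circular cones and gnomonic coordinates -/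

section Cone

variable {d : ℕ} {v : Euc d}

/-- The open circular cone around `v` of opening `arctan δ`. -/
def sector (v : Euc d) (δ : ℝ) : Set (Euc d) :=
  {z | 0 < inner ℝ v z ∧ ‖z‖ ^ 2 < (1 + δ ^ 2) * inner ℝ v z ^ 2}

theorem isOpen_sector (v : Euc d) (δ : ℝ) : IsOpen (sector v δ) := by
  have h1 : IsOpen {z : Euc d | (0 : ℝ) < inner ℝ v z} := isOpen_lt continuous_const (by fun_prop)
  have h2 : IsOpen {z : Euc d | ‖z‖ ^ 2 < (1 + δ ^ 2) * inner ℝ v z ^ 2} :=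
    isOpen_lt (by fun_prop) (by fun_prop)
  exact h1.inter h2

theorem measurableSet_sector (v : Euc d) (δ : ℝ) : MeasurableSet (sector v δ) :=
  (isOpen_sector v δ).measurableSet

variable (u : OrthonormalBasis (Fin (d - 1)) ℝ (Submodule.span ℝ {v})ᗮ)

/-- The coordinates `(s, w) ↦ s v + ∑ l, w l u l` as a linear isometry. -/
noncomputable def frameIsometry (hv : ‖v‖ = 1) : WithLp 2 (ℝ × Euc (d - 1)) →ₗᵢ[ℝ] Euc d where
  toFun p := p.fst • v + frameIncl u p.snd
  map_add' p q := by
    simp only [WithLp.add_fst, WithLp.add_snd, add_smul, _root_.map_add]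
    abel
  map_smul' c p := by
    simp only [WithLp.smul_fst, WithLp.smul_snd, smul_eq_mul, mul_smul, _root_.map_smul, smul_add,
      RingHom.id_apply]
  norm_map' p := by
    have h : ‖p.fst • v + frameIncl u p.snd‖ ^ 2 = ‖p‖ ^ 2 := by
      rw [WithLp.prod_norm_sq_eq_of_L2, norm_add_sq_real, inner_smul_left, inner_frameIncl,
        (frameIncl u).norm_map, norm_smul, hv]
      simp
    exact (pow_left_inj₀ (norm_nonneg _) (norm_nonneg _) two_ne_zero).1 h

theorem measurePreserving_frame (hd : 0 < d) (hv : ‖v‖ = 1) :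
    MeasurePreserving (fun p : ℝ × Euc (d - 1) => p.1 • v + frameIncl u p.2) := by
  have hfin : Module.finrank ℝ (WithLp 2 (ℝ × Euc (d - 1))) = Module.finrank ℝ (Euc d) := by
    rw [(WithLp.linearEquiv 2 ℝ (ℝ × Euc (d - 1))).finrank_eq, Module.finrank_prod,
      finrank_euclideanSpace_fin, finrank_euclideanSpace_fin, Module.finrank_self]
    omega
  have h1 := ((frameIsometry u hv).toLinearIsometryEquiv hfin).measurePreserving
  exact h1.comp (WithLp.volume_preserving_toLp ℝ (Euc (d - 1)))

theorem lintegral_comp_smul_of_pos {n : ℕ} {f : Euc n → ℝ≥0∞} (hf : Measurable f) {s : ℝ}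
    (hs : 0 < s) : ∫⁻ w, f w = ENNReal.ofReal (s ^ n) * ∫⁻ w, f (s • w) := by
  have h := Measure.map_addHaar_smul (volume : Measure (Euc n)) hs.ne'
  have h1 : ∫⁻ w, f (s • w) = ∫⁻ w, f w ∂(Measure.map (s • ·) volume) := by
    rw [lintegral_map hf (by fun_prop)]
  rw [h1, h, lintegral_smul_measure, finrank_euclideanSpace_fin, smul_eq_mul, ← mul_assoc,
    ← ENNReal.ofReal_mul (by positivity), abs_of_pos (by positivity),
    mul_inv_cancel₀ (by positivity), ENNReal.ofReal_one, one_mul]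

/-- The point has component `s` along `v` and squared norm `s ^ 2 * (1 + ‖w‖ ^ 2)`. The cone
condition therefore constrains `w` alone, and the ball condition bounds `s`. -/
theorem smul_add_frameIncl_mem_iff (hv : ‖v‖ = 1) {δ : ℝ} (hδ : 0 < δ) {s : ℝ} (hs : 0 < s)
    (w : Euc (d - 1)) : s • (v + frameIncl u w) ∈ Metric.ball (0 : Euc d) 1 ∩ sector v δ ↔
      w ∈ Metric.ball (0 : Euc (d - 1)) δ ∧ s < (1 + ‖w‖ ^ 2) ^ (-(1 / 2) : ℝ) := by
  have hin : inner ℝ v (s • (v + frameIncl u w)) = s := by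
    rw [inner_smul_right, inner_add_right, inner_frameIncl, real_inner_self_eq_norm_sq, hv]
    ring
  have hn : ‖s • (v + frameIncl u w)‖ ^ 2 = s ^ 2 * (1 + ‖w‖ ^ 2) := by
    rw [norm_smul, mul_pow, norm_add_frameIncl_sq u hv, Real.norm_eq_abs, sq_abs]
  rw [Set.mem_inter_iff, sector, Set.mem_ofPred_eq, hin, hn, mem_ball_zero_iff, mem_ball_zero_iff,
    and_comm]
  have h1 : ‖s • (v + frameIncl u w)‖ < 1 ↔ s < (1 + ‖w‖ ^ 2) ^ (-(1 / 2) : ℝ) := by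
    rw [← sq_lt_one_iff₀ (norm_nonneg _), hn, Real.rpow_neg (by positivity), ← Real.sqrt_eq_rpow,
      ← sq_lt_sq₀ hs.le (by positivity), inv_pow, Real.sq_sqrt (by positivity), lt_inv_comm₀
        (by positivity) (by positivity), ← one_div, lt_div_iff₀ (by positivity), mul_comm]
  have h2 : 0 < s ∧ s ^ 2 * (1 + ‖w‖ ^ 2) < (1 + δ ^ 2) * s ^ 2 ↔ ‖w‖ < δ := by
    rw [and_iff_right hs, mul_comm (1 + δ ^ 2), mul_lt_mul_iff_right₀ (by positivity),
      add_lt_add_iff_left, sq_lt_sq₀ (norm_nonneg _) hδ.le]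
  rw [h1, h2]

/-- Integration over a sector in gnomonic coordinates. -/
theorem lintegral_sector (hd : 0 < d) (hv : ‖v‖ = 1) {δ : ℝ} (hδ : 0 < δ) {F : Euc d → ℝ≥0∞}
    (hF : Measurable F) (hF0 : ∀ s : ℝ, 0 < s → ∀ z, F (s • z) = F z) :
    d * ∫⁻ z in Metric.ball (0 : Euc d) 1 ∩ sector v δ, F z =
      ∫⁻ w in Metric.ball (0 : Euc (d - 1)) δ,
        F (v + frameIncl u w) * ENNReal.ofReal ((1 + ‖w‖ ^ 2) ^ (-(d : ℝ) / 2)) := by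
  set A := Metric.ball (0 : Euc d) 1 ∩ sector v δ with hA
  have hAm : MeasurableSet A := Metric.isOpen_ball.measurableSet.inter (measurableSet_sector v δ)
  have hmp := measurePreserving_frame u hd hv
  have hι : Measurable fun w => frameIncl u w := (frameIncl u).continuous.measurable
  have hfm : Measurable (A.indicator F) := hF.indicator hAm
  set T : Euc (d - 1) → ℝ := fun w => (1 + ‖w‖ ^ 2) ^ (-(1 / 2) : ℝ) with hT
  have hTm : Measurable T := by simp only [hT]; fun_prop
  set Φ : ℝ → Euc (d - 1) → ℝ≥0∞ := fun s w =>
    (Set.Ioi (0 : ℝ)).indicator (fun s => ENNReal.ofReal (s ^ (d - 1)) *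
      A.indicator F (s • (v + frameIncl u w))) s with hΦ
  have hΦm : Measurable (Function.uncurry Φ) := by
    have : Function.uncurry Φ = (Set.Ioi (0 : ℝ) ×ˢ (Set.univ : Set (Euc (d - 1)))).indicator
        fun p => ENNReal.ofReal (p.1 ^ (d - 1)) * A.indicator F (p.1 • (v + frameIncl u p.2)) := by
      funext p
      by_cases hp : 0 < p.1 <;> simp [Function.uncurry, hΦ, Set.indicator, hp]
    rw [this]
    refine Measurable.indicator ?_ (measurableSet_Ioi.prod MeasurableSet.univ)
    have h1 : Measurable fun p : ℝ × Euc (d - 1) => ENNReal.ofReal (p.1 ^ (d - 1)) := by fun_prop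
    have h2 : Measurable fun p : ℝ × Euc (d - 1) => p.1 • (v + frameIncl u p.2) :=
      measurable_fst.smul (measurable_const.add (hι.comp measurable_snd))
    exact h1.mul (hfm.comp h2)
  have hfm2 : Measurable fun p : ℝ × Euc (d - 1) => A.indicator F (p.1 • v + frameIncl u p.2) :=
    hfm.comp hmp.measurable
  -- Slice by the component `s` of `z` along `v` and rescale the transverse variable by `s`, with
  -- Jacobian `s ^ (d - 1)`. Slices with `s ≤ 0` miss the cone.
  have e1 : ∫⁻ z in A, F z = ∫⁻ s : ℝ, ∫⁻ w : Euc (d - 1), Φ s w := by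
    rw [← lintegral_indicator hAm, ← hmp.lintegral_comp hfm,
      Measure.volume_eq_prod, lintegral_prod _ hfm2.aemeasurable]
    refine lintegral_congr fun s => ?_
    rcases lt_or_ge 0 s with hs | hs
    · have hm : Measurable fun w : Euc (d - 1) => A.indicator F (s • v + frameIncl u w) :=
        hfm.comp (measurable_const.add hι)
      simp only [hΦ, Set.indicator_of_mem (Set.mem_Ioi.2 hs)]
      rw [lintegral_comp_smul_of_pos hm hs, lintegral_const_mul' _ _ ENNReal.ofReal_ne_top]
      simp only [_root_.map_smul, smul_add]
    · have hzero : ∀ w, A.indicator F (s • v + frameIncl u w) = 0 := by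
        intro w
        refine Set.indicator_of_notMem (fun h => ?_) _
        have h1 := h.2.1
        rw [inner_add_right, inner_frameIncl, inner_smul_right, real_inner_self_eq_norm_sq, hv]
          at h1
        linarith
      simp only [hzero, hΦ, Set.indicator_of_notMem (show s ∉ Set.Ioi (0 : ℝ) from hs.not_gt)]
  rw [e1, lintegral_lintegral_swap hΦm.aemeasurable, ← lintegral_const_mul' _ _
    (ENNReal.natCast_ne_top d), ← lintegral_indicator Metric.isOpen_ball.measurableSet]
  refine lintegral_congr fun w => ?_
  -- `F` is constant along each ray, so the radial integral up to `T w` only contributes `T w ^ d /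
  -- d`.
  have hin : ∀ s, Φ s w = (Set.Ioo (0 : ℝ) (T w)).indicator
      (fun s => ENNReal.ofReal (s ^ (d - 1)) *
        (Metric.ball (0 : Euc (d - 1)) δ).indicator (fun w => F (v + frameIncl u w)) w) s := by
    intro s
    rcases lt_or_ge 0 s with hs | hs
    · simp only [hΦ, Set.indicator_of_mem (Set.mem_Ioi.2 hs)]
      have hiff := smul_add_frameIncl_mem_iff u hv hδ hs w
      by_cases h1 : w ∈ Metric.ball (0 : Euc (d - 1)) δ
      · by_cases h2 : s < T w
        · rw [Set.indicator_of_mem (hiff.2 ⟨h1, h2⟩), Set.indicator_of_mem h1,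
            Set.indicator_of_mem (Set.mem_Ioo.2 ⟨hs, h2⟩), hF0 s hs]
        · rw [Set.indicator_of_notMem (fun h => h2 (hiff.1 h).2),
            Set.indicator_of_notMem (fun h => h2 h.2), mul_zero]
      · rw [Set.indicator_of_notMem (fun h => h1 (hiff.1 h).1), Set.indicator_of_notMem h1]
        simp
    · simp only [hΦ, Set.indicator_of_notMem (show s ∉ Set.Ioi (0 : ℝ) from hs.not_gt),
        Set.indicator_of_notMem (show s ∉ Set.Ioo (0 : ℝ) (T w) from fun h => hs.not_gt h.1)]
  simp only [hin]
  have hT0 : 0 ≤ T w := by simp only [hT]; positivity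
  rw [lintegral_indicator measurableSet_Ioo, lintegral_mul_const _ (by fun_prop),
    lintegral_Ioo_pow hd hT0, ← mul_assoc, ← ENNReal.ofReal_natCast, ← ENNReal.ofReal_mul
      (by positivity), mul_div_cancel₀ _ (by positivity : (d : ℝ) ≠ 0)]
  have hTd : T w ^ d = (1 + ‖w‖ ^ 2) ^ (-(d : ℝ) / 2) := by
    simp only [hT]
    rw [← Real.rpow_natCast, ← Real.rpow_mul (by positivity)]
    congr 1
    ring
  rw [hTd]
  by_cases h1 : w ∈ Metric.ball (0 : Euc (d - 1)) δ
  · rw [Set.indicator_of_mem h1, Set.indicator_of_mem h1, mul_comm]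
  · rw [Set.indicator_of_notMem h1, Set.indicator_of_notMem h1, mul_zero]

theorem norm_sub_lt_of_mem_sector (hv : ‖v‖ = 1) {δ : ℝ} (hδ : 0 < δ) {z : Euc d}
    (hz : ‖z‖ = 1) (h : z ∈ sector v δ) : ‖z - v‖ < δ := by
  obtain ⟨h1, h2⟩ := h
  set t := inner ℝ v z
  have h3 : ‖z - v‖ ^ 2 = 2 - 2 * t := by
    rw [norm_sub_sq_real, hz, hv, real_inner_comm]
    ring
  rw [hz] at h2
  have h4 : t ≤ 1 := by
    have := real_inner_le_norm v z
    rw [hz, hv, mul_one] at this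
    exact this
  have h5 : 2 - 2 * t < δ ^ 2 := by nlinarith [sq_nonneg (1 - t), mul_pos hδ hδ]
  rw [← sq_lt_sq₀ (norm_nonneg _) hδ.le, h3]
  exact h5

theorem smul_mem_sector_iff {δ s : ℝ} (hs : 0 < s) {z : Euc d} :
    s • z ∈ sector v δ ↔ z ∈ sector v δ := by
  simp only [sector, Set.mem_ofPred_eq, inner_smul_right, norm_smul, Real.norm_of_nonneg hs.le,
    mul_pow]
  rw [mul_pos_iff_of_pos_left hs, mul_left_comm, mul_lt_mul_iff_right₀ (by positivity)]

/-- On the unit sphere a sector stays within distance `δ` of its axis, so a common direction would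
contradict the triangle inequality. -/
theorem disjoint_sector {v' : Euc d} (hv : ‖v‖ = 1) (hv' : ‖v'‖ = 1) {δ : ℝ} (hδ : 0 < δ)
    (h : 2 * δ ≤ ‖v - v'‖) : Disjoint (sector v δ) (sector v' δ) := by
  rw [Set.disjoint_left]
  intro z hz hz'
  have hz0 : z ≠ 0 := by
    rintro rfl
    have := hz.1
    simp at this
  have hn : 0 < ‖z‖⁻¹ := inv_pos.2 (norm_pos_iff.2 hz0)
  have h1 : ‖‖z‖⁻¹ • z‖ = 1 := by
    rw [norm_smul, norm_inv, norm_norm, inv_mul_cancel₀ (norm_ne_zero_iff.2 hz0)]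
  have h2 := norm_sub_lt_of_mem_sector hv hδ h1 ((smul_mem_sector_iff hn).2 hz)
  have h3 := norm_sub_lt_of_mem_sector hv' hδ h1 ((smul_mem_sector_iff hn).2 hz')
  have h4 : ‖v - v'‖ ≤ ‖‖z‖⁻¹ • z - v‖ + ‖‖z‖⁻¹ • z - v'‖ := by
    have : v - v' = (‖z‖⁻¹ • z - v') - (‖z‖⁻¹ • z - v) := by abel
    rw [this, add_comm]
    exact norm_sub_le _ _
  linarith

theorem self_mem_sector (hv : ‖v‖ = 1) {δ : ℝ} (hδ : 0 < δ) : v ∈ sector v δ := by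
  simp only [sector, Set.mem_ofPred_eq, real_inner_self_eq_norm_sq, hv]
  constructor
  · norm_num
  · have : 0 < δ ^ 2 := by positivity
    linarith

end Cone

/-! ### Definiteness of the quadratic part and its Gaussian integral -/

section QuadraticPart

/-- A continuous 2-homogeneous function which is positive off the origin is coercive. -/
theorem IsContHomogeneous.exists_coercive {E : Type*} [NormedAddCommGroup E]
    [InnerProductSpace ℝ E] [FiniteDimensional ℝ E] {q : E → ℝ} (hq : IsContHomogeneous 2 q)
    (hpos : ∀ ζ, ζ ≠ 0 → 0 < q ζ) : ∃ c, 0 < c ∧ ∀ ζ, c * ‖ζ‖ ^ 2 ≤ q ζ := by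
  have h0 : q 0 = 0 := by simpa using hq.2 0 0
  rcases (Metric.sphere (0 : E) 1).eq_empty_or_nonempty with he | hne
  · refine ⟨1, one_pos, fun ζ => ?_⟩
    rcases eq_or_ne ζ 0 with rfl | hζ
    · simp [h0]
    · exfalso
      have : ‖ζ‖⁻¹ • ζ ∈ Metric.sphere (0 : E) 1 := by
        rw [mem_sphere_zero_iff_norm, norm_smul, norm_inv, norm_norm,
          inv_mul_cancel₀ (norm_ne_zero_iff.2 hζ)]
      rw [he] at this
      exact this
  · obtain ⟨ω, hω, hmin⟩ := (isCompact_sphere (0 : E) 1).exists_isMinOn hne hq.1.continuousOn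
    have hω0 : ω ≠ 0 := by
      rintro rfl
      simp at hω
    refine ⟨q ω, hpos ω hω0, fun ζ => ?_⟩
    rcases eq_or_ne ζ 0 with rfl | hζ
    · simp [h0]
    · have hm : ‖ζ‖⁻¹ • ζ ∈ Metric.sphere (0 : E) 1 := by
        rw [mem_sphere_zero_iff_norm, norm_smul, norm_inv, norm_norm,
          inv_mul_cancel₀ (norm_ne_zero_iff.2 hζ)]
      have h1 : q ω ≤ q (‖ζ‖⁻¹ • ζ) := hmin hm
      have h2 := hq.2 ‖ζ‖ (‖ζ‖⁻¹ • ζ)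
      rw [smul_smul, mul_inv_cancel₀ (norm_ne_zero_iff.2 hζ), one_smul] at h2
      rw [h2, mul_comm]
      gcongr

variable {d : ℕ} {α : ℝ} {N : ℕ} {g : Euc d → ℝ} {ghat : ℝ} {v : Euc d}
  (u : OrthonormalBasis (Fin (d - 1)) ℝ (Submodule.span ℝ {v})ᗮ)

/-- A negative value at `ζ` would make the phase negative at `t • ζ` for small `t ≠ 0`, against the
maximality of `g` at `v`. -/
theorem IsSphereMax.taylorTerm_two_nonneg (hα : 0 < α) (hN : 2 ≤ N)
    (h : IsSphereMax α N g ghat v) (ζ : Euc (d - 1)) :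
    0 ≤ taylorTerm (laplacePhase α g ghat u) 0 2 ζ := by
  have hN' : (2 : WithTop ℕ∞) ≤ (N : WithTop ℕ∞) := by exact_mod_cast hN
  have hT : taylorTerm (laplacePhase α g ghat u) 0 2 ζ =
      2⁻¹ * iteratedFDeriv ℝ 2 (laplacePhase α g ghat u) 0 fun _ => ζ := by
    simp [taylorTerm, Nat.factorial]
  have l := ((h.contDiffAt_laplacePhase u).of_le hN').line_isLittleO ζ
  rw [h.laplacePhase_zero, h.fderiv_laplacePhase u hα, ← hT] at l
  simp only [zero_add, zero_apply, zero_mul] at l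
  have h0 : Tendsto (fun t : ℝ => t • ζ) (𝓝 0) (𝓝 0) := by
    have : Continuous fun t : ℝ => t • ζ := by fun_prop
    simpa using this.tendsto 0
  by_contra hneg
  push Not at hneg
  have h1 := l.def (show (0 : ℝ) < -taylorTerm (laplacePhase α g ghat u) 0 2 ζ / 2 by linarith)
  have h2 := h0.eventually (h.eventually_laplacePhase_nonneg u hα)
  have h3 : ∀ᶠ t : ℝ in 𝓝[≠] 0, t ≠ 0 := self_mem_nhdsWithin
  obtain ⟨t, ⟨ht1, ht2⟩, ht3⟩ := (((h1.and h2).filter_mono nhdsWithin_le_nhds).and h3).exists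
  have ht4 : 0 < t ^ 2 := by positivity
  rw [Real.norm_of_nonneg ht4.le, Real.norm_eq_abs] at ht1
  have := (abs_le.1 ht1).2
  nlinarith

theorem isHermitian_tangentHessian (hN : 2 ≤ N) (h : IsSphereMax α N g ghat v) :
    (tangentHessian g v u).IsHermitian := by
  have hN' : (2 : WithTop ℕ∞) ≤ (N : WithTop ℕ∞) := by exact_mod_cast hN
  have hG : ContDiffAt ℝ 2 (fun t : Euc (d - 1) => g (v + ∑ l, t l • (u l : Euc d))) 0 := by
    have hGeq : (fun t : Euc (d - 1) => g (v + ∑ l, t l • (u l : Euc d))) =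
        fun w => ghat * (chartProfile g ghat u w * (1 + ‖w‖ ^ 2) ^ (α / 2)) :=
      funext fun w => h.eq_chartProfile_mul u w
    rw [hGeq]
    exact contDiffAt_const.mul (((h.contDiffAt_chartProfile u 0).of_le hN').mul
      (contDiff_one_add_norm_sq_rpow _).contDiffAt)
  have hsymm := hG.isSymmSndFDerivAt (by simp)
  ext i j
  simp only [Matrix.conjTranspose_apply, tangentHessian, Matrix.of_apply, iteratedFDeriv_two_apply,
    star_trivial, Matrix.cons_val_zero, Matrix.cons_val_one]
  exact hsymm _ _

theorem IsSphereMax.posSemidef (hα : 0 < α) (hN : 2 ≤ N) (h : IsSphereMax α N g ghat v) :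
    (1 - (α * ghat)⁻¹ • tangentHessian g v u).PosSemidef := by
  refine .of_dotProduct_mulVec_nonneg ?_ fun x => ?_
  · refine Matrix.isHermitian_one.sub ?_
    rw [Matrix.IsHermitian, Matrix.conjTranspose_smul, (isHermitian_tangentHessian u hN h).eq,
      star_trivial]
  · have h1 := h.taylorTerm_two_nonneg u hα hN (WithLp.toLp 2 x)
    rw [h.taylorTerm_two_eq_quadratic u hα hN] at h1
    rw [star_trivial]
    simpa using h1

theorem abs_det_one_sub_eq_abs_tangentDet :
    |(1 - (α * ghat)⁻¹ • tangentHessian g v u).det| = |tangentDet α g ghat v u| := by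
  rw [tangentDet, ← neg_sub, Matrix.det_neg, abs_mul, abs_pow, abs_neg, abs_one, one_pow, one_mul]

theorem IsSphereMax.integral_exp_neg_taylorTerm_two (hα : 0 < α) (hN : 2 ≤ N)
    (h : IsSphereMax α N g ghat v) (hdet : tangentDet α g ghat v u ≠ 0) :
    ∫ ζ, Real.exp (-taylorTerm (laplacePhase α g ghat u) 0 2 ζ) =
      (2 * Real.pi) ^ (((d - 1 : ℕ) : ℝ) / 2) * |tangentDet α g ghat v u| ^ (-(1 / 2) : ℝ) := by
  have hdet' : (1 - (α * ghat)⁻¹ • tangentHessian g v u).det ≠ 0 := by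
    rw [← abs_ne_zero, abs_det_one_sub_eq_abs_tangentDet, abs_ne_zero]
    exact hdet
  simp only [h.taylorTerm_two_eq_quadratic u hα hN]
  rw [integral_exp_neg_quadratic (h.posSemidef u hα hN) hdet', abs_det_one_sub_eq_abs_tangentDet]

/-- A positive semidefinite matrix with nonzero determinant is positive definite. This is where
nondegeneracy gives coercivity. -/
theorem IsSphereMax.exists_coercive (hα : 0 < α) (hN : 2 ≤ N)
    (h : IsSphereMax α N g ghat v) (hdet : tangentDet α g ghat v u ≠ 0) :
    ∃ c, 0 < c ∧ ∀ ζ, c * ‖ζ‖ ^ 2 ≤ taylorTerm (laplacePhase α g ghat u) 0 2 ζ := by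
  refine (isContHomogeneous_taylorTerm _ _ _).exists_coercive fun ζ hζ => ?_
  have hdet' : (1 - (α * ghat)⁻¹ • tangentHessian g v u).det ≠ 0 := by
    rw [← abs_ne_zero, abs_det_one_sub_eq_abs_tangentDet, abs_ne_zero]
    exact hdet
  have h1 := ((h.posSemidef u hα hN).posDef_iff_det_ne_zero.2 hdet').dotProduct_mulVec_pos
    (x := ζ.ofLp) (by simpa using hζ)
  rw [star_trivial] at h1
  rw [h.taylorTerm_two_eq_quadratic u hα hN]
  positivity

end QuadraticPart

/-! ### Dependence of phase and amplitude on the jet of the angular part -/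

section Jets

open Asymptotics

variable {d : ℕ} {α : ℝ} {m : ℕ} {g g' : Euc d → ℝ} {ghat : ℝ} {v : Euc d}
  (u : OrthonormalBasis (Fin (d - 1)) ℝ (Submodule.span ℝ {v})ᗮ)

/-- Equal jets at `v` give equal Taylor polynomials, and the chart is `v` plus a linear isometry, so
the order of the remainder is kept. -/
theorem IsSphereMax.chartProfile_sub_isLittleO (h : IsSphereMax α (m + 1) g ghat v)
    (h' : IsSphereMax α (m + 1) g' ghat v)
    (hJ : angularJet (m + 1) g' v = angularJet (m + 1) g v) :
    (fun w => chartProfile g' ghat u w - chartProfile g ghat u w) =o[𝓝 0]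
      fun w => ‖w‖ ^ (m + 1) := by
  have hv : v ≠ 0 := norm_ne_zero_iff.1 (by rw [h.norm_eq]; exact one_ne_zero)
  have h1 := ContDiffAt.sub_isLittleO_of_iteratedFDeriv_eq
    (contDiffAt_angularPart h'.contDiff hv) (contDiffAt_angularPart h.contDiff hv)
    fun k hk => congrFun (congrArg Prod.snd hJ) ⟨k, hk⟩
  have h2 : Tendsto (fun w => frameIncl u w) (𝓝 0) (𝓝 0) := by
    simpa using (frameIncl u).continuous.tendsto 0
  refine ((h1.comp_tendsto h2).const_mul_left ghat⁻¹).congr (fun w => ?_) fun w => ?_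
  · simp only [Function.comp_apply, chartProfile]
    ring
  · simp only [Function.comp_apply, (frameIncl u).norm_map]

/-- The power function is strictly differentiable at `1`, hence Lipschitz near the common value of
both profiles at the origin. -/
theorem IsSphereMax.chartProfile_rpow_sub_isLittleO (h : IsSphereMax α (m + 1) g ghat v)
    (h' : IsSphereMax α (m + 1) g' ghat v)
    (hJ : angularJet (m + 1) g' v = angularJet (m + 1) g v) (p : ℝ) :
    (fun w => chartProfile g' ghat u w ^ p - chartProfile g ghat u w ^ p) =o[𝓝 0]
      fun w => ‖w‖ ^ (m + 1) := by
  have h1 := (Real.hasStrictDerivAt_rpow_const_of_ne (one_ne_zero (α := ℝ))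
    p).hasStrictFDerivAt.isBigO_sub
  have t : Tendsto (chartProfile g ghat u) (𝓝 0) (𝓝 1) := by
    have := (h.contDiffAt_chartProfile u 0).continuousAt.tendsto
    rwa [h.chartProfile_zero] at this
  have t' : Tendsto (chartProfile g' ghat u) (𝓝 0) (𝓝 1) := by
    have := (h'.contDiffAt_chartProfile u 0).continuousAt.tendsto
    rwa [h'.chartProfile_zero] at this
  exact (h1.comp_tendsto (t'.prodMk_nhds t)).trans_isLittleO
    (h.chartProfile_sub_isLittleO u h' hJ)

theorem IsSphereMax.laplacePhase_sub_isLittleO (h : IsSphereMax α (m + 1) g ghat v)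
    (h' : IsSphereMax α (m + 1) g' ghat v)
    (hJ : angularJet (m + 1) g' v = angularJet (m + 1) g v) :
    (fun w => laplacePhase α g' ghat u w - laplacePhase α g ghat u w) =o[𝓝 0]
      fun w => ‖w‖ ^ (m + 1) := by
  refine ((h.chartProfile_rpow_sub_isLittleO u h' hJ (-2 / α)).const_mul_left 2⁻¹).congr_left
    fun w => ?_
  simp only [laplacePhase]
  ring

theorem IsSphereMax.laplaceAmplitude_sub_isLittleO (h : IsSphereMax α (m + 1) g ghat v)
    (h' : IsSphereMax α (m + 1) g' ghat v)
    (hJ : angularJet (m + 1) g' v = angularJet (m + 1) g v) :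
    (fun w => laplaceAmplitude α g' ghat u w - laplaceAmplitude α g ghat u w) =o[𝓝 0]
      fun w => ‖w‖ ^ (m + 1) := by
  have h1 : (fun w : Euc (d - 1) => (1 + ‖w‖ ^ 2) ^ (-(d : ℝ) / 2)) =O[𝓝 0]
      fun _ => (1 : ℝ) :=
    ((contDiff_one_add_norm_sq_rpow (n := 0) _).continuous.tendsto 0).isBigO_one ℝ
  have h2 := (h.chartProfile_rpow_sub_isLittleO u h' hJ (-(d : ℝ) / α)).mul_isBigO h1
  simp only [mul_one] at h2
  refine h2.congr_left fun w => ?_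
  simp only [laplaceAmplitude]
  ring

/-- The sum starts at degree two because the phase and its first derivative vanish at its minimum.
-/
theorem IsSphereMax.laplacePhase_sub_sum_isLittleO (hα : 0 < α)
    (h : IsSphereMax α (m + 1) g ghat v) :
    (fun w => laplacePhase α g ghat u w -
        ∑ l ∈ Finset.Icc 2 (m + 1), taylorTerm (laplacePhase α g ghat u) 0 l w) =o[𝓝 0]
      fun w => ‖w‖ ^ (m + 1) := by
  refine (h.contDiffAt_laplacePhase u).sub_sum_taylorTerm_isLittleO.congr_left fun w => ?_
  have e : Finset.range (m + 2) = insert 0 (insert 1 (Finset.Icc 2 (m + 1))) := by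
    ext i
    simp only [Finset.mem_range, Finset.mem_insert, Finset.mem_Icc]
    omega
  rw [zero_add, e, Finset.sum_insert (by simp), Finset.sum_insert (by simp)]
  have e0 : taylorTerm (laplacePhase α g ghat u) 0 0 w = 0 := by
    simp [taylorTerm, h.laplacePhase_zero]
  have e1 : taylorTerm (laplacePhase α g ghat u) 0 1 w = 0 := by
    simp [taylorTerm, iteratedFDeriv_one_apply, h.fderiv_laplacePhase u hα]
  rw [e0, e1, zero_add, zero_add]

end Jets

/-- The integrand of the radial density at radius `ρ` in terms of the normalized angular part. -/
noncomputable def radialKernel (d : ℕ) (α ρ a : ℝ) : ℝ :=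
  if 0 < a then a ^ (-(d : ℝ) / α) * Real.exp (-(ρ ^ 2 * a ^ (-2 / α) / 2)) else 0

/-! ### Bounds for the radial kernel -/

section RadialKernel

variable {d : ℕ} {α : ℝ}

theorem radialKernel_nonneg (d : ℕ) (α ρ a : ℝ) : 0 ≤ radialKernel d α ρ a := by
  unfold radialKernel
  split_ifs with h
  · positivity
  · exact le_rfl

theorem measurable_radialKernel (d : ℕ) (α ρ : ℝ) : Measurable (radialKernel d α ρ) := by
  unfold radialKernel
  refine Measurable.ite (measurableSet_lt measurable_const measurable_id) ?_ measurable_const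
  fun_prop

/-- A uniform bound with a Gaussian factor governed by an upper bound of the argument. -/
theorem exists_radialKernel_le (d : ℕ) (hα : 0 < α) :
    ∃ K, 0 ≤ K ∧ ∀ ρ a q : ℝ, 1 ≤ ρ → 1 ≤ q → a ≤ q ^ (-α) →
      radialKernel d α ρ a ≤ K * Real.exp (-((ρ ^ 2 - 1) * q ^ 2 / 2)) := by
  obtain ⟨K, hK, h⟩ := exists_pow_le_mul_exp_sq d (η := 1 / 2) (by norm_num)
  refine ⟨K, hK, fun ρ a q hρ hq ha => ?_⟩
  unfold radialKernel
  split_ifs with ha0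
  · set t := a ^ (-1 / α) with ht
    have ht0 : 0 ≤ t := by positivity
    have e1 : a ^ (-(d : ℝ) / α) = t ^ d := by
      rw [ht, ← Real.rpow_natCast, ← Real.rpow_mul ha0.le]
      congr 1; ring
    have e2 : a ^ (-2 / α) = t ^ 2 := by
      rw [ht, ← Real.rpow_natCast, ← Real.rpow_mul ha0.le]
      congr 1; push_cast; ring
    have hqt : q ≤ t := by
      have h1 : (q ^ (-α)) ^ (-1 / α) ≤ t :=
        Real.rpow_le_rpow_of_nonpos ha0 ha (div_nonpos_of_nonpos_of_nonneg (by norm_num) hα.le)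
      rwa [← Real.rpow_mul (by linarith), show -α * (-1 / α) = 1 by field_simp, Real.rpow_one]
        at h1
    rw [e1, e2]
    -- A factor `exp (t ^ 2 / 2)` is spent on absorbing `t ^ d`, whence `ρ ^ 2 - 1`; what remains
    -- decreases in `t ≥ q`.
    calc t ^ d * Real.exp (-(ρ ^ 2 * t ^ 2 / 2))
        ≤ K * Real.exp (1 / 2 * t ^ 2) * Real.exp (-(ρ ^ 2 * t ^ 2 / 2)) := by
          gcongr
          exact h t ht0
      _ = K * Real.exp (-((ρ ^ 2 - 1) * t ^ 2 / 2)) := by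
          rw [mul_assoc, ← Real.exp_add]
          congr 2; ring
      _ ≤ _ := by
          have : 0 ≤ ρ ^ 2 - 1 := by nlinarith
          gcongr
  · positivity

theorem integrableOn_radialKernel (hα : 0 < α) {g : Euc d → ℝ} (hg : Measurable g) {ghat : ℝ}
    (hle : ∀ z, angularPart g z / ghat ≤ 1) {ρ : ℝ} (hρ : 1 ≤ ρ) :
    IntegrableOn (fun z => radialKernel d α ρ (angularPart g z / ghat))
      (Metric.ball (0 : Euc d) 1) := by
  obtain ⟨K, hK, h⟩ := exists_radialKernel_le d hα
  have hm : Measurable fun z => radialKernel d α ρ (angularPart g z / ghat) :=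
    (measurable_radialKernel d α ρ).comp ((measurable_angularPart hg).div_const _)
  refine Measure.integrableOn_of_bounded (M := K * Real.exp (-((ρ ^ 2 - 1) * 1 ^ 2 / 2)))
    measure_ball_lt_top.ne hm.aestronglyMeasurable (Eventually.of_forall fun z => ?_)
  rw [Real.norm_of_nonneg (radialKernel_nonneg _ _ _ _)]
  exact h ρ _ 1 hρ le_rfl (by rw [Real.one_rpow]; exact hle z)

end RadialKernel

/-- The contribution of a sector to the radial density. -/
noncomputable def sectorIntegral {d : ℕ} (α : ℝ) (g : Euc d → ℝ) (ghat : ℝ) (v : Euc d)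
    (δ ρ : ℝ) : ℝ :=
  d * ∫ z in Metric.ball (0 : Euc d) 1 ∩ sector v δ, radialKernel d α ρ (angularPart g z / ghat)

/-! ### Contribution of one point of maximum -/

section Sector

open Asymptotics

variable {d : ℕ} {α : ℝ} {g g' : Euc d → ℝ} {ghat : ℝ} {v : Euc d}
  (u : OrthonormalBasis (Fin (d - 1)) ℝ (Submodule.span ℝ {v})ᗮ)

theorem sectorIntegral_eq_integral_ball (hd : 0 < d) (hv : ‖v‖ = 1) {δ : ℝ} (hδ : 0 < δ)
    (hg : Measurable g) (ρ : ℝ) :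
    sectorIntegral α g ghat v δ ρ = ∫ w in Metric.ball (0 : Euc (d - 1)) δ,
      radialKernel d α ρ (chartProfile g ghat u w) * (1 + ‖w‖ ^ 2) ^ (-(d : ℝ) / 2) := by
  have hm : Measurable fun z => radialKernel d α ρ (angularPart g z / ghat) :=
    (measurable_radialKernel d α ρ).comp ((measurable_angularPart hg).div_const _)
  have hm2 : Measurable fun w => radialKernel d α ρ (chartProfile g ghat u w) *
      (1 + ‖w‖ ^ 2) ^ (-(d : ℝ) / 2) :=
    ((measurable_radialKernel d α ρ).comp (measurable_chartProfile u hg)).mul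
      (contDiff_one_add_norm_sq_rpow (n := 0) _).continuous.measurable
  have h := lintegral_sector u hd hv hδ
    (F := fun z => ENNReal.ofReal (radialKernel d α ρ (angularPart g z / ghat)))
    hm.ennreal_ofReal (fun s hs z => by rw [angularPart_smul hs])
  rw [sectorIntegral, integral_eq_lintegral_of_nonneg_ae
      (Eventually.of_forall fun z => radialKernel_nonneg _ _ _ _) hm.aestronglyMeasurable,
    integral_eq_lintegral_of_nonneg_ae (Eventually.of_forall fun w => mul_nonneg
      (radialKernel_nonneg _ _ _ _) (by positivity)) hm2.aestronglyMeasurable,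
    ← ENNReal.toReal_natCast, ← ENNReal.toReal_mul, h]
  congr 1
  refine lintegral_congr fun w => ?_
  rw [ENNReal.ofReal_mul (radialKernel_nonneg _ _ _ _), chartProfile, ENNReal.toReal_natCast]

/-- For small `δ` the profile is positive on the ball, which removes the case distinction in
`radialKernel`; the factor `exp (ρ ^ 2 / 2)` supplies the `-1` in the phase. -/
theorem IsSphereMax.exp_mul_sectorIntegral {N : ℕ} (hd : 0 < d)
    (h : IsSphereMax α N g ghat v) :
    ∀ᶠ δ in 𝓝[>] (0 : ℝ), ∀ ρ, Real.exp (ρ ^ 2 / 2) * sectorIntegral α g ghat v δ ρ =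
      ∫ w in Metric.ball (0 : Euc (d - 1)) δ, laplaceAmplitude α g ghat u w *
        Real.exp (-(ρ ^ 2 * laplacePhase α g ghat u w)) := by
  obtain ⟨δ₀, hδ₀, hpos⟩ := Metric.eventually_nhds_iff_ball.1 (h.eventually_chartProfile_pos u)
  filter_upwards [Ioo_mem_nhdsGT hδ₀] with δ hδ ρ
  rw [sectorIntegral_eq_integral_ball u hd h.norm_eq hδ.1
    (measurable_of_contDiffOn_compl h.contDiff), ← integral_const_mul]
  refine setIntegral_congr_fun Metric.isOpen_ball.measurableSet fun w hw => ?_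
  have hw' := hpos w (Metric.ball_subset_ball hδ.2.le hw)
  simp only [radialKernel, if_pos hw', laplaceAmplitude, laplacePhase]
  have : -(ρ ^ 2 * ((chartProfile g ghat u w ^ (-2 / α) - 1) / 2)) =
      ρ ^ 2 / 2 + -(ρ ^ 2 * chartProfile g ghat u w ^ (-2 / α) / 2) := by ring
  rw [this, Real.exp_add]
  ring

/-- The expansion of the contribution of a point of maximum, with coefficients depending only on
the derivatives of the angular part at this point. -/
theorem IsSphereMax.exists_sectorIntegral_expansion (hd : 0 < d) (hα : 0 < α) (r : ℕ)
    (h : IsSphereMax α (2 * r + 2) g ghat v) (hdet : tangentDet α g ghat v u ≠ 0) :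
    ∃ b : ℕ → ℝ, b 0 = (2 * Real.pi) ^ (((d - 1 : ℕ) : ℝ) / 2) *
        |tangentDet α g ghat v u| ^ (-(1 / 2) : ℝ) ∧
      ∀ g', IsSphereMax α (2 * r + 2) g' ghat v →
        angularJet (2 * r + 2) g' v = angularJet (2 * r + 2) g v →
        ∀ᶠ δ in 𝓝[>] (0 : ℝ), (fun ρ : ℝ => ρ ^ (d - 1) * (Real.exp (ρ ^ 2 / 2) *
            sectorIntegral α g' ghat v δ ρ) - ∑ i ∈ Finset.range (r + 1), b i * ρ⁻¹ ^ (2 * i))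
          =o[atTop] fun ρ => ρ⁻¹ ^ (2 * r) := by
  obtain ⟨c, hc, hcs⟩ := h.exists_coercive u hα (by omega) hdet
  obtain ⟨b, hb0, hb⟩ := exists_laplace_expansion r
    (s := fun l => taylorTerm (laplacePhase α g ghat u) 0 l)
    (p := fun l => taylorTerm (laplaceAmplitude α g ghat u) 0 l)
    (fun l => isContHomogeneous_taylorTerm _ _ _) (fun l => isContHomogeneous_taylorTerm _ _ _)
    hc hcs
  refine ⟨b, ?_, fun g' h' hJ => ?_⟩
  · rw [hb0, h.integral_exp_neg_taylorTerm_two u hα (by omega) hdet]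
    simp [taylorTerm, h.laplaceAmplitude_zero]
  · have hg' := measurable_of_contDiffOn_compl h'.contDiff
    -- The phase of `g'` is compared with the Taylor terms of `g`, so the coefficients `b` already
    -- fixed serve for `g'` too.
    have hS : (fun w => laplacePhase α g' ghat u w - ∑ l ∈ Finset.Icc 2 (2 * r + 2),
        taylorTerm (laplacePhase α g ghat u) 0 l w) =o[𝓝 0] fun w => ‖w‖ ^ (2 * r + 2) :=
      ((h.laplacePhase_sub_isLittleO u h' hJ).add
        (h.laplacePhase_sub_sum_isLittleO u hα)).congr_left fun w => by ring
    have hψ : (fun w => laplaceAmplitude α g' ghat u w - ∑ l ∈ Finset.range (2 * r + 3),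
        taylorTerm (laplaceAmplitude α g ghat u) 0 l w) =o[𝓝 0] fun w => ‖w‖ ^ (2 * r + 2) :=
      ((h.laplaceAmplitude_sub_isLittleO u h' hJ).add
        (h.contDiffAt_laplaceAmplitude u).sub_sum_taylorTerm_isLittleO).congr_left fun w => by
          rw [zero_add]; ring
    filter_upwards [hb _ _ (measurable_laplacePhase u hg') (measurable_laplaceAmplitude u hg') hS
      hψ, h'.exp_mul_sectorIntegral u hd] with δ h1 h2
    simp only [h2]
    rwa [finrank_euclideanSpace_fin] at h1

/-- This identifies the leading coefficients of two expansions of one function. -/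
theorem tendsto_of_sub_sum_isLittleO {f : ℝ → ℝ} {b : ℕ → ℝ} {r : ℕ}
    (h : (fun ρ : ℝ => f ρ - ∑ i ∈ Finset.range (r + 1), b i * ρ⁻¹ ^ (2 * i)) =o[atTop]
      fun ρ => ρ⁻¹ ^ (2 * r)) : Tendsto f atTop (𝓝 (b 0)) := by
  have h0 : Tendsto (fun ρ : ℝ => ρ⁻¹) atTop (𝓝 0) := tendsto_inv_atTop_zero
  have h1 : (fun ρ : ℝ => ρ⁻¹ ^ (2 * r)) =O[atTop] fun _ => (1 : ℝ) :=
    (h0.pow (2 * r)).isBigO_one ℝ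
  have h2 := (isLittleO_one_iff ℝ).1 (h.trans_isBigO h1)
  have h3 : Tendsto (fun ρ : ℝ => ∑ i ∈ Finset.range (r + 1), b i * ρ⁻¹ ^ (2 * i)) atTop
      (𝓝 (∑ i ∈ Finset.range (r + 1), b i * 0 ^ (2 * i))) :=
    tendsto_finsetSum _ fun i _ => (h0.pow _).const_mul _
  have h4 : ∑ i ∈ Finset.range (r + 1), b i * (0 : ℝ) ^ (2 * i) = b 0 := by
    rw [Finset.sum_range_succ']
    simp
  rw [h4] at h3
  simpa using h2.add h3

/-- The coefficients in the expansion of the contribution of a point of maximum may be chosen as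
a function of the maximum and of the jet of the angular part. -/
theorem exists_local_coefficients (hd : 0 < d) (hα : 0 < α) (r : ℕ) (ghat : ℝ)
    (J : PointedJet d (2 * r + 2)) :
    ∃ b : ℕ → ℝ, ∀ (g : Euc d → ℝ) (v : Euc d)
      (u : OrthonormalBasis (Fin (d - 1)) ℝ (Submodule.span ℝ {v})ᗮ),
      IsSphereMax α (2 * r + 2) g ghat v → angularJet (2 * r + 2) g v = J →
      tangentDet α g ghat v u ≠ 0 →
      b 0 = (2 * Real.pi) ^ (((d - 1 : ℕ) : ℝ) / 2) *
        |tangentDet α g ghat v u| ^ (-(1 / 2) : ℝ) ∧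
      ∀ᶠ δ in 𝓝[>] (0 : ℝ), (fun ρ : ℝ => ρ ^ (d - 1) * (Real.exp (ρ ^ 2 / 2) *
          sectorIntegral α g ghat v δ ρ) - ∑ i ∈ Finset.range (r + 1), b i * ρ⁻¹ ^ (2 * i))
        =o[atTop] fun ρ => ρ⁻¹ ^ (2 * r) := by
  by_cases hex : ∃ (g : Euc d → ℝ) (v : Euc d)
      (u : OrthonormalBasis (Fin (d - 1)) ℝ (Submodule.span ℝ {v})ᗮ),
      IsSphereMax α (2 * r + 2) g ghat v ∧ angularJet (2 * r + 2) g v = J ∧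
      tangentDet α g ghat v u ≠ 0
  -- One function realizing the jet fixes the coefficients for all others. A jet without admissible
  -- realization imposes nothing and receives `0`.
  · obtain ⟨g₀, v₀, u₀, h₀, hJ₀, hdet₀⟩ := hex
    obtain ⟨b, -, hb⟩ := h₀.exists_sectorIntegral_expansion u₀ hd hα r hdet₀
    refine ⟨b, fun g v u h hJ hdet => ?_⟩
    obtain rfl : v = v₀ := congrArg Prod.fst (hJ.trans hJ₀.symm)
    have h1 := hb g h (hJ.trans hJ₀.symm)
    -- The frame `u` may differ from `u₀`, so the formula for `b 0` in terms of `u` comes from a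
    -- second expansion, compared with the first at a common `δ`.
    obtain ⟨b', hb0', hb'⟩ := h.exists_sectorIntegral_expansion u hd hα r hdet
    obtain ⟨δ, h2, h3⟩ := (h1.and (hb' g h rfl)).exists
    refine ⟨?_, h1⟩
    rw [← hb0']
    exact tendsto_nhds_unique (tendsto_of_sub_sum_isLittleO h2) (tendsto_of_sub_sum_isLittleO h3)
  · refine ⟨0, fun g v u h hJ hdet => (hex ⟨g, v, u, h, hJ, hdet⟩).elim⟩

end Sector

/-- The density of `(g(η) / ghat) ^ (1 / α)` on the positive half-line. -/
noncomputable def radialDensity {d : ℕ} (α : ℝ) (g : Euc d → ℝ) (ghat ρ : ℝ) : ℝ :=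
  (2 * Real.pi) ^ (-(d : ℝ) / 2) * (ρ ^ (d - 1) *
    (d * ∫ z in Metric.ball (0 : Euc d) 1, radialKernel d α ρ (angularPart g z / ghat)))

/-! ### Localization at the points of maximum and expansion of the radial density -/

section GlobalExpansion

open Asymptotics

variable {d : ℕ} {α : ℝ} {g : Euc d → ℝ} {ghat : ℝ}

theorem densityKernel_eq_radialKernel (hα : 0 < α) (hg : 0 < ghat) {ρ : ℝ} (hρ : 0 < ρ) (c : ℝ) :
    densityKernel d α (ghat * ρ ^ α) c =
      ρ ^ d / (α * (ghat * ρ ^ α)) * radialKernel d α ρ (c / ghat) := by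
  have hx : 0 < ghat * ρ ^ α := by positivity
  unfold densityKernel radialKernel
  rcases lt_or_ge 0 c with hc | hc
  · have ha : 0 < c / ghat := by positivity
    rw [if_pos (by positivity), if_pos ha, abs_of_pos hx]
    set a := c / ghat with hadef
    have e0 : ghat * ρ ^ α / c = ρ ^ α * a⁻¹ := by rw [hadef]; field_simp
    have e1 : (ρ ^ α * a⁻¹) ^ ((d : ℝ) / α) = ρ ^ d * a ^ (-(d : ℝ) / α) := by
      rw [Real.mul_rpow (by positivity) (by positivity), ← Real.rpow_mul hρ.le,
        Real.inv_rpow ha.le, ← Real.rpow_neg ha.le, neg_div, mul_div_cancel₀ _ hα.ne',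
        Real.rpow_natCast]
    have e2 : (ρ ^ α * a⁻¹) ^ (2 / α) = ρ ^ 2 * a ^ (-2 / α) := by
      rw [Real.mul_rpow (by positivity) (by positivity), ← Real.rpow_mul hρ.le,
        Real.inv_rpow ha.le, ← Real.rpow_neg ha.le, neg_div, mul_div_cancel₀ _ hα.ne']
      norm_cast
    rw [e0, e1, e2, neg_div 2 (ρ ^ 2 * a ^ (-2 / α))]
    ring
  · rw [if_neg (not_lt.2 (mul_nonpos_of_nonneg_of_nonpos hx.le hc)),
      if_neg (not_lt.2 (div_nonpos_of_nonpos_of_nonneg hc hg.le)), mul_zero]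

/-- The prefactor is the inverse of the derivative of `ρ ↦ ghat * ρ ^ α`. -/
theorem chaosDensity_eq_radialDensity (hd : 0 < d) (hα : 0 < α) (hg : 0 < ghat) {ρ : ℝ}
    (hρ : 0 < ρ) : chaosDensity α g (ghat * ρ ^ α) =
      ρ / (α * (ghat * ρ ^ α)) * radialDensity α g ghat ρ := by
  simp only [chaosDensity, radialDensity, densityKernel_eq_radialKernel hα hg hρ]
  rw [integral_const_mul, ← pow_sub_one_mul hd.ne' ρ]
  ring

theorem pow_mul_exp_neg_sq_isLittleO {c : ℝ} (hc : 0 < c) (n m : ℕ) :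
    (fun ρ : ℝ => ρ ^ n * Real.exp (-(c * ρ ^ 2))) =o[atTop] fun ρ => ρ⁻¹ ^ m := by
  obtain ⟨K, hK, h⟩ := exists_pow_le_mul_exp_sq (n + m + 1) hc
  have h1 : (fun ρ : ℝ => ρ ^ n * Real.exp (-(c * ρ ^ 2))) =O[atTop] fun ρ => ρ⁻¹ ^ (m + 1) := by
    refine IsBigO.of_bound K ?_
    filter_upwards [eventually_gt_atTop 0] with ρ hρ
    rw [Real.norm_of_nonneg (by positivity), Real.norm_of_nonneg (by positivity), inv_pow,
      ← div_eq_mul_inv, le_div_iff₀ (by positivity), Real.exp_neg]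
    calc ρ ^ n * (Real.exp (c * ρ ^ 2))⁻¹ * ρ ^ (m + 1)
        = ρ ^ (n + m + 1) * (Real.exp (c * ρ ^ 2))⁻¹ := by ring
      _ ≤ K * Real.exp (c * ρ ^ 2) * (Real.exp (c * ρ ^ 2))⁻¹ := by gcongr; exact h ρ hρ.le
      _ = K := by field_simp
  refine h1.trans_isLittleO ?_
  have h2 : (fun ρ : ℝ => ρ⁻¹ ^ m * ρ⁻¹) =o[atTop] fun ρ => ρ⁻¹ ^ m * 1 :=
    (isBigO_refl _ _).mul_isLittleO ((isLittleO_one_iff ℝ).2 tendsto_inv_atTop_zero)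
  simpa only [mul_one, pow_succ] using h2

/-- Away from the points of maximum, the angular part is bounded away from its maximum. -/
theorem exists_angularPart_div_le (hα : 0 < α) (hhom : IsHomogeneousOfOrder α g)
    (hcont : ContinuousOn g {0}ᶜ) (hpos : 0 < ghat) (hle : ∀ ω : Euc d, ‖ω‖ = 1 → g ω ≤ ghat)
    {U : Set (Euc d)} (hU : IsOpen U) (hsmul : ∀ s : ℝ, 0 < s → ∀ z, s • z ∈ U → z ∈ U)
    (hmem : ∀ ω : Euc d, ‖ω‖ = 1 → g ω = ghat → ω ∈ U) :
    ∃ q : ℝ, 1 < q ∧ ∀ z ∉ U, angularPart g z / ghat ≤ q ^ (-α) := by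
  obtain ⟨m, hm0, hm1, hm⟩ : ∃ m : ℝ, 0 < m ∧ m < 1 ∧
      ∀ ω : Euc d, ‖ω‖ = 1 → ω ∉ U → g ω / ghat ≤ m := by
    have hK : IsCompact (Metric.sphere (0 : Euc d) 1 \ U) := (isCompact_sphere 0 1).diff hU
    rcases (Metric.sphere (0 : Euc d) 1 \ U).eq_empty_or_nonempty with he | hne
    · refine ⟨1 / 2, by norm_num, by norm_num, fun ω hω hωU => ?_⟩
      have : ω ∈ Metric.sphere (0 : Euc d) 1 \ U := ⟨mem_sphere_zero_iff_norm.2 hω, hωU⟩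
      rw [he] at this
      exact this.elim
    · have hsub : Metric.sphere (0 : Euc d) 1 \ U ⊆ {0}ᶜ := by
        rintro ω ⟨hω, -⟩ rfl
        simp at hω
      obtain ⟨ω₀, hω₀, hmax⟩ := hK.exists_isMaxOn hne (hcont.mono hsub)
      have hn := mem_sphere_zero_iff_norm.1 hω₀.1
      have hlt : g ω₀ < ghat := lt_of_le_of_ne (hle ω₀ hn) fun h => hω₀.2 (hmem ω₀ hn h)
      -- The maximum with `1 / 2` keeps `m` positive even if `g` is nonpositive off `U`.
      refine ⟨max (g ω₀ / ghat) (1 / 2), by positivity,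
        max_lt ((div_lt_one hpos).2 hlt) (by norm_num), fun ω hω hωU => le_max_of_le_left ?_⟩
      have : g ω ≤ g ω₀ := hmax ⟨mem_sphere_zero_iff_norm.2 hω, hωU⟩
      gcongr
  -- Chosen so that `q ^ (-α) = m`.
  refine ⟨m ^ (-1 / α), Real.one_lt_rpow_of_pos_of_lt_one_of_neg hm0 hm1
    (div_neg_of_neg_of_pos (by norm_num) hα), fun z hz => ?_⟩
  rw [← Real.rpow_mul hm0.le, show -1 / α * -α = 1 by field_simp, Real.rpow_one]
  rcases eq_or_ne z 0 with rfl | hz0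
  · rw [angularPart, smul_zero, hhom.map_zero hα, zero_div]
    exact hm0.le
  · have hn : 0 < ‖z‖⁻¹ := inv_pos.2 (norm_pos_iff.2 hz0)
    refine hm _ ?_ fun h => hz (hsmul _ hn z h)
    rw [norm_smul, norm_inv, norm_norm, inv_mul_cancel₀ (norm_ne_zero_iff.2 hz0)]

theorem angularPart_div_le_one (hα : 0 < α) (hhom : IsHomogeneousOfOrder α g)
    (hpos : 0 < ghat) (hle : ∀ ω : Euc d, ‖ω‖ = 1 → g ω ≤ ghat) (z : Euc d) :
    angularPart g z / ghat ≤ 1 := by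
  rcases eq_or_ne z 0 with rfl | hz0
  · rw [angularPart, smul_zero, hhom.map_zero hα, zero_div]
    exact zero_le_one
  · rw [div_le_one hpos]
    exact hle _ (by rw [norm_smul, norm_inv, norm_norm, inv_mul_cancel₀ (norm_ne_zero_iff.2 hz0)])

/-- The expansion of the radial density, from the expansions at the points of maximum. -/
theorem radialDensity_expansion (hα : 0 < α) (hhom : IsHomogeneousOfOrder α g)
    (hcont : ContinuousOn g {0}ᶜ) (hpos : 0 < ghat) (hle : ∀ ω : Euc d, ‖ω‖ = 1 → g ω ≤ ghat)
    {k : ℕ} {v : Fin k → Euc d} (hinj : Function.Injective v)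
    (hv : Set.range v = sphereLevelSet g ghat) {r : ℕ} {b : Fin k → ℕ → ℝ}
    (hb : ∀ j, ∀ᶠ δ in 𝓝[>] (0 : ℝ), (fun ρ : ℝ => ρ ^ (d - 1) * (Real.exp (ρ ^ 2 / 2) *
        sectorIntegral α g ghat (v j) δ ρ) - ∑ i ∈ Finset.range (r + 1), b j i * ρ⁻¹ ^ (2 * i))
      =o[atTop] fun ρ => ρ⁻¹ ^ (2 * r)) :
    (fun ρ : ℝ => Real.exp (ρ ^ 2 / 2) * radialDensity α g ghat ρ - ∑ i ∈ Finset.range (r + 1),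
        ((2 * Real.pi) ^ (-(d : ℝ) / 2) * ∑ j, b j i) * ρ⁻¹ ^ (2 * i))
      =o[atTop] fun ρ => ρ⁻¹ ^ (2 * r) := by
  have hvj : ∀ j, ‖v j‖ = 1 ∧ g (v j) = ghat := fun j => by
    have : v j ∈ sphereLevelSet g ghat := hv ▸ Set.mem_range_self j
    exact ⟨mem_sphere_zero_iff_norm.1 this.1, this.2⟩
  have hsep : ∀ᶠ δ in 𝓝[>] (0 : ℝ), ∀ i j, i ≠ j → 2 * δ ≤ ‖v i - v j‖ := by
    refine eventually_all.2 fun i => eventually_all.2 fun j => ?_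
    rcases eq_or_ne i j with hij | hij
    · exact Eventually.of_forall fun δ h => (h hij).elim
    · have : 0 < ‖v i - v j‖ / 2 := half_pos (norm_pos_iff.2 (sub_ne_zero.2 (hinj.ne hij)))
      filter_upwards [Ioo_mem_nhdsGT this] with δ hδ _
      linarith [hδ.2]
  obtain ⟨δ, ⟨hδb, hδs⟩, hδ0⟩ :=
    (((eventually_all.2 hb).and hsep).and self_mem_nhdsWithin).exists
  have hδ : 0 < δ := hδ0
  set U : Set (Euc d) := ⋃ j, sector (v j) δ with hU
  have hUo : IsOpen U := isOpen_iUnion fun j => isOpen_sector _ _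
  obtain ⟨q, hq, hqle⟩ := exists_angularPart_div_le hα hhom hcont hpos hle hUo
    (fun s hs z hz => by
      obtain ⟨j, hj⟩ := Set.mem_iUnion.1 hz
      exact Set.mem_iUnion.2 ⟨j, (smul_mem_sector_iff hs).1 hj⟩)
    (fun ω hω hgω => by
      have : ω ∈ Set.range v := hv ▸ ⟨mem_sphere_zero_iff_norm.2 hω, hgω⟩
      obtain ⟨j, rfl⟩ := this
      exact Set.mem_iUnion.2 ⟨j, self_mem_sector hω hδ⟩)
  have hgm : Measurable g := measurable_of_continuousOn_compl_singleton 0 hcont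
  set f : ℝ → Euc d → ℝ := fun ρ z => radialKernel d α ρ (angularPart g z / ghat) with hf
  have hint : ∀ ρ : ℝ, 1 ≤ ρ → IntegrableOn (f ρ) (Metric.ball 0 1) := fun ρ hρ =>
    integrableOn_radialKernel hα hgm (angularPart_div_le_one hα hhom hpos hle) hρ
  obtain ⟨K, hK, hKle⟩ := exists_radialKernel_le d hα
  set R : ℝ → ℝ := fun ρ => ∫ z in Metric.ball (0 : Euc d) 1 \ U, f ρ z with hR
  have hsplit : ∀ ρ : ℝ, 1 ≤ ρ → d * ∫ z in Metric.ball (0 : Euc d) 1, f ρ z =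
      ∑ j, sectorIntegral α g ghat (v j) δ ρ + d * R ρ := by
    intro ρ hρ
    have h1 := integral_inter_add_sdiff hUo.measurableSet (hint ρ hρ)
    have h2 : ∫ z in Metric.ball (0 : Euc d) 1 ∩ U, f ρ z =
        ∑ j, ∫ z in Metric.ball (0 : Euc d) 1 ∩ sector (v j) δ, f ρ z := by
      rw [hU, Set.inter_iUnion]
      refine integral_iUnion_fintype (fun j => ?_) (fun i j hij => ?_) fun j => ?_
      · exact Metric.isOpen_ball.measurableSet.inter (measurableSet_sector _ _)
      · exact (disjoint_sector (hvj i).1 (hvj j).1 hδ (hδs i j hij)).mono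
          Set.inter_subset_right Set.inter_subset_right
      · exact (hint ρ hρ).mono_set Set.inter_subset_left
    rw [← h1, h2, mul_add, Finset.mul_sum]
    rfl
  have hrest : (fun ρ : ℝ => ρ ^ (d - 1) * (Real.exp (ρ ^ 2 / 2) * (d * R ρ))) =o[atTop]
      fun ρ => ρ⁻¹ ^ (2 * r) := by
    set V := (volume : Measure (Euc d)).real (Metric.ball 0 1)
    have hbound : ∀ ρ : ℝ, 1 ≤ ρ → ‖R ρ‖ ≤ K * Real.exp (-((ρ ^ 2 - 1) * q ^ 2 / 2)) * V := by
      intro ρ hρ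
      have h1 : ‖R ρ‖ ≤ K * Real.exp (-((ρ ^ 2 - 1) * q ^ 2 / 2)) *
          (volume : Measure (Euc d)).real (Metric.ball 0 1 \ U) := by
        refine norm_setIntegral_le_of_norm_le_const ((measure_mono Set.sdiff_subset).trans_lt
          measure_ball_lt_top) fun z hz => ?_
        rw [Real.norm_of_nonneg (radialKernel_nonneg _ _ _ _)]
        exact hKle ρ _ q hρ hq.le (hqle z hz.2)
      refine h1.trans ?_
      have : (volume : Measure (Euc d)).real (Metric.ball 0 1 \ U) ≤ V :=
        measureReal_mono Set.sdiff_subset measure_ball_lt_top.ne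
      gcongr
    -- Against the growth `exp (ρ ^ 2 / 2)`, the bound `exp (-((ρ ^ 2 - 1) * q ^ 2 / 2))` leaves the
    -- decay rate `(q ^ 2 - 1) / 2`.
    have hc : 0 < (q ^ 2 - 1) / 2 := by nlinarith
    refine IsBigO.trans_isLittleO (IsBigO.of_bound (d * (K * V * Real.exp (q ^ 2 / 2))) ?_)
      (pow_mul_exp_neg_sq_isLittleO hc (d - 1) (2 * r))
    filter_upwards [eventually_ge_atTop 1] with ρ hρ
    have hρ0 : 0 < ρ := by linarith
    have hn : ‖ρ ^ (d - 1) * Real.exp (-((q ^ 2 - 1) / 2 * ρ ^ 2))‖ =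
        ρ ^ (d - 1) * Real.exp (-((q ^ 2 - 1) / 2 * ρ ^ 2)) :=
      Real.norm_of_nonneg (by positivity)
    rw [hn, norm_mul, norm_mul, norm_mul, Real.norm_of_nonneg (by positivity : 0 ≤ ρ ^ (d - 1)),
      Real.norm_of_nonneg (Real.exp_pos _).le, Real.norm_of_nonneg (Nat.cast_nonneg d)]
    calc ρ ^ (d - 1) * (Real.exp (ρ ^ 2 / 2) * (d * ‖R ρ‖))
        ≤ ρ ^ (d - 1) * (Real.exp (ρ ^ 2 / 2) *
            (d * (K * Real.exp (-((ρ ^ 2 - 1) * q ^ 2 / 2)) * V))) := by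
          gcongr
          exact hbound ρ hρ
      _ = ρ ^ (d - 1) * (d * (K * V)) *
            (Real.exp (ρ ^ 2 / 2) * Real.exp (-((ρ ^ 2 - 1) * q ^ 2 / 2))) := by ring
      _ = ρ ^ (d - 1) * (d * (K * V)) *
            (Real.exp (q ^ 2 / 2) * Real.exp (-((q ^ 2 - 1) / 2 * ρ ^ 2))) := by
          rw [← Real.exp_add, ← Real.exp_add]
          congr 2; ring
      _ = _ := by ring
  have hsum : (fun ρ : ℝ => ∑ j, (ρ ^ (d - 1) * (Real.exp (ρ ^ 2 / 2) *
      sectorIntegral α g ghat (v j) δ ρ) - ∑ i ∈ Finset.range (r + 1), b j i * ρ⁻¹ ^ (2 * i)))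
      =o[atTop] fun ρ => ρ⁻¹ ^ (2 * r) := by
    have := IsLittleO.sum (s := Finset.univ) fun j _ => hδb j
    exact this.congr_left fun ρ => by rw [Finset.sum_apply]
  refine ((hsum.add hrest).const_mul_left ((2 * Real.pi) ^ (-(d : ℝ) / 2))).congr' ?_ .rfl
  filter_upwards [eventually_ge_atTop 1] with ρ hρ
  rw [radialDensity, hsplit ρ hρ, Finset.sum_sub_distrib, Finset.sum_comm]
  simp only [← Finset.mul_sum, ← Finset.sum_mul, mul_assoc]
  ring

end GlobalExpansion

/-- The coefficients of the expansion of `y e ^ (y² / 2) ∫_y^∞ f` when `B` are the coefficients of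
the expansion of `e ^ (ρ² / 2) f(ρ)`. -/
noncomputable def tailCoeff (B : ℕ → ℝ) : ℕ → ℝ
  | 0 => B 0
  | i + 1 => B (i + 1) - (2 * i + 1) * tailCoeff B i

/-! ### From an expansion of the density to one of the tail -/

section Tail

open Asymptotics

/-- The recursion makes the sum telescope. The one surviving extra term, of degree `2 * r + 2`, is
negligible at order `2 * r` as `x → 0`. -/
theorem sum_tailCoeff (B : ℕ → ℝ) (r : ℕ) (x : ℝ) :
    ∑ i ∈ Finset.range (r + 1), (tailCoeff B i * x ^ (2 * i) +
      (2 * i + 1) * tailCoeff B i * x ^ (2 * i + 2)) =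
    ∑ i ∈ Finset.range (r + 1), B i * x ^ (2 * i) +
      (2 * r + 1) * tailCoeff B r * x ^ (2 * r + 2) := by
  induction r with
  | zero => simp [tailCoeff]
  | succ r ih =>
    rw [Finset.sum_range_succ, ih, Finset.sum_range_succ _ (r + 1)]
    simp only [tailCoeff]
    push_cast
    ring

theorem hasDerivAt_inv_pow_mul_exp (n : ℕ) {y : ℝ} (hy : y ≠ 0) :
    HasDerivAt (fun y : ℝ => y⁻¹ ^ (n + 1) * Real.exp (-(y ^ 2 / 2)))
      (-(Real.exp (-(y ^ 2 / 2)) * (y⁻¹ ^ n + (n + 1) * y⁻¹ ^ (n + 2)))) y := by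
  have h1 := (hasDerivAt_inv hy).pow (n + 1)
  have h2 : HasDerivAt (fun y : ℝ => Real.exp (-(y ^ 2 / 2))) (Real.exp (-(y ^ 2 / 2)) *
      (-(2 * y / 2))) y := by
    have := ((hasDerivAt_pow 2 y).div_const 2).neg.exp
    simpa using this
  refine (h1.mul h2).congr_deriv ?_
  simp only [Nat.add_sub_cancel, Pi.pow_apply]
  push_cast
  have : (y ^ 2)⁻¹ = y⁻¹ ^ 2 := by rw [inv_pow]
  rw [this]
  have e : y⁻¹ ^ (n + 1) * y = y⁻¹ ^ n := by rw [pow_succ, mul_assoc, inv_mul_cancel₀ hy, mul_one]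
  have : y⁻¹ ^ (n + 1) * (Real.exp (-(y ^ 2 / 2)) * -(2 * y / 2)) =
    -(Real.exp (-(y ^ 2 / 2)) * (y⁻¹ ^ (n + 1) * y)) := by ring
  rw [this, e]
  ring

theorem tendsto_inv_pow_mul_exp (n : ℕ) :
    Tendsto (fun y : ℝ => y⁻¹ ^ (n + 1) * Real.exp (-(y ^ 2 / 2))) atTop (𝓝 0) := by
  have h1 : Tendsto (fun y : ℝ => y⁻¹ ^ (n + 1)) atTop (𝓝 0) := by
    simpa using (tendsto_inv_atTop_zero (𝕜 := ℝ)).pow (n + 1)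
  refine squeeze_zero_norm' ?_ h1
  filter_upwards [eventually_gt_atTop 0] with y hy
  rw [Real.norm_of_nonneg (by positivity)]
  refine mul_le_of_le_one_right (by positivity) (Real.exp_le_one_iff.2 ?_)
  have : 0 ≤ y ^ 2 / 2 := by positivity
  linarith

/-- The integrand is minus the derivative of `y⁻¹ ^ (n + 1) * exp (-(y ^ 2 / 2))`. Such integrands,
having explicit tails, are the building blocks of the comparison function for the tail. -/
theorem integral_inv_pow_mul_exp (n : ℕ) {y : ℝ} (hy : 0 < y) :
    IntegrableOn (fun t : ℝ => Real.exp (-(t ^ 2 / 2)) * (t⁻¹ ^ n + (n + 1) * t⁻¹ ^ (n + 2)))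
        (Set.Ioi y) ∧
      ∫ t in Set.Ioi y, Real.exp (-(t ^ 2 / 2)) * (t⁻¹ ^ n + (n + 1) * t⁻¹ ^ (n + 2)) =
        y⁻¹ ^ (n + 1) * Real.exp (-(y ^ 2 / 2)) := by
  have hd : ∀ t ∈ Set.Ici y, HasDerivAt (fun y : ℝ => y⁻¹ ^ (n + 1) * Real.exp (-(y ^ 2 / 2)))
      (-(Real.exp (-(t ^ 2 / 2)) * (t⁻¹ ^ n + (n + 1) * t⁻¹ ^ (n + 2)))) t := fun t ht =>
    hasDerivAt_inv_pow_mul_exp n (hy.trans_le ht).ne'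
  have hneg : ∀ t ∈ Set.Ioi y,
      -(Real.exp (-(t ^ 2 / 2)) * (t⁻¹ ^ n + (n + 1) * t⁻¹ ^ (n + 2))) ≤ 0 := fun t ht => by
    have : 0 < t := hy.trans ht
    have : 0 ≤ Real.exp (-(t ^ 2 / 2)) * (t⁻¹ ^ n + (n + 1) * t⁻¹ ^ (n + 2)) := by positivity
    linarith
  have h1 := integrableOn_Ioi_deriv_of_nonpos' hd hneg (tendsto_inv_pow_mul_exp n)
  have h2 := integral_Ioi_of_hasDerivAt_of_nonpos' hd hneg (tendsto_inv_pow_mul_exp n)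
  rw [integral_neg] at h2
  exact ⟨by simpa using h1.neg, by linarith⟩

/-- `f` is compared with a combination `P` of functions with explicit tails, weighted by `tailCoeff`
so that `f` and `P` have the same expansion to order `2 * r`. The tail of `f - P` is then estimated
directly. -/
theorem tail_expansion {f : ℝ → ℝ} {B : ℕ → ℝ} {r : ℕ}
    (hint : ∀ y, 0 < y → IntegrableOn f (Set.Ioi y))
    (hf : (fun ρ : ℝ => Real.exp (ρ ^ 2 / 2) * f ρ - ∑ i ∈ Finset.range (r + 1),
      B i * ρ⁻¹ ^ (2 * i)) =o[atTop] fun ρ => ρ⁻¹ ^ (2 * r)) :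
    (fun y : ℝ => y * Real.exp (y ^ 2 / 2) * (∫ t in Set.Ioi y, f t) -
        ∑ i ∈ Finset.range (r + 1), tailCoeff B i * y⁻¹ ^ (2 * i)) =o[atTop]
      fun y => y⁻¹ ^ (2 * r) := by
  set k : ℕ → ℝ → ℝ := fun n t =>
    Real.exp (-(t ^ 2 / 2)) * (t⁻¹ ^ n + (n + 1) * t⁻¹ ^ (n + 2)) with hk
  set P : ℝ → ℝ := fun t => ∑ i ∈ Finset.range (r + 1), tailCoeff B i * k (2 * i) t with hP
  have hPint : ∀ y, 0 < y → IntegrableOn P (Set.Ioi y) := fun y hy =>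
    integrable_finsetSum _ fun i _ => ((integral_inv_pow_mul_exp (2 * i) hy).1.const_mul _)
  have hPval : ∀ y, 0 < y → y * Real.exp (y ^ 2 / 2) * ∫ t in Set.Ioi y, P t =
      ∑ i ∈ Finset.range (r + 1), tailCoeff B i * y⁻¹ ^ (2 * i) := by
    intro y hy
    simp only [hP]
    rw [integral_finsetSum _ fun i _ => ((integral_inv_pow_mul_exp (2 * i) hy).1.const_mul _),
      Finset.mul_sum]
    refine Finset.sum_congr rfl fun i _ => ?_
    rw [integral_const_mul, (integral_inv_pow_mul_exp (2 * i) hy).2, Real.exp_neg, pow_succ y⁻¹]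
    have hE := (Real.exp_pos (y ^ 2 / 2)).ne'
    calc _ = tailCoeff B i * y⁻¹ ^ (2 * i) * (y * y⁻¹) *
          (Real.exp (y ^ 2 / 2) * (Real.exp (y ^ 2 / 2))⁻¹) := by ring
      _ = _ := by rw [mul_inv_cancel₀ hy.ne', mul_inv_cancel₀ hE, mul_one, mul_one]
  have hPeq : ∀ t, Real.exp (t ^ 2 / 2) * P t = ∑ i ∈ Finset.range (r + 1), B i * t⁻¹ ^ (2 * i) +
      (2 * r + 1) * tailCoeff B r * t⁻¹ ^ (2 * r + 2) := by
    intro t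
    rw [← sum_tailCoeff, hP, Finset.mul_sum]
    refine Finset.sum_congr rfl fun i _ => ?_
    simp only [hk]
    rw [Real.exp_neg]
    push_cast
    field_simp
  have hDo : (fun t : ℝ => Real.exp (t ^ 2 / 2) * (f t - P t)) =o[atTop]
      fun t => t⁻¹ ^ (2 * r) := by
    have h0 : Tendsto (fun t : ℝ => (2 * r + 1) * tailCoeff B r * t⁻¹ ^ 2) atTop (𝓝 0) := by
      simpa using ((tendsto_inv_atTop_zero (𝕜 := ℝ)).pow 2).const_mul ((2 * r + 1) * tailCoeff B r)
    have h1 : (fun t : ℝ => t⁻¹ ^ (2 * r) * ((2 * r + 1) * tailCoeff B r * t⁻¹ ^ 2)) =o[atTop]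
        fun t => t⁻¹ ^ (2 * r) * 1 :=
      (isBigO_refl _ _).mul_isLittleO ((isLittleO_one_iff ℝ).2 h0)
    simp only [mul_one] at h1
    refine (hf.sub h1).congr_left fun t => ?_
    rw [mul_sub, hPeq]
    ring
  refine IsLittleO.of_bound fun ε hε => ?_
  obtain ⟨y₀, hy₀⟩ := eventually_atTop.1 (hDo.def hε)
  filter_upwards [eventually_ge_atTop y₀, eventually_gt_atTop 0] with y hy hy0
  rw [← hPval y hy0, ← mul_sub, ← integral_sub (hint y hy0) (hPint y hy0)]
  have hbound : ‖∫ t in Set.Ioi y, (f t - P t)‖ ≤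
      ∫ t in Set.Ioi y, ε * y⁻¹ ^ (2 * r) * (y⁻¹ * (t * Real.exp (-(t ^ 2 / 2)))) := by
    have hti : IntegrableOn (fun t : ℝ => t * Real.exp (-(t ^ 2 / 2))) (Set.Ioi y) := by
      have := (integrable_mul_exp_neg_mul_sq (b := 1 / 2) (by norm_num)).integrableOn
        (s := Set.Ioi y)
      refine this.congr_fun (fun t _ => ?_) measurableSet_Ioi
      simp only
      congr 2; ring
    refine norm_integral_le_of_norm_le ((hti.const_mul _).const_mul _) ?_
    refine (ae_restrict_mem measurableSet_Ioi).mono fun t ht => ?_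
    have ht' : y < t := ht
    have ht0 : 0 < t := hy0.trans ht'
    have h1 := hy₀ t (hy.trans ht'.le)
    have hn : ‖t⁻¹ ^ (2 * r)‖ = t⁻¹ ^ (2 * r) := Real.norm_of_nonneg (by positivity)
    rw [norm_mul, Real.norm_of_nonneg (Real.exp_pos _).le, hn] at h1
    have h2 : ‖f t - P t‖ ≤ ε * t⁻¹ ^ (2 * r) * Real.exp (-(t ^ 2 / 2)) := by
      rw [Real.exp_neg, ← div_eq_mul_inv, le_div_iff₀ (Real.exp_pos _), mul_comm]
      exact h1
    refine h2.trans ?_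
    -- Inserting this factor makes the Gaussian bound explicitly integrable and yields the `y⁻¹`
    -- that compensates the prefactor `y`.
    have h3 : (1 : ℝ) ≤ y⁻¹ * t := by
      rw [inv_mul_eq_div, one_le_div hy0]
      exact ht'.le
    calc ε * t⁻¹ ^ (2 * r) * Real.exp (-(t ^ 2 / 2))
        ≤ ε * y⁻¹ ^ (2 * r) * (1 * Real.exp (-(t ^ 2 / 2))) := by
          rw [one_mul]; gcongr
      _ ≤ ε * y⁻¹ ^ (2 * r) * (y⁻¹ * t * Real.exp (-(t ^ 2 / 2))) := by gcongr
      _ = _ := by ring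
  have hexp : ∫ t in Set.Ioi y, t * Real.exp (-(t ^ 2 / 2)) = Real.exp (-(y ^ 2 / 2)) := by
    have hd : ∀ t ∈ Set.Ici y, HasDerivAt (fun y : ℝ => Real.exp (-(y ^ 2 / 2)))
        (-(t * Real.exp (-(t ^ 2 / 2)))) t := fun t _ => by
      refine ((hasDerivAt_pow 2 t).div_const 2).neg.exp.congr_deriv ?_
      simp
      ring
    have hneg : ∀ t ∈ Set.Ioi y, -(t * Real.exp (-(t ^ 2 / 2))) ≤ 0 := fun t ht => by
      have : 0 < t := hy0.trans ht
      have : 0 ≤ t * Real.exp (-(t ^ 2 / 2)) := by positivity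
      linarith
    have hlim : Tendsto (fun y : ℝ => Real.exp (-(y ^ 2 / 2))) atTop (𝓝 0) := by
      refine Real.tendsto_exp_neg_atTop_nhds_zero.comp ?_
      exact (tendsto_pow_atTop two_ne_zero).atTop_div_const two_pos
    have h2 := integral_Ioi_of_hasDerivAt_of_nonpos' hd hneg hlim
    rw [integral_neg] at h2
    linarith
  rw [integral_const_mul, integral_const_mul, hexp] at hbound
  have hn : ‖y⁻¹ ^ (2 * r)‖ = y⁻¹ ^ (2 * r) := Real.norm_of_nonneg (by positivity)
  have hn' : ‖y * Real.exp (y ^ 2 / 2)‖ = y * Real.exp (y ^ 2 / 2) :=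
    Real.norm_of_nonneg (by positivity)
  rw [norm_mul, hn, hn']
  calc y * Real.exp (y ^ 2 / 2) * ‖∫ t in Set.Ioi y, (f t - P t)‖
      ≤ y * Real.exp (y ^ 2 / 2) * (ε * y⁻¹ ^ (2 * r) * (y⁻¹ * Real.exp (-(y ^ 2 / 2)))) := by
        gcongr
    _ = ε * y⁻¹ ^ (2 * r) := by
        rw [Real.exp_neg]
        field_simp

end Tail

/-! ### Return to the variable `x = ghat * ρ ^ α` -/

section Substitution

open Asymptotics

variable {d : ℕ} {α : ℝ} {g : Euc d → ℝ} {ghat : ℝ}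

theorem image_mul_rpow_Ioi (hα : 0 < α) (hpos : 0 < ghat) {y : ℝ} (hy : 0 < y) :
    (fun ρ : ℝ => ghat * ρ ^ α) '' Set.Ioi y = Set.Ioi (ghat * y ^ α) := by
  ext t
  constructor
  · rintro ⟨ρ, hρ, rfl⟩
    have : y ^ α < ρ ^ α := Real.rpow_lt_rpow hy.le hρ hα
    exact mul_lt_mul_of_pos_left this hpos
  · intro ht
    have ht' : y ^ α < t / ghat := by
      rw [lt_div_iff₀ hpos, mul_comm]
      exact ht
    have h0 : 0 < t / ghat := (Real.rpow_pos_of_pos hy α).trans ht'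
    refine ⟨(t / ghat) ^ (1 / α), ?_, ?_⟩
    · have h1 := Real.rpow_lt_rpow (by positivity) ht' (one_div_pos.2 hα)
      rwa [← Real.rpow_mul hy.le, mul_one_div_cancel hα.ne', Real.rpow_one] at h1
    · simp only
      rw [← Real.rpow_mul h0.le, one_div_mul_cancel hα.ne', Real.rpow_one]
      field_simp

theorem chaosTail_eq_integral_radialDensity (hd : 0 < d) (hα : 0 < α)
    (hhom : IsHomogeneousOfOrder α g) (hg : Measurable g) (hpos : 0 < ghat) {y : ℝ} (hy : 0 < y) :
    chaosTail g (ghat * y ^ α) = ∫ ρ in Set.Ioi y, radialDensity α g ghat ρ ∧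
      IntegrableOn (radialDensity α g ghat) (Set.Ioi y) := by
  obtain ⟨h1, h2⟩ := chaosTail_eq_integral hα hd hhom hg (x := ghat * y ^ α) (by positivity)
  have hder : ∀ ρ ∈ Set.Ioi y, HasDerivWithinAt (fun ρ : ℝ => ghat * ρ ^ α)
      (ghat * (α * ρ ^ (α - 1))) (Set.Ioi y) ρ := fun ρ hρ =>
    ((Real.hasDerivAt_rpow_const (Or.inl (hy.trans hρ).ne')).const_mul ghat).hasDerivWithinAt
  have hinj : Set.InjOn (fun ρ : ℝ => ghat * ρ ^ α) (Set.Ioi y) := by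
    intro a ha b hb hab
    have ha0 : 0 < a := hy.trans ha
    have hb0 : 0 < b := hy.trans hb
    exact (Real.rpow_left_inj ha0.le hb0.le hα.ne').1 (mul_left_cancel₀ hpos.ne' hab)
  have heq : Set.EqOn (fun ρ : ℝ => |ghat * (α * ρ ^ (α - 1))| • chaosDensity α g (ghat * ρ ^ α))
      (radialDensity α g ghat) (Set.Ioi y) := by
    intro ρ hρ
    have hρ0 : 0 < ρ := hy.trans hρ
    simp only
    rw [chaosDensity_eq_radialDensity hd hα hpos hρ0, abs_of_pos (by positivity), smul_eq_mul,
      Real.rpow_sub_one hρ0.ne']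
    have : 0 < ρ ^ α := by positivity
    field_simp
  rw [← image_mul_rpow_Ioi hα hpos hy] at h1 h2
  rw [integral_image_eq_integral_abs_deriv_smul measurableSet_Ioi hder hinj] at h1
  rw [integrableOn_image_iff_integrableOn_abs_deriv_smul measurableSet_Ioi hder hinj] at h2
  exact ⟨h1.trans (setIntegral_congr_fun measurableSet_Ioi heq),
    h2.congr_fun heq measurableSet_Ioi⟩

theorem inv_rpow_pow_eq (hpos : 0 < ghat) {x : ℝ} (hx : 0 < x) (i : ℕ) :
    ((x / ghat) ^ (1 / α))⁻¹ ^ (2 * i) =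
      ghat ^ (2 * (i : ℝ) / α) * x ^ (-(2 * (i : ℝ)) / α) := by
  have h0 : 0 < x / ghat := by positivity
  rw [← Real.rpow_neg h0.le, ← Real.rpow_natCast, ← Real.rpow_mul h0.le,
    Real.div_rpow hx.le hpos.le, div_eq_mul_inv, ← Real.rpow_neg hpos.le, mul_comm]
  congr 2 <;> · push_cast; ring

/-- An expansion in the radial variable, written in the original variable. -/
theorem exists_rescaled_remainder (hα : 0 < α) (hpos : 0 < ghat) {F : ℝ → ℝ} {a : ℕ → ℝ} {r : ℕ}
    (hF : (fun y : ℝ => F y - ∑ i ∈ Finset.range (r + 1), a i * y⁻¹ ^ (2 * i)) =o[atTop]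
      fun y => y⁻¹ ^ (2 * r)) :
    ∃ ε : ℝ → ℝ, ε =o[atTop] (fun x : ℝ => x ^ (-(2 * (r : ℝ)) / α)) ∧
      ∀ x, 0 < x → F ((x / ghat) ^ (1 / α)) = a 0 + ∑ i ∈ Finset.Icc 1 r,
        a i * ghat ^ (2 * (i : ℝ) / α) * x ^ (-(2 * (i : ℝ)) / α) + ε x := by
  have hy : Tendsto (fun x : ℝ => (x / ghat) ^ (1 / α)) atTop atTop :=
    (tendsto_rpow_atTop (one_div_pos.2 hα)).comp (tendsto_id.atTop_div_const hpos)
  refine ⟨_, (hF.comp_tendsto hy).trans_isBigO ?_, fun x hx => ?_⟩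
  · refine IsBigO.of_bound (ghat ^ (2 * (r : ℝ) / α)) ?_
    filter_upwards [eventually_gt_atTop 0] with x hx
    simp only [Function.comp_apply]
    rw [inv_rpow_pow_eq hpos hx, norm_mul,
      Real.norm_of_nonneg (by positivity : 0 ≤ ghat ^ (2 * (r : ℝ) / α))]
  · have e : Finset.range (r + 1) = insert 0 (Finset.Icc 1 r) := by
      ext i
      simp only [Finset.mem_range, Finset.mem_insert, Finset.mem_Icc]
      omega
    simp only [Function.comp_apply]
    rw [e, Finset.sum_insert (by simp)]
    simp only [inv_rpow_pow_eq hpos hx]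
    simp only [mul_assoc]
    simp

end Substitution

/-! ### Main theorem -/

theorem theorem1 (d : ℕ) (hd : 2 ≤ d) (α : ℝ) (hα : 0 < α) (r : ℕ) :
    -- the coefficients of the tail expansion, as functions of `ghat` and of the derivatives
    -- of the restriction of `g` to the sphere at the points of maximum
    ∃ h : ℝ → Set (PointedJet d (2 * r + 2)) → ℕ → ℝ,
      ∀ (g : Euc d → ℝ), IsHomogeneousOfOrder α g →
        ContDiffOn ℝ ((2 * r + 2 : ℕ) : WithTop ℕ∞) g {0}ᶜ →
      ∀ (ghat : ℝ), IsGreatest (g '' Metric.sphere (0 : Euc d) 1) ghat → 0 < ghat →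
      ∀ (k : ℕ) (v : Fin k → Euc d), Function.Injective v →
        Set.range v = sphereLevelSet g ghat →
      ∀ (u : (j : Fin k) → OrthonormalBasis (Fin (d - 1)) ℝ (Submodule.span ℝ {v j})ᗮ),
        (∀ j, tangentDet α g ghat (v j) (u j) ≠ 0) →
      ∃ (h₀ : ℝ) (c : ℕ → ℝ),
        h₀ = 1 / Real.sqrt (2 * Real.pi) *
          ∑ j, |tangentDet α g ghat (v j) (u j)| ^ (-(1 / 2) : ℝ) ∧
        c = h ghat (Set.range fun j => angularJet (2 * r + 2) g (v j)) ∧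
        c 0 = h₀ ∧
        (∃ ε : ℝ → ℝ,
          ε =o[atTop] (fun x : ℝ => x ^ (-(2 * (r : ℝ)) / α)) ∧
          ∀ᶠ x in atTop, chaosTail g x =
            (x / ghat) ^ (-1 / α) * Real.exp (-(x / ghat) ^ (2 / α) / 2) *
              (h₀ + ∑ i ∈ Finset.Icc 1 r, c i * x ^ (-(2 * (i : ℝ)) / α) + ε x)) ∧
        (∃ p : ℝ → ℝ, IsContinuousDensityOffZero (chaosLaw g) p ∧
          ∃ (c' : ℕ → ℝ) (ε : ℝ → ℝ),
            ε =o[atTop] (fun x : ℝ => x ^ (-(2 * (r : ℝ)) / α)) ∧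
            ∀ᶠ x in atTop, p x =
              (x / ghat) ^ (1 / α - 1) * Real.exp (-(x / ghat) ^ (2 / α) / 2) *
                (h₀ / (α * ghat) + ∑ i ∈ Finset.Icc 1 r, c' i * x ^ (-(2 * (i : ℝ)) / α)
                  + ε x)) := by

  have hd0 : 0 < d := by omega
  choose b hb using fun (ghat : ℝ) (J : PointedJet d (2 * r + 2)) =>
    exists_local_coefficients hd0 hα r ghat J
  -- The jets are given as a set, hence the `finsum` over that set. The factor `ghat ^ (2 * i / α)`
  -- turns powers of `x / ghat` into powers of `x`.
  refine ⟨fun ghat 𝒥 i => tailCoeff (fun i => (2 * Real.pi) ^ (-(d : ℝ) / 2) *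
    ∑ᶠ J ∈ 𝒥, b ghat J i) i * ghat ^ (2 * (i : ℝ) / α), ?_⟩
  intro g hhom hC ghat hmax hpos k v hinj hv u hdet
  have hle : ∀ ω : Euc d, ‖ω‖ = 1 → g ω ≤ ghat := fun ω hω =>
    hmax.2 ⟨ω, mem_sphere_zero_iff_norm.2 hω, rfl⟩
  have hmaxj : ∀ j, IsSphereMax α (2 * r + 2) g ghat (v j) := fun j => by
    have hj : v j ∈ sphereLevelSet g ghat := hv ▸ Set.mem_range_self j
    exact ⟨hhom, hC, mem_sphere_zero_iff_norm.1 hj.1, hj.2, hle, hpos⟩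
  have hg : Measurable g := measurable_of_contDiffOn_compl hC
  set J : Fin k → PointedJet d (2 * r + 2) := fun j => angularJet (2 * r + 2) g (v j) with hJ
  -- The base point is part of the jet, so distinct points of maximum give distinct jets and the sum
  -- over the set loses no term.
  have hJinj : Function.Injective J := fun i j hij => hinj (congrArg Prod.fst hij)
  have hloc := fun j => hb ghat (J j) g (v j) (u j) (hmaxj j) rfl (hdet j)
  have hsum : ∀ i, ∑ᶠ K ∈ Set.range J, b ghat K i = ∑ j, b ghat (J j) i := fun i => by
    rw [finsum_mem_range hJinj, finsum_eq_sum_of_fintype]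
  simp only [hsum]
  set B : ℕ → ℝ := fun i => (2 * Real.pi) ^ (-(d : ℝ) / 2) * ∑ j, b ghat (J j) i with hB
  have hrad := radialDensity_expansion hα hhom hC.continuousOn hpos hle hinj hv
    fun j => (hloc j).2
  have htail := tail_expansion (fun y hy =>
    (chaosTail_eq_integral_radialDensity hd0 hα hhom hg hpos hy).2) hrad
  have hB0 : B 0 = 1 / Real.sqrt (2 * Real.pi) *
      ∑ j, |tangentDet α g ghat (v j) (u j)| ^ (-(1 / 2) : ℝ) := by
    simp only [hB, fun j => (hloc j).1]
    -- The powers of `2 * π` combine to the exponent `-d / 2 + (d - 1) / 2 = -1 / 2`.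
    rw [← Finset.mul_sum, ← mul_assoc, ← Real.rpow_add (by positivity), Nat.cast_sub (by omega)]
    congr 1
    rw [Real.sqrt_eq_rpow, one_div ((2 * Real.pi) ^ (1 / 2 : ℝ)), ← Real.rpow_neg (by positivity)]
    congr 1
    push_cast
    ring
  have hx : ∀ x : ℝ, 0 < x → ghat * ((x / ghat) ^ (1 / α)) ^ α = x := fun x hx => by
    rw [← Real.rpow_mul (by positivity), one_div_mul_cancel hα.ne', Real.rpow_one]
    field_simp
  have hsq : ∀ x : ℝ, 0 < x → ((x / ghat) ^ (1 / α)) ^ 2 = (x / ghat) ^ (2 / α) := fun x hx => by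
    rw [← Real.rpow_natCast, ← Real.rpow_mul (by positivity)]
    congr 1
    push_cast
    ring
  refine ⟨B 0, _, hB0, rfl, by simp [tailCoeff, B], ?_, chaosDensity α g,
    isContinuousDensityOffZero_chaosDensity hα hd0 hhom hg,
    fun i => B i * ghat ^ (2 * (i : ℝ) / α) / (α * ghat), ?_⟩
  · obtain ⟨ε, hε, h⟩ := exists_rescaled_remainder hα hpos htail
    refine ⟨ε, hε, ?_⟩
    filter_upwards [eventually_gt_atTop 0] with x hx0
    have h0 : 0 < x / ghat := by positivity
    have h1 := h x hx0
    have h2 := (chaosTail_eq_integral_radialDensity hd0 hα hhom hg hpos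
      (Real.rpow_pos_of_pos h0 (1 / α))).1
    rw [hx x hx0] at h2
    rw [← h2, hsq x hx0] at h1
    have h3 : tailCoeff B 0 = B 0 := rfl
    rw [h3] at h1
    rw [← h1, neg_div, neg_div, Real.rpow_neg h0.le, Real.exp_neg]
    have := (Real.rpow_pos_of_pos h0 (1 / α)).ne'
    field_simp
  · obtain ⟨ε, hε, h⟩ := exists_rescaled_remainder hα hpos hrad
    refine ⟨fun x => ε x / (α * ghat), ?_, ?_⟩
    · simpa only [div_eq_inv_mul] using hε.const_mul_left (α * ghat)⁻¹
    filter_upwards [eventually_gt_atTop 0] with x hx0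
    have h0 : 0 < x / ghat := by positivity
    have h1 := h x hx0
    rw [hsq x hx0] at h1
    have h2 := chaosDensity_eq_radialDensity (g := g) hd0 hα hpos
      (Real.rpow_pos_of_pos h0 (1 / α))
    rw [hx x hx0] at h2
    have h3 : B 0 / (α * ghat) + ∑ i ∈ Finset.Icc 1 r, B i * ghat ^ (2 * (i : ℝ) / α) / (α * ghat) *
        x ^ (-(2 * (i : ℝ)) / α) + ε x / (α * ghat) = (B 0 + ∑ i ∈ Finset.Icc 1 r,
          B i * ghat ^ (2 * (i : ℝ) / α) * x ^ (-(2 * (i : ℝ)) / α) + ε x) / (α * ghat) := by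
      rw [add_div, add_div, Finset.sum_div]
      congr 2
      exact Finset.sum_congr rfl fun i _ => by ring
    rw [h3, ← h1, h2, Real.rpow_sub_one h0.ne', neg_div, Real.exp_neg]
    field_simp
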